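/- Let $\mathcal F$ be an additive category with split idempotents, $\Sigma$ an auto-equivalence (for instance an automorphism) of $\mathcal F$, and $n\ge 3$. An $n$-$\Sigma$-sequence is a sequence of morphisms $X_\bullet=(X_1\xrightarrow{\alpha_1}X_2\xrightarrow{\alpha_2}\cdots\xrightarrow{\alpha_{n-1}}X_n\xrightarrow{\alpha_n}\Sigma X_1)$ in $\mathcal F$; a morphism of such sequences is a family $(\varphi_1,\dots,\varphi_n)$ that commutes with the $\alpha_i$, where $\varphi_{n+1}=\Sigma\varphi_1$. A pre-$n$-angulation of $(\mathcal F,\Sigma)$ is a class of $n$-$\Sigma$-sequences, called $n$-angles, such that: (F1) the class is closed under finite direct sums and under direct summands; it contains $X\xrightarrow{1}X\to 0\to\cdots\to 0\to\Sigma X$ for every $X\in\mathcal F$; and every morphism $X_1\to X_2$ of $\mathcal F$ is the first morphism of some $n$-angle; (F2) $X_\bullet$ is an $n$-angle if and only if its left rotation $X_2\xrightarrow{\alpha_2}\cdots\xrightarrow{\alpha_n}\Sigma X_1\xrightarrow{(-1)^n\Sigma\alpha_1}\Sigma X_2$ is one; (F3) for $n$-angles $X_\bullet$, $Y_\bullet$,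 every pair $\varphi_1:X_1\to Y_1$, $\varphi_2:X_2\to Y_2$ which commutes with the first morphisms extends to a morphism $X_\bullet\to Y_\bullet$. Assume that $(\mathcal F,\Sigma)$ admits at least one pre-$n$-angulation. Let $\operatorname{mod}\mathcal F$ be the category of finitely presented functors $\mathcal F^{\mathrm{op}}\to\mathrm{Ab}$, with the auto-equivalence $\Sigma M=M\circ\Sigma^{-1}$, and let $\underline{\operatorname{mod}}\,\mathcal F$ be its stable category: morphisms are taken modulo those which factor through an injective object of $\operatorname{mod}\mathcal F$. Then every $M\in\operatorname{mod}\mathcal F$ admits a short exact sequence $0\to M\to I_M\to\Omega^{-1}M\to 0$ in $\operatorname{mod}\mathcal F$ with $I_M$ injective. Fix any choice of such sequences. It defines the functor $\Omega^{-1}$ on $\underline{\operatorname{mod}}\,\mathcal F$, its iterates $\Omega^{-n}$, the injective resolutions $\hat I_M=(I_M\to I_{\Omega^{-1}M}\to I_{\Omega^{-2}M}\to\cdots)$, and the natural isomorphism $\sigma:\Sigma\Omega^{-1}\to\Omega^{-1}\Sigma$ of functors on $\underline{\operatorname{mod}}\,\mathcal F$ that is induced on cokernels by extensions $\Sigma I_M\to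 I_{\Sigma M}$ of $1_{\Sigma M}$. An isomorphism of triangle functors $(F,\phi)\to(G,\psi)$, where $\phi:F\Omega^{-1}\cong\Omega^{-1}F$ and $\psi:G\Omega^{-1}\cong\Omega^{-1}G$, is a natural isomorphism $\theta:F\to G$ such that $(\Omega^{-1}\theta_M)\,\phi_M=\psi_M\,\theta_{\Omega^{-1}M}$ for all $M$. If $X_\bullet$ is an $n$-angle of some pre-$n$-angulation and $M=\operatorname{Ker}\mathcal F(-,\alpha_1)$, then $1_M$ lifts to a morphism of complexes from $\mathcal F(-,X_1)\to\cdots\to\mathcal F(-,X_n)$ to $\hat I_M$. By means of the factorization $\mathcal F(-,X_n)\to\Sigma M\to\Sigma\mathcal F(-,X_1)=\mathcal F(-,\Sigma X_1)$ of $\mathcal F(-,\alpha_n)$, in which the second morphism is $\Sigma$ of the inclusion of $M$, it induces a morphism $\delta_{X_\bullet}:\Sigma M\to\Omega^{-n}M$ in $\underline{\operatorname{mod}}\,\mathcal F$. (1) For every pre-$n$-angulation $\mathcal N$ of $(\mathcal F,\Sigma)$ there is exactly one isomorphism of triangle functors $$\delta(\mathcal N):(\Sigma,\sigma)\longrightarrow(\Omega^{-n},(-1)^n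 1_{\Omega^{-n-1}})$$ such that $\delta(\mathcal N)_M=\delta_{X_\bullet}$ for all $X_\bullet\in\mathcal N$ and every kernel $M$ of $\mathcal F(-,\alpha_1)$. (2) The map $\mathcal N\mapsto\delta(\mathcal N)$ is a bijection from the pre-$n$-angulations of $(\mathcal F,\Sigma)$ to the isomorphisms of triangle functors $(\Sigma,\sigma)\to(\Omega^{-n},(-1)^n 1_{\Omega^{-n-1}})$. (3) Consequently the group of automorphisms $g$ of the triangle functor $(\Omega^{-n},(-1)^n1_{\Omega^{-n-1}})$ acts on the pre-$n$-angulations of $(\mathcal F,\Sigma)$ by $\delta(g\cdot\mathcal N)=g\circ\delta(\mathcal N)$, and this action is simply transitive. -/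

import Mathlib

open CategoryTheory CategoryTheory.Limits
open scoped ZeroObject

universe v u

noncomputable section

namespace PreNAng

/-! ### Short exact sequences, the stable category and cosyzygies -/

section Stable

variable {A : Type u} [Category.{v} A] [Preadditive A]

/-- `0 ⟶ K ⟶ J ⟶ B ⟶ 0` is a short exact sequence: `i` is a kernel of `p` and
`p` is a cokernel of `i`. -/
structure IsShortExact {K J B : A} (i : K ⟶ J) (p : J ⟶ B) : Prop where
  w : i ≫ p = 0
  isKernel : Nonempty (IsLimit (KernelFork.ofι i w))
  isCokernel : Nonempty (IsColimit (CokernelCofork.ofπ p w))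

lemma IsShortExact.mono {K J B : A} {i : K ⟶ J} {p : J ⟶ B} (h : IsShortExact i p) : Mono i :=
  mono_of_isLimit_fork h.isKernel.some

lemma IsShortExact.epi {K J B : A} {i : K ⟶ J} {p : J ⟶ B} (h : IsShortExact i p) : Epi p :=
  epi_of_isColimit_cofork h.isCokernel.some

lemma IsShortExact.exists_desc {K J B Z : A} {i : K ⟶ J} {p : J ⟶ B} (h : IsShortExact i p)
    (f : J ⟶ Z) (hf : i ≫ f = 0) : ∃ g : B ⟶ Z, p ≫ g = f :=
  ⟨_, (CokernelCofork.IsColimit.desc' h.isCokernel.some f hf).2⟩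

/-- A choice, for every object `M`, of a short exact sequence
`0 ⟶ M ⟶ I M ⟶ Om M ⟶ 0` with `I M` injective; `Om M` is the cosyzygy `Ω⁻¹ M`. -/
structure CosyzygyChoice (A : Type u) [Category.{v} A] [Preadditive A] where
  I : A → A
  Om : A → A
  ι (M : A) : M ⟶ I M
  π (M : A) : I M ⟶ Om M
  injective (M : A) : Injective (I M)
  shortExact (M : A) : IsShortExact (ι M) (π M)

variable (A) in
/-- Two morphisms are stably equal if their difference factors through an injective object. -/
def stableRel : HomRel A := fun X Y f g =>
  ∃ (J : A) (_ : Injective J) (a : X ⟶ J) (b : J ⟶ Y), f - g = a ≫ b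

lemma stableRel_add [HasBinaryBiproducts A] ⦃X Y : A⦄ (f₁ f₂ g₁ g₂ : X ⟶ Y)
    (hf : stableRel A f₁ f₂) (hg : stableRel A g₁ g₂) :
    stableRel A (f₁ + g₁) (f₂ + g₂) := by
  obtain ⟨J, hJ, a, b, h⟩ := hf
  obtain ⟨J', hJ', a', b', h'⟩ := hg
  refine ⟨J ⊞ J', inferInstance, biprod.lift a a', biprod.desc b b', ?_⟩
  rw [biprod.lift_desc, ← h, ← h']
  abel

instance [HasZeroObject A] [HasBinaryBiproducts A] : Congruence (stableRel A) where
  equivalence := by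
    intro X Y
    refine ⟨fun f => ?_, ?_, ?_⟩
    · exact ⟨0, inferInstance, 0, 0, by simp⟩
    · rintro f g ⟨J, hJ, a, b, h⟩
      exact ⟨J, hJ, a, -b, by rw [Preadditive.comp_neg, ← h]; abel⟩
    · intro f g k h h'
      obtain ⟨J, hJ, a, b, e⟩ := stableRel_add _ _ _ _ h h'
      exact ⟨J, hJ, a, b, by rw [← e]; abel⟩
  comp_left := by
    rintro X Y Z f g g' ⟨J, hJ, a, b, h⟩
    exact ⟨J, hJ, f ≫ a, b, by rw [← Preadditive.comp_sub, h, Category.assoc]⟩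
  comp_right := by
    rintro X Y Z f f' g ⟨J, hJ, a, b, h⟩
    exact ⟨J, hJ, a, b ≫ g, by rw [← Preadditive.sub_comp, h, Category.assoc]⟩

variable (A) in
/-- The stable category of `A`: same objects, and morphisms modulo those which factor through
an injective object. -/
abbrev Stable := CategoryTheory.Quotient (stableRel A)

instance [HasZeroObject A] [HasBinaryBiproducts A] : Preadditive (Stable A) :=
  CategoryTheory.Quotient.preadditive _ stableRel_add

variable (A) in
/-- The projection functor to the stable category. -/
abbrev toStable : A ⥤ Stable A := CategoryTheory.Quotient.functor (stableRel A)

lemma IsShortExact.exists_lift {K J B M I N : A} {i : K ⟶ J} {p : J ⟶ B} (h : IsShortExact i p)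
    {ι : M ⟶ I} {π : I ⟶ N} (w : ι ≫ π = 0) [Injective I] (f : K ⟶ M) :
    ∃ (g : B ⟶ N) (e : J ⟶ I), i ≫ e = f ≫ ι ∧ p ≫ g = e ≫ π := by
  have := h.mono
  obtain ⟨g, hg⟩ := h.exists_desc (Injective.factorThru (f ≫ ι) i ≫ π)
    (by rw [Injective.comp_factorThru_assoc, Category.assoc, w, comp_zero])
  exact ⟨g, _, Injective.comp_factorThru _ _, hg⟩

lemma IsShortExact.lift_unique {K J B M I N : A} {i : K ⟶ J} {p : J ⟶ B} (h : IsShortExact i p)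
    {ι : M ⟶ I} {π : I ⟶ N} (w : ι ≫ π = 0) (hI : Injective I) {f f' : K ⟶ M}
    (hf : stableRel A f f') {g g' : B ⟶ N} {e e' : J ⟶ I}
    (he : i ≫ e = f ≫ ι) (hg : p ≫ g = e ≫ π)
    (he' : i ≫ e' = f' ≫ ι) (hg' : p ≫ g' = e' ≫ π) :
    (toStable A).map g = (toStable A).map g' := by
  have := h.mono
  have := h.epi
  obtain ⟨Q, hQ, a, b, hab⟩ := hf
  obtain ⟨k, hk⟩ := h.exists_desc (e - e' - Injective.factorThru a i ≫ b ≫ ι) (by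
    rw [Preadditive.comp_sub, Preadditive.comp_sub, he, he', Injective.comp_factorThru_assoc,
      ← Preadditive.sub_comp, hab, Category.assoc, sub_self])
  refine CategoryTheory.Quotient.sound _ ⟨I, hI, k, π, ?_⟩
  rw [← cancel_epi p, ← Category.assoc, hk]
  simp [Preadditive.comp_sub, Preadditive.sub_comp, hg, hg', w]

namespace CosyzygyChoice

variable (c : CosyzygyChoice A)

lemma exists_lift {K J B M : A} {i : K ⟶ J} {p : J ⟶ B} (h : IsShortExact i p) (f : K ⟶ M) :
    ∃ (g : B ⟶ c.Om M) (e : J ⟶ c.I M), i ≫ e = f ≫ c.ι M ∧ p ≫ g = e ≫ c.π M :=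
  have := c.injective M
  h.exists_lift (c.shortExact M).w f

/-- Let `0 ⟶ K ⟶ J ⟶ B ⟶ 0` be short exact and `f : K ⟶ M`. Extend `f` to a morphism
`J ⟶ I M`; this is the induced morphism `B ⟶ Om M` on cokernels. Its class in the stable
category does not depend on the extension. -/
def connecting {K J B M : A} {i : K ⟶ J} {p : J ⟶ B} (h : IsShortExact i p) (f : K ⟶ M) :
    B ⟶ c.Om M :=
  (c.exists_lift h f).choose

lemma connecting_spec {K J B M : A} {i : K ⟶ J} {p : J ⟶ B} (h : IsShortExact i p)
    (f : K ⟶ M) : ∃ e : J ⟶ c.I M, i ≫ e = f ≫ c.ι M ∧ p ≫ c.connecting h f = e ≫ c.π M :=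
  (c.exists_lift h f).choose_spec

lemma map_connecting_eq {K J B M : A} {i : K ⟶ J} {p : J ⟶ B} (h : IsShortExact i p)
    {f f' : K ⟶ M} (hf : stableRel A f f') {g : B ⟶ c.Om M} {e : J ⟶ c.I M}
    (he : i ≫ e = f' ≫ c.ι M) (hg : p ≫ g = e ≫ c.π M) :
    (toStable A).map (c.connecting h f) = (toStable A).map g := by
  obtain ⟨e', h₁, h₂⟩ := c.connecting_spec h f
  exact h.lift_unique (c.shortExact M).w (c.injective M) hf h₁ h₂ he hg

variable [HasZeroObject A] [HasBinaryBiproducts A]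

lemma stableRel_refl {X Y : A} (f : X ⟶ Y) : stableRel A f f :=
  Congruence.equivalence.refl f

/-- The functor `Ω⁻¹` from `A` to its stable category. -/
def omPre : A ⥤ Stable A where
  obj M := (toStable A).obj (c.Om M)
  map {M N} f := (toStable A).map (c.connecting (c.shortExact M) f)
  map_id M := by
    rw [← CategoryTheory.Functor.map_id]
    exact c.map_connecting_eq _ (stableRel_refl _) (e := 𝟙 _) (by simp) (by simp)
  map_comp {M N P} f g := by
    obtain ⟨e, h₁, h₂⟩ := c.connecting_spec (c.shortExact M) f
    obtain ⟨e', h₁', h₂'⟩ := c.connecting_spec (c.shortExact N) g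
    rw [← Functor.map_comp]
    refine c.map_connecting_eq _ (stableRel_refl _) (e := e ≫ e') ?_ ?_
    · rw [reassoc_of% h₁, h₁', Category.assoc]
    · rw [reassoc_of% h₂, h₂', Category.assoc]

/-- The cosyzygy functor `Ω⁻¹` on the stable category. -/
def om : Stable A ⥤ Stable A :=
  CategoryTheory.Quotient.lift _ c.omPre (by
    intro M N f g h
    obtain ⟨e, h₁, h₂⟩ := c.connecting_spec (c.shortExact M) g
    exact c.map_connecting_eq _ h h₁ h₂)

/-- The iterates `Ω⁻ᵏ` of the cosyzygy functor: `Ω⁻⁰ = id` and `Ω⁻⁽ᵏ⁺¹⁾ = Ω⁻¹ ∘ Ω⁻ᵏ`. -/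
def omPow : ℕ → (Stable A ⥤ Stable A)
  | 0 => 𝟭 _
  | k + 1 => omPow k ⋙ c.om

/-- The object `Ω⁻ᵏ M` of `A`, that is `Om (Om (⋯ (Om M)))`. -/
def omObj (k : ℕ) (M : A) : A := ((c.omPow k).obj ((toStable A).obj M)).as

/-- The canonical identification `Ω⁻ᵏ ∘ Ω⁻¹ = Ω⁻⁽ᵏ⁺¹⁾ = Ω⁻¹ ∘ Ω⁻ᵏ`; it is the identity of
`Ω⁻⁽ᵏ⁺¹⁾` up to the associativity of the composition of functors. -/
def omPowComm : (k : ℕ) → (c.om ⋙ c.omPow k ≅ c.omPow k ⋙ c.om)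
  | 0 => Functor.rightUnitor _ ≪≫ (Functor.leftUnitor _).symm
  | k + 1 => (Functor.associator _ _ _).symm ≪≫ Functor.isoWhiskerRight (omPowComm k) c.om

end CosyzygyChoice

/-- The automorphism `(-1)ᵏ` of an object. -/
def signIso {D : Type u} [Category.{v} D] [Preadditive D] (k : ℕ) (X : D) : X ≅ X where
  hom := (-1 : ℤ) ^ k • 𝟙 X
  inv := (-1 : ℤ) ^ k • 𝟙 X
  hom_inv_id := by simp [smul_smul, ← mul_pow]
  inv_hom_id := by simp [smul_smul, ← mul_pow]

lemma IsShortExact.map {K J B : A} {i : K ⟶ J} {p : J ⟶ B} (h : IsShortExact i p)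
    (F : A ≌ A) [F.functor.Additive] : IsShortExact (F.functor.map i) (F.functor.map p) where
  w := by rw [← Functor.map_comp, h.w, Functor.map_zero]
  isKernel := ⟨KernelFork.mapIsLimit _ h.isKernel.some F.functor⟩
  isCokernel := ⟨CokernelCofork.mapIsColimit _ h.isCokernel.some F.functor⟩

variable [HasZeroObject A] [HasBinaryBiproducts A]

/-- The functor induced on the stable category by an auto-equivalence. -/
def stableMap (F : A ≌ A) [F.functor.Additive] : Stable A ⥤ Stable A :=
  CategoryTheory.Quotient.lift _ (F.functor ⋙ toStable A) (by
    rintro M N f g ⟨J, hJ, a, b, h⟩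
    exact CategoryTheory.Quotient.sound _ ⟨F.functor.obj J, (F.map_injective_iff J).2 hJ, F.functor.map a,
      F.functor.map b, by rw [← Functor.map_sub, h, Functor.map_comp]⟩)

/-- The canonical morphism `σ_M : F Ω⁻¹ M ⟶ Ω⁻¹ F M`: it is induced on cokernels by an
extension `F (I M) ⟶ I (F M)` of the identity of `F M`. -/
def sigmaMap (F : A ≌ A) [F.functor.Additive] (c : CosyzygyChoice A) (M : A) :
    F.functor.obj (c.Om M) ⟶ c.Om (F.functor.obj M) :=
  c.connecting ((c.shortExact M).map F) (𝟙 (F.functor.obj M))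

lemma isIso_sigmaMap (F : A ≌ A) [F.functor.Additive] (c : CosyzygyChoice A) (M : A) :
    IsIso ((toStable A).map (sigmaMap F c M)) := by
  have h := (c.shortExact M).map F
  have hI : Injective (F.functor.obj (c.I M)) := (F.map_injective_iff _).2 (c.injective M)
  have h' := c.shortExact (F.functor.obj M)
  obtain ⟨e, h₁, h₂⟩ : ∃ e, _ ∧ _ ≫ sigmaMap F c M = _ :=
    c.connecting_spec h (𝟙 (F.functor.obj M))
  obtain ⟨g, e', h₁', h₂'⟩ := h'.exists_lift h.w (𝟙 (F.functor.obj M))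
  rw [Category.id_comp] at h₁ h₁'
  refine ⟨(toStable A).map g, ?_, ?_⟩
  · refine ((toStable A).map_comp _ _).symm.trans (Eq.trans ?_ ((toStable A).map_id _))
    refine h.lift_unique h.w hI (CosyzygyChoice.stableRel_refl (𝟙 _)) (e := e ≫ e')
      (e' := 𝟙 _) ?_ ?_ ?_ ?_
    · rw [reassoc_of% h₁, h₁', Category.id_comp]
    · rw [reassoc_of% h₂, h₂', Category.assoc]
    · rw [Category.comp_id, Category.id_comp]
    · exact (Category.comp_id _).trans (Category.id_comp _).symm
  · refine ((toStable A).map_comp _ _).symm.trans (Eq.trans ?_ ((toStable A).map_id _))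
    refine h'.lift_unique h'.w (c.injective _) (CosyzygyChoice.stableRel_refl (𝟙 _))
      (e := e' ≫ e) (e' := 𝟙 _) ?_ ?_ ?_ ?_
    · rw [reassoc_of% h₁', h₁, Category.id_comp]
    · rw [reassoc_of% h₂', h₂, Category.assoc]
    · rw [Category.comp_id, Category.id_comp]
    · exact (Category.comp_id _).trans (Category.id_comp _).symm

lemma sigmaMap_naturality (F : A ≌ A) [F.functor.Additive] (c : CosyzygyChoice A) {M N : A}
    (f : M ⟶ N) :
    (toStable A).map (F.functor.map (c.connecting (c.shortExact M) f)) ≫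
        (toStable A).map (sigmaMap F c N) =
      (toStable A).map (sigmaMap F c M) ≫
        (toStable A).map (c.connecting (c.shortExact (F.functor.obj M)) (F.functor.map f)) := by
  rw [← Functor.map_comp, ← Functor.map_comp]
  obtain ⟨e, h₁, h₂⟩ := c.connecting_spec (c.shortExact M) f
  obtain ⟨a, h₃, h₄⟩ : ∃ e, _ ∧ _ ≫ sigmaMap F c M = _ :=
    c.connecting_spec ((c.shortExact M).map F) (𝟙 (F.functor.obj M))
  obtain ⟨b, h₅, h₆⟩ : ∃ e, _ ∧ _ ≫ sigmaMap F c N = _ :=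
    c.connecting_spec ((c.shortExact N).map F) (𝟙 (F.functor.obj N))
  obtain ⟨d, h₇, h₈⟩ := c.connecting_spec (c.shortExact (F.functor.obj M)) (F.functor.map f)
  rw [Category.id_comp] at h₃ h₅
  refine ((c.shortExact M).map F).lift_unique (c.shortExact _).w (c.injective _)
    (CosyzygyChoice.stableRel_refl (F.functor.map f)) (e := F.functor.map e ≫ b)
    (e' := a ≫ d) ?_ ?_ ?_ ?_
  · rw [← Functor.map_comp_assoc, h₁, Functor.map_comp_assoc, h₅]
  · rw [← Functor.map_comp_assoc, h₂, Functor.map_comp_assoc, h₆, Category.assoc]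
  · rw [reassoc_of% h₃, h₇]
  · rw [reassoc_of% h₄, h₈, Category.assoc]

/-- The natural isomorphism `σ : F Ω⁻¹ ≅ Ω⁻¹ F` of endofunctors of the stable category. -/
def sigma (F : A ≌ A) [F.functor.Additive] (c : CosyzygyChoice A) :
    c.om ⋙ stableMap F ≅ stableMap F ⋙ c.om :=
  CategoryTheory.Quotient.natIsoLift _ <| NatIso.ofComponents
    (fun M => @asIso _ _ _ _ ((toStable A).map (sigmaMap F c M)) (isIso_sigmaMap F c M))
    (fun f => sigmaMap_naturality F c f)

/-! ### Functors commuting with the suspension -/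

end Stable

section Suspension

variable {D : Type u} [Category.{v} D]

/-- Let `T` be the suspension of `D`. An object is a functor `F : D ⥤ D` with a natural
isomorphism `F T ≅ T F`, as it underlies every triangle functor `D ⥤ D`. -/
structure SuspFunctor (T : D ⥤ D) where
  functor : D ⥤ D
  comm : T ⋙ functor ≅ functor ⋙ T

namespace SuspFunctor

variable {T : D ⥤ D}

/-- A morphism `(F, φ) ⟶ (G, ψ)` of triangle functors: a natural transformation `θ : F ⟶ G`
with `(T θ_X) ∘ φ_X = ψ_X ∘ θ_{T X}` for all `X`. -/
@[ext]
structure Hom (F G : SuspFunctor T) where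
  nat : F.functor ⟶ G.functor
  comm : ∀ X : D, F.comm.hom.app X ≫ T.map (nat.app X) =
    nat.app (T.obj X) ≫ G.comm.hom.app X

instance : Category (SuspFunctor T) where
  Hom := Hom
  id F := ⟨𝟙 _, by intro X; simp⟩
  comp f g := ⟨f.nat ≫ g.nat, by
    intro X
    simp only [NatTrans.comp_app, Functor.map_comp, Category.assoc]
    rw [← g.comm, ← Category.assoc, f.comm, Category.assoc]⟩
  id_comp f := Hom.ext (Category.id_comp _)
  comp_id f := Hom.ext (Category.comp_id _)
  assoc f g h := Hom.ext (Category.assoc _ _ _)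

end SuspFunctor

end Suspension

section

variable {A : Type u} [Category.{v} A] [Preadditive A] [HasZeroObject A] [HasBinaryBiproducts A]

/-- The triangle functor `(F, σ)` on the stable category. -/
def shiftTriangleFunctor (F : A ≌ A) [F.functor.Additive] (c : CosyzygyChoice A) :
    SuspFunctor c.om where
  functor := stableMap F
  comm := sigma F c

/-- The triangle functor `(Ω⁻ⁿ, (-1)ⁿ)` on the stable category. -/
def omTriangleFunctor (c : CosyzygyChoice A) (n : ℕ) : SuspFunctor c.om where
  functor := c.omPow n
  comm := NatIso.ofComponents (fun M => (c.omPowComm n).app M ≪≫ signIso n _) (by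
    intro X Y f
    have := (c.omPowComm n).hom.naturality f
    simp only [Iso.trans_hom, Iso.app_hom, signIso, Preadditive.comp_zsmul, Category.comp_id,
      Preadditive.zsmul_comp, this])

end

/-! ### Finitely presented functors -/

section FinPres

lemma shift_left_inv {C : Type u} [Category.{v} C] (S : C ≌ C) {W X : C} (f : S.inverse.obj W ⟶ X) :
    S.inverse.map (S.counitInv.app W ≫ S.functor.map f) ≫ S.unitInv.app X = f := by
  simp

lemma shift_right_inv {C : Type u} [Category.{v} C] (S : C ≌ C) {W X : C} (g : W ⟶ S.functor.obj X) :
    S.counitInv.app W ≫ S.functor.map (S.inverse.map g ≫ S.unitInv.app X) = g := by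
  simp

variable (C : Type u) [Category.{v} C] [Preadditive C]

/-- `M : Cᵒᵖ ⥤ Ab` is finitely presented if there is an exact sequence
`C(-, X) ⟶ C(-, Y) ⟶ M ⟶ 0`. -/
def isFinPres : ObjectProperty (Cᵒᵖ ⥤ AddCommGrpCat.{v}) := fun M =>
  ∃ (X Y : C) (f : X ⟶ Y) (p : preadditiveYoneda.obj Y ⟶ M)
    (w : preadditiveYoneda.map f ≫ p = 0), Nonempty (IsColimit (CokernelCofork.ofπ p w))

/-- The category `mod C` of finitely presented functors `Cᵒᵖ ⥤ Ab`. -/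
abbrev FinPres := (isFinPres C).FullSubcategory

variable {C}

instance : (isFinPres C).IsClosedUnderIsomorphisms where
  of_iso := by
    rintro M N e ⟨X, Y, f, p, w, ⟨h⟩⟩
    refine ⟨X, Y, f, p ≫ e.hom, by rw [reassoc_of% w, zero_comp], ⟨?_⟩⟩
    exact IsColimit.ofIsoColimit h (Cofork.ext e (by simp))

lemma isFinPres_yoneda [HasZeroObject C] (X : C) : isFinPres C (preadditiveYoneda.obj X) := by
  refine ⟨0, X, 0, 𝟙 _, by simp, ⟨CokernelCofork.IsColimit.ofπ _ _ (fun g _ => g) ?_ ?_⟩⟩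
  · intros; simp
  · intro Z g _ m hm
    simpa using hm

lemma exists_cokernel_biprod {D : Type*} [Category* D] [Preadditive D] [HasBinaryBiproducts D]
    [HasBinaryBiproducts C] (y : C ⥤ D) [y.Additive] {M N : D} {X Y X' Y' : C}
    {f : X ⟶ Y} {f' : X' ⟶ Y'} {p : y.obj Y ⟶ M} {p' : y.obj Y' ⟶ N}
    (w : y.map f ≫ p = 0) (w' : y.map f' ≫ p' = 0)
    (h : IsColimit (CokernelCofork.ofπ p w)) (h' : IsColimit (CokernelCofork.ofπ p' w')) :
    ∃ (q : y.obj (Y ⊞ Y') ⟶ M ⊞ N) (hq : y.map (biprod.map f f') ≫ q = 0),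
      Nonempty (IsColimit (CokernelCofork.ofπ q hq)) := by
  have hw : y.map (biprod.map f f') ≫ biprod.lift (y.map biprod.fst ≫ p) (y.map biprod.snd ≫ p')
      = 0 := by
    ext1
    · rw [Category.assoc, biprod.lift_fst, ← Functor.map_comp_assoc, biprod.map_fst,
        Functor.map_comp_assoc, w, comp_zero, zero_comp]
    · rw [Category.assoc, biprod.lift_snd, ← Functor.map_comp_assoc, biprod.map_snd,
        Functor.map_comp_assoc, w', comp_zero, zero_comp]
  have hl : y.map biprod.inl ≫ biprod.lift (y.map (biprod.fst : Y ⊞ Y' ⟶ Y) ≫ p)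
      (y.map biprod.snd ≫ p') = p ≫ biprod.inl := by
    ext1 <;> simp [← Functor.map_comp_assoc]
  have hr : y.map biprod.inr ≫ biprod.lift (y.map (biprod.fst : Y ⊞ Y' ⟶ Y) ≫ p)
      (y.map biprod.snd ≫ p') = p' ≫ biprod.inr := by
    ext1 <;> simp [← Functor.map_comp_assoc]
  have ext_y : ∀ {Z : D} (a b : y.obj (Y ⊞ Y') ⟶ Z),
      y.map biprod.inl ≫ a = y.map biprod.inl ≫ b →
      y.map biprod.inr ≫ a = y.map biprod.inr ≫ b → a = b := by
    intro Z a b h₁ h₂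
    rw [← Category.id_comp a, ← Category.id_comp b, ← y.map_id, ← biprod.total, y.map_add,
      Preadditive.add_comp, Preadditive.add_comp, y.map_comp, y.map_comp, Category.assoc,
      Category.assoc, Category.assoc, Category.assoc, h₁, h₂]
  have ep : Epi p := epi_of_isColimit_cofork h
  have ep' : Epi p' := epi_of_isColimit_cofork h'
  refine ⟨_, hw, ⟨?_⟩⟩
  refine CokernelCofork.IsColimit.ofπ _ _
    (fun g hg => biprod.desc
      (CokernelCofork.IsColimit.desc' h (y.map biprod.inl ≫ g) ?_).1
      (CokernelCofork.IsColimit.desc' h' (y.map biprod.inr ≫ g) ?_).1) ?_ ?_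
  · have := y.map biprod.inl ≫= hg
    rwa [← Functor.map_comp_assoc, biprod.inl_map, Functor.map_comp_assoc, comp_zero] at this
  · have := y.map biprod.inr ≫= hg
    rwa [← Functor.map_comp_assoc, biprod.inr_map, Functor.map_comp_assoc, comp_zero] at this
  · intro Z g hg
    apply ext_y
    · rw [reassoc_of% hl, biprod.inl_desc]
      exact (CokernelCofork.IsColimit.desc' h (y.map biprod.inl ≫ g) _).2
    · rw [reassoc_of% hr, biprod.inr_desc]
      exact (CokernelCofork.IsColimit.desc' h' (y.map biprod.inr ≫ g) _).2
  · intro Z g hg m hm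
    ext1
    · rw [biprod.inl_desc, ← cancel_epi p, ← reassoc_of% hl, hm]
      exact (CokernelCofork.IsColimit.desc' h (y.map biprod.inl ≫ g) _).2.symm
    · rw [biprod.inr_desc, ← cancel_epi p', ← reassoc_of% hr, hm]
      exact (CokernelCofork.IsColimit.desc' h' (y.map biprod.inr ≫ g) _).2.symm

instance : (preadditiveYoneda (C := C)).Additive where
  map_add {X Y f g} := by
    ext W (h : W.unop ⟶ X)
    exact Preadditive.comp_add _ _ _ h f g

lemma isFinPres_biprod [HasBinaryBiproducts C] {M N : Cᵒᵖ ⥤ AddCommGrpCat.{v}}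
    (hM : isFinPres C M) (hN : isFinPres C N) : isFinPres C (M ⊞ N) := by
  obtain ⟨X, Y, f, p, w, ⟨h⟩⟩ := hM
  obtain ⟨X', Y', f', p', w', ⟨h'⟩⟩ := hN
  exact ⟨_, _, _, exists_cokernel_biprod _ w w' h h'⟩

instance [HasZeroObject C] : HasZeroObject (FinPres C) where
  zero := ⟨⟨preadditiveYoneda.obj 0, isFinPres_yoneda 0⟩, by
    rw [IsZero.iff_id_eq_zero]
    apply ObjectProperty.hom_ext
    change 𝟙 (preadditiveYoneda.obj (0 : C)) = 0
    rw [← CategoryTheory.Functor.map_id, (isZero_zero C).eq_of_src (𝟙 (0 : C)) 0, Functor.map_zero]⟩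

instance [HasBinaryBiproducts C] : HasBinaryBiproducts (FinPres C) where
  has_binary_biproduct M N := HasBinaryBiproduct.mk
    { bicone :=
        { pt := ⟨M.obj ⊞ N.obj, isFinPres_biprod M.property N.property⟩
          fst := ObjectProperty.homMk biprod.fst
          snd := ObjectProperty.homMk biprod.snd
          inl := ObjectProperty.homMk biprod.inl
          inr := ObjectProperty.homMk biprod.inr
          inl_fst := ObjectProperty.hom_ext _ biprod.inl_fst
          inl_snd := ObjectProperty.hom_ext _ biprod.inl_snd
          inr_fst := ObjectProperty.hom_ext _ biprod.inr_fst
          inr_snd := ObjectProperty.hom_ext _ biprod.inr_snd }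
      isBilimit := isBinaryBilimitOfTotal _ (ObjectProperty.hom_ext _ biprod.total) }

/-- An auto-equivalence of an additive category is additive. -/
instance additive_of_equivalence [HasZeroObject C] [HasBinaryBiproducts C] (S : C ≌ C) :
    S.functor.Additive := by
  have := preservesBinaryBiproducts_of_preservesBinaryProducts S.functor
  have : S.functor.PreservesZeroMorphisms := inferInstance
  exact Functor.additive_of_preservesBinaryBiproducts _

/-- The Yoneda embedding `X ↦ C(-, X)` into finitely presented functors. -/
def yon [HasZeroObject C] : C ⥤ FinPres C :=
  (isFinPres C).lift preadditiveYoneda isFinPres_yoneda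

/-- The natural isomorphism `C(S⁻¹ -, X) ≅ C(-, S X)`, which sends `f : S⁻¹ W ⟶ X` to the
composition `W ≅ S S⁻¹ W ⟶ S X`. -/
def yonedaShiftIso [HasZeroObject C] [HasBinaryBiproducts C] (S : C ≌ C) (X : C) :
    S.inverse.op ⋙ preadditiveYoneda.obj X ≅ preadditiveYoneda.obj (S.functor.obj X) :=
  NatIso.ofComponents (fun W => AddEquiv.toAddCommGrpIso
    { toFun := fun (f : S.inverse.obj W.unop ⟶ X) => S.counitInv.app W.unop ≫ S.functor.map f
      invFun := fun (g : W.unop ⟶ S.functor.obj X) => S.inverse.map g ≫ S.unitInv.app X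
      left_inv := fun f => shift_left_inv S f
      right_inv := fun g => shift_right_inv S g
      map_add' := fun (f g : S.inverse.obj W.unop ⟶ X) => by
        change S.counitInv.app W.unop ≫ S.functor.map (f + g) =
          S.counitInv.app W.unop ≫ S.functor.map f + S.counitInv.app W.unop ≫ S.functor.map g
        rw [Functor.map_add, Preadditive.comp_add] }) (by
    intro W W' f
    ext (g : S.inverse.obj W.unop ⟶ X)
    change S.counitInv.app W'.unop ≫ S.functor.map (S.inverse.map f.unop ≫ g) =
      f.unop ≫ S.counitInv.app W.unop ≫ S.functor.map g
    simp)

lemma exists_cokernel_of_iso {D : Type*} [Category* D] [Preadditive D] {M X Y X' Y' : D}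
    {f : X ⟶ Y} {p : Y ⟶ M} (w : f ≫ p = 0) (h : IsColimit (CokernelCofork.ofπ p w))
    (f' : X' ⟶ Y') (a : X ≅ X') (b : Y ≅ Y') (comm : f ≫ b.hom = a.hom ≫ f') :
    ∃ (q : Y' ⟶ M) (hq : f' ≫ q = 0), Nonempty (IsColimit (CokernelCofork.ofπ q hq)) := by
  have hq : f' ≫ b.inv ≫ p = 0 := by
    rw [← cancel_epi a.hom, ← reassoc_of% comm, b.hom_inv_id_assoc, w, comp_zero]
  have ep : Epi p := epi_of_isColimit_cofork h
  refine ⟨b.inv ≫ p, hq, ⟨CokernelCofork.IsColimit.ofπ _ _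
    (fun g hg => (CokernelCofork.IsColimit.desc' h (b.hom ≫ g) ?_).1) ?_ ?_⟩⟩
  · rw [reassoc_of% comm, hg, comp_zero]
  · intro Z g hg
    rw [Category.assoc, Iso.inv_comp_eq]
    exact (CokernelCofork.IsColimit.desc' h (b.hom ≫ g) _).2
  · intro Z g hg m hm
    rw [← cancel_epi p, ← cancel_epi b.inv, ← Category.assoc, hm, eq_comm, Iso.inv_comp_eq]
    exact (CokernelCofork.IsColimit.desc' h (b.hom ≫ g) _).2

lemma isFinPres_shift [HasZeroObject C] [HasBinaryBiproducts C] (S : C ≌ C)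
    {M : Cᵒᵖ ⥤ AddCommGrpCat.{v}} (hM : isFinPres C M) : isFinPres C (S.inverse.op ⋙ M) := by
  obtain ⟨X, Y, f, p, w, ⟨h⟩⟩ := hM
  let F : (Cᵒᵖ ⥤ AddCommGrpCat.{v}) ⥤ (Cᵒᵖ ⥤ AddCommGrpCat.{v}) := S.op.congrLeft.functor
  have hF : F.PreservesZeroMorphisms := ⟨fun _ _ => rfl⟩
  have w' : F.map (preadditiveYoneda.map f) ≫ F.map p = 0 := by
    rw [← Functor.map_comp, w, Functor.map_zero]
  refine ⟨S.functor.obj X, S.functor.obj Y, S.functor.map f,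
    exists_cokernel_of_iso w' (CokernelCofork.mapIsColimit _ h F) _ (yonedaShiftIso S X)
      (yonedaShiftIso S Y) ?_⟩
  ext W (g : S.inverse.obj W.unop ⟶ X)
  change S.counitInv.app W.unop ≫ S.functor.map (g ≫ f) =
    (S.counitInv.app W.unop ≫ S.functor.map g) ≫ S.functor.map f
  rw [Functor.map_comp, Category.assoc]

/-- The auto-equivalence `M ↦ M ∘ S⁻¹` of `mod C` which extends `S`. -/
def shift [HasZeroObject C] [HasBinaryBiproducts C] (S : C ≌ C) : FinPres C ≌ FinPres C :=
  Equivalence.congrFullSubcategory S.op.congrLeft (by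
    ext M
    refine ⟨fun h => ?_, isFinPres_shift S⟩
    refine (isFinPres C).prop_of_iso (S.op.congrLeft.unitIso.app M).symm ?_
    exact isFinPres_shift S.symm h)

/-- The canonical isomorphism `S C(-, X) ≅ C(-, S X)` in `mod C`. -/
def yonShiftIso [HasZeroObject C] [HasBinaryBiproducts C] (S : C ≌ C) (X : C) :
    (shift S).functor.obj (yon.obj X) ≅ yon.obj (S.functor.obj X) :=
  (isFinPres C).isoMk (yonedaShiftIso S X)

end FinPres

/-! ### `n`-`S`-sequences and pre-`n`-angulations, for `n = k + 3` -/

section Angles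

variable {C : Type u} [Category.{v} C]

/-- An `n`-`S`-sequence `X₁ ⟶ X₂ ⟶ ⋯ ⟶ Xₙ ⟶ S X₁`, where `n = k + 3`. The object `Xᵢ₊₁` is
`obj i`, the morphism `αᵢ₊₁ : Xᵢ₊₁ ⟶ Xᵢ₊₂` is `map i`, and `αₙ : Xₙ ⟶ S X₁` is `last`. -/
structure NSeq (S : C ≌ C) (k : ℕ) where
  obj : Fin (k + 3) → C
  map (i : Fin (k + 2)) : obj i.castSucc ⟶ obj i.succ
  last : obj (Fin.last (k + 2)) ⟶ S.functor.obj (obj 0)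

namespace NSeq

variable {S : C ≌ C} {k : ℕ}

/-- The first morphism `α₁ : X₁ ⟶ X₂`. -/
def first (X : NSeq S k) : X.obj 0 ⟶ X.obj 1 := X.map 0

/-- A morphism of `n`-`S`-sequences. -/
structure Hom (X Y : NSeq S k) where
  app (i : Fin (k + 3)) : X.obj i ⟶ Y.obj i
  comm (i : Fin (k + 2)) : X.map i ≫ app i.succ = app i.castSucc ≫ Y.map i
  comm_last : X.last ≫ S.functor.map (app 0) = app (Fin.last (k + 2)) ≫ Y.last

/-- `Y` is (up to isomorphism) the left rotation
`X₂ ⟶ X₃ ⟶ ⋯ ⟶ Xₙ ⟶ S X₁ ⟶ S X₂` of `X`, with last morphism `(-1)ⁿ S α₁`. -/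
def IsLeftRotation [Preadditive C] (X Y : NSeq S k) : Prop :=
  ∃ (e : ∀ i : Fin (k + 2), Y.obj i.castSucc ≅ X.obj i.succ)
    (e' : Y.obj (Fin.last (k + 2)) ≅ S.functor.obj (X.obj 0)),
    (∀ i : Fin (k + 1), Y.map i.castSucc ≫ (e i.succ).hom = (e i.castSucc).hom ≫ X.map i.succ) ∧
    Y.map (Fin.last (k + 1)) ≫ e'.hom = (e (Fin.last (k + 1))).hom ≫ X.last ∧
    Y.last ≫ S.functor.map (e 0).hom = (-1 : ℤ) ^ (k + 3) • (e'.hom ≫ S.functor.map X.first)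

/-- `Z` is a direct sum of `X` and `Y`. -/
def IsDirectSum [Preadditive C] (X Y Z : NSeq S k) : Prop :=
  ∃ (i₁ : Hom X Z) (p₁ : Hom Z X) (i₂ : Hom Y Z) (p₂ : Hom Z Y), ∀ j : Fin (k + 3),
    i₁.app j ≫ p₁.app j = 𝟙 _ ∧ i₂.app j ≫ p₂.app j = 𝟙 _ ∧
    i₁.app j ≫ p₂.app j = 0 ∧ i₂.app j ≫ p₁.app j = 0 ∧
    p₁.app j ≫ i₁.app j + p₂.app j ≫ i₂.app j = 𝟙 _

/-- The objects `X, X, 0, …, 0` of the trivial sequence. -/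
def trivialObj [HasZeroObject C] (X : C) : ℕ → C
  | 0 => X
  | 1 => X
  | _ + 2 => 0

/-- The trivial sequence `X ⟶ X ⟶ 0 ⟶ ⋯ ⟶ 0 ⟶ S X` whose first morphism is the identity. -/
def trivial [HasZeroObject C] [HasZeroMorphisms C] (S : C ≌ C) (k : ℕ) (X : C) : NSeq S k where
  obj i := trivialObj X i
  map
    | ⟨0, _⟩ => 𝟙 X
    | ⟨_ + 1, _⟩ => 0
  last := 0

end NSeq

variable [Preadditive C] [HasZeroObject C]

/-- The axioms (F1), (F2), (F3) for a class of `n`-`S`-sequences to be a pre-`n`-angulation of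
`(C, S)`, where `n = k + 3`. Taking `Y` to be a zero sequence, the axiom `summand` shows that the
class is closed under isomorphisms, so that in the axioms `complete` and `rotate` it does not
matter that the first morphism and the left rotation are only specified up to isomorphism. -/
structure IsPreNAngulation (S : C ≌ C) (k : ℕ) (N : Set (NSeq S k)) : Prop where
  directSum : ∀ X Y Z, NSeq.IsDirectSum X Y Z → X ∈ N → Y ∈ N → Z ∈ N
  summand : ∀ X Y Z, NSeq.IsDirectSum X Y Z → Z ∈ N → X ∈ N
  trivial_mem : ∀ X : C, NSeq.trivial S k X ∈ N
  complete : ∀ {X₁ X₂ : C} (f : X₁ ⟶ X₂), ∃ X ∈ N, Nonempty (Arrow.mk X.first ≅ Arrow.mk f)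
  rotate : ∀ X Y, NSeq.IsLeftRotation X Y → (X ∈ N ↔ Y ∈ N)
  extend : ∀ X ∈ N, ∀ Y ∈ N, ∀ (φ₁ : X.obj 0 ⟶ Y.obj 0) (φ₂ : X.obj 1 ⟶ Y.obj 1),
    X.first ≫ φ₂ = φ₁ ≫ Y.first → ∃ φ : NSeq.Hom X Y, φ.app 0 = φ₁ ∧ φ.app 1 = φ₂

/-- The pre-`n`-angulations of `(C, S)`, where `n = k + 3`. -/
def PreNAngulation (S : C ≌ C) (k : ℕ) := {N : Set (NSeq S k) // IsPreNAngulation S k N}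

variable [HasBinaryBiproducts C]

/-- Let `X` be an exact `n`-`S`-sequence and `j : M ⟶ C(-, X₁)` a kernel of `C(-, α₁)`. This says
that `d : S M ⟶ Ω⁻ⁿ M` is the morphism `δ_X` of the stable category: there is a morphism `φ` of
complexes from `X₁ ⟶ ⋯ ⟶ Xₙ` to the injective resolution `I M ⟶ I (Ω⁻¹ M) ⟶ I (Ω⁻² M) ⟶ ⋯` of
`M` which lifts the identity of `M`, and `d` is the class of the morphism `ψ` that `φ` induces on
`S M` by means of the factorization `Xₙ ⟶ S M ⟶ S X₁` of `αₙ`. -/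
def IsDelta {S : C ≌ C} {k : ℕ} (c : CosyzygyChoice (FinPres C)) (X : NSeq S k) {M : FinPres C}
    (j : M ⟶ yon.obj (X.obj 0))
    (d : (toStable _).obj ((shift S).functor.obj M) ⟶
      (c.omPow (k + 3)).obj ((toStable _).obj M)) : Prop :=
  ∃ (φ : ∀ i : Fin (k + 3), yon.obj (X.obj i) ⟶ c.I (c.omObj i M))
    (q : yon.obj (X.obj (Fin.last (k + 2))) ⟶ (shift S).functor.obj M)
    (ψ : (shift S).functor.obj M ⟶ c.omObj (k + 3) M),
    j ≫ φ 0 = c.ι M ∧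
    (∀ i : Fin (k + 2), yon.map (X.map i) ≫ φ i.succ =
      φ i.castSucc ≫ c.π (c.omObj i M) ≫ c.ι (c.omObj (i + 1) M)) ∧
    q ≫ (shift S).functor.map j ≫ (yonShiftIso S (X.obj 0)).hom = yon.map X.last ∧
    q ≫ ψ = φ (Fin.last (k + 2)) ≫ c.π (c.omObj (k + 2) M) ∧
    d = (toStable _).map ψ

/-- `Θ` is the isomorphism of triangle functors associated with the pre-`n`-angulation `N`:
for every `n`-angle `X` in `N` and every kernel `j : M ⟶ C(-, X₁)` of `C(-, α₁)` one has
`Θ_M = δ_X`. -/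
def IsDeltaOf {S : C ≌ C} {k : ℕ} (c : CosyzygyChoice (FinPres C)) (N : PreNAngulation S k)
    (Θ : shiftTriangleFunctor (shift S) c ≅ omTriangleFunctor c (k + 3)) : Prop :=
  ∀ X ∈ N.1, ∀ (M : FinPres C) (j : M ⟶ yon.obj (X.obj 0)) (w : j ≫ yon.map X.first = 0),
    Nonempty (IsLimit (KernelFork.ofι j w)) →
      IsDelta c X j (Θ.hom.nat.app ((toStable _).obj M))

end Angles

end PreNAng

set_option linter.unusedSectionVars false

namespace PreNAng

/-! ### Finitely presented functors form an abelian category -/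

section FinPresAbelian

variable {C : Type u} [Category.{v} C] [Preadditive C]

/-! The Yoneda embedding turns an `n`-angle into an exact complex in `mod C`. A pre-`n`-angulation
provides weak kernels, makes every morphism a weak kernel, and lets a morphism extend along `f` as
soon as it kills whatever `f` kills. Hence `mod C` is abelian, representables are both projective
and injective, and, as idempotents split, every injective is representable. So `C(-, X₁) ⟶ ⋯ ⟶ C(-,
Xₙ)` is the beginning of an injective resolution of `M`, and its `n`-th cosyzygy is `S M`, the image
of `C(-, αₙ)`. Comparing it with the chosen resolution yields `δ_X`, a composite of `n` connecting
isomorphisms (`IsRes.δ`, `IsRes.isDelta_iff`).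

For a fixed pre-`n`-angulation, (F3) makes `δ_X` natural in `M`; naturality at `1_M` shows that it
does not depend on the `n`-angle. Rotating an `n`-angle replaces `M` by a copy of `Ω⁻¹ M`, and the
sign in the rotation axiom becomes the sign `(-1)ⁿ` of the triangle functor (`IsRes.δ_rotation`).

Conversely, an isomorphism `Θ` singles out the exact sequences with `δ_X = Θ_M` (`angles`). They
satisfy (F3) because a pair of morphisms extends up to an error that is stably zero, and this error
can be absorbed in the last component (`exists_hom_of_mem_angles`). Every morphism can be completed
because the last term of an existing `n`-angle can be replaced so that `δ_X` becomes any prescribed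
isomorphism (`IsRes.exists_twist`).

A pre-`n`-angulation is contained in the class defined by its own isomorphism, and an inclusion of
pre-`n`-angulations is an equality (`IsPreNAngulation.eq_of_subset`). This gives the bijection, and
the simply transitive action is transported along it. -/

lemma exact_of_pointwise {F G H : Cᵒᵖ ⥤ AddCommGrpCat.{v}} (f : F ⟶ G) (g : G ⟶ H)
    (w : f ≫ g = 0)
    (h : ∀ (W : Cᵒᵖ) (b : G.obj W), g.app W b = 0 → ∃ a : F.obj W, f.app W a = b) :
    (ShortComplex.mk f g w).Exact := by
  rw [ShortComplex.exact_iff_kernel_ι_comp_cokernel_π_zero]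
  ext W x
  obtain ⟨a, ha⟩ := h W ((kernel.ι g).app W x) (by
    have := congr($(NatTrans.congr_app (kernel.condition g) W) x)
    exact this)
  have := congr($(NatTrans.congr_app (cokernel.condition f) W) a)
  change (cokernel.π f).app W ((kernel.ι g).app W x) = 0
  rw [← ha]
  exact this

lemma exists_of_exact {F G H : Cᵒᵖ ⥤ AddCommGrpCat.{v}} {f : F ⟶ G} {g : G ⟶ H}
    {w : f ≫ g = 0} (h : (ShortComplex.mk f g w).Exact) (W : Cᵒᵖ) (b : G.obj W)
    (hb : g.app W b = 0) : ∃ a : F.obj W, f.app W a = b :=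
  (ShortComplex.ab_exact_iff _).1 (h.map ((evaluation _ _).obj W)) b hb

lemma surjective_app_of_epi {F G : Cᵒᵖ ⥤ AddCommGrpCat.{v}} (f : F ⟶ G) [Epi f] (W : Cᵒᵖ) :
    Function.Surjective (f.app W) :=
  (AddCommGrpCat.epi_iff_surjective _).1 inferInstance

lemma injective_app_of_mono {F G : Cᵒᵖ ⥤ AddCommGrpCat.{v}} (f : F ⟶ G) [Mono f] (W : Cᵒᵖ) :
    Function.Injective (f.app W) :=
  (AddCommGrpCat.mono_iff_injective _).1 inferInstance

lemma yoneda_hom_ext {Z : C} {M : Cᵒᵖ ⥤ AddCommGrpCat.{v}} {a b : preadditiveYoneda.obj Z ⟶ M}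
    (h : a.app (.op Z) (𝟙 Z) = b.app (.op Z) (𝟙 Z)) : a = b := by
  ext W (t : W.unop ⟶ Z)
  have ha := congr($(a.naturality t.op) (𝟙 Z))
  have hb := congr($(b.naturality t.op) (𝟙 Z))
  change a.app W (t ≫ 𝟙 Z) = M.map t.op (a.app (.op Z) (𝟙 Z)) at ha
  change b.app W (t ≫ 𝟙 Z) = M.map t.op (b.app (.op Z) (𝟙 Z)) at hb
  rw [Category.comp_id] at ha hb
  rw [ha, hb, h]

/-- Morphisms from a representable functor lift along epimorphisms from representable functors. -/
lemma exists_yoneda_lift {Z Y : C} {M : Cᵒᵖ ⥤ AddCommGrpCat.{v}} (p : preadditiveYoneda.obj Y ⟶ M)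
    [Epi p] (φ : preadditiveYoneda.obj Z ⟶ M) : ∃ h : Z ⟶ Y, preadditiveYoneda.map h ≫ p = φ := by
  obtain ⟨h, hh⟩ := surjective_app_of_epi p (.op Z) (φ.app (.op Z) (𝟙 Z))
  refine ⟨h, yoneda_hom_ext ?_⟩
  rw [← hh]
  exact congr(p.app (.op Z) $(Category.id_comp (h : Z ⟶ Y)))

lemma isFinPres_iff (M : Cᵒᵖ ⥤ AddCommGrpCat.{v}) : isFinPres C M ↔
    ∃ (X Y : C) (f : X ⟶ Y) (p : preadditiveYoneda.obj Y ⟶ M)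
      (w : preadditiveYoneda.map f ≫ p = 0), Epi p ∧ (ShortComplex.mk _ _ w).Exact := by
  refine ⟨?_, ?_⟩
  · rintro ⟨X, Y, f, p, w, ⟨h⟩⟩
    exact ⟨X, Y, f, p, w, epi_of_isColimit_cofork h, ShortComplex.exact_of_g_is_cokernel _ h⟩
  · rintro ⟨X, Y, f, p, w, _, h⟩
    exact ⟨X, Y, f, p, w, ⟨ShortComplex.Exact.gIsCokernel (S := .mk _ _ w) h⟩⟩

/-- `f` is a weak kernel of `g`. -/
structure WeakExact {X Y Z : C} (f : X ⟶ Y) (g : Y ⟶ Z) : Prop where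
  w : f ≫ g = 0
  exists_lift (W : C) (t : W ⟶ Y) : t ≫ g = 0 → ∃ s : W ⟶ X, s ≫ f = t

lemma WeakExact.map_w {D : Type*} [Category* D] [Preadditive D] {X Y Z : C} {f : X ⟶ Y}
    {g : Y ⟶ Z} (h : WeakExact f g) (F : C ⥤ D) [F.Additive] : F.map f ≫ F.map g = 0 := by
  rw [← Functor.map_comp, h.w, Functor.map_zero]

variable (C) in
/-- Every morphism of `C` has a weak kernel. -/
class WeakKernels : Prop where
  exists_weakExact {Y Z : C} (g : Y ⟶ Z) : ∃ (X : C) (f : X ⟶ Y), WeakExact f g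

variable [HasZeroObject C] [HasBinaryBiproducts C]

/-- Lift `φ` to `h : Z ⟶ Y` along a presentation `f : X ⟶ Y` of `M`. A morphism into `Z` is killed
by `φ` exactly when its composite with `h` factors through `f`, so a weak kernel of `(h, -f)`, which
is a weak pullback, covers the kernel of `φ`. -/
lemma exists_yoneda_exact [WeakKernels C] {Z : C} {M : Cᵒᵖ ⥤ AddCommGrpCat.{v}}
    (hM : isFinPres C M) (φ : preadditiveYoneda.obj Z ⟶ M) :
    ∃ (V : C) (g : V ⟶ Z) (w : preadditiveYoneda.map g ≫ φ = 0),
      (ShortComplex.mk _ _ w).Exact := by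
  obtain ⟨X, Y, f, p, w, _, hp⟩ := (isFinPres_iff M).1 hM
  obtain ⟨h, rfl⟩ := exists_yoneda_lift p φ
  obtain ⟨V, s, hs, hs'⟩ := WeakKernels.exists_weakExact (biprod.desc h (-f))
  have e : (s ≫ biprod.fst) ≫ h = (s ≫ biprod.snd) ≫ f := by
    rw [biprod.desc_eq, Preadditive.comp_add, Preadditive.comp_neg, Preadditive.comp_neg,
      add_neg_eq_zero] at hs
    simpa using hs
  refine ⟨V, s ≫ biprod.fst, ?_, ?_⟩
  · rw [← Functor.map_comp_assoc, e, Functor.map_comp_assoc, w, comp_zero]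
  · refine exact_of_pointwise _ _ _ fun W (b : W.unop ⟶ Z) hb => ?_
    obtain ⟨r : W.unop ⟶ X, hr : r ≫ f = b ≫ h⟩ := exists_of_exact hp W (b ≫ h : W.unop ⟶ Y) hb
    obtain ⟨t, ht⟩ := hs' W.unop (biprod.lift b r) (by simp [hr])
    refine ⟨t, ?_⟩
    change t ≫ s ≫ biprod.fst = b
    rw [reassoc_of% ht, biprod.lift_fst]

/-- A representable `Z` that covers the kernel of `p ≫ f` also covers `K`. As `K ⟶ M` is a
monomorphism, the relations can be computed from `Z ⟶ M`, so `exists_yoneda_exact` applies twice. -/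
lemma isFinPres_kernel [WeakKernels C] {M N : Cᵒᵖ ⥤ AddCommGrpCat.{v}}
    (hM : isFinPres C M) (hN : isFinPres C N) (f : M ⟶ N) {K : Cᵒᵖ ⥤ AddCommGrpCat.{v}}
    (i : K ⟶ M) [Mono i] (w : i ≫ f = 0) (hi : (ShortComplex.mk _ _ w).Exact) : isFinPres C K := by
  obtain ⟨X, Y, _, p, _, _, _⟩ := (isFinPres_iff M).1 hM
  obtain ⟨Z, g, w₁, h₁⟩ := exists_yoneda_exact hN (p ≫ f)
  obtain ⟨V, r, w₂, h₂⟩ := exists_yoneda_exact hM (preadditiveYoneda.map g ≫ p)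
  let q : preadditiveYoneda.obj Z ⟶ K := hi.lift (preadditiveYoneda.map g ≫ p) (by simpa using w₁)
  have hq : q ≫ i = preadditiveYoneda.map g ≫ p := hi.lift_f _ _
  have hq' (W : Cᵒᵖ) (b : W.unop ⟶ Z) : i.app W (q.app W b) = p.app W (b ≫ g : W.unop ⟶ Y) :=
    congr($(NatTrans.congr_app hq W) b)
  have wq : preadditiveYoneda.map r ≫ q = 0 := by
    rw [← cancel_mono i, Category.assoc, hq, w₂, zero_comp]
  refine (isFinPres_iff K).2 ⟨V, Z, r, q, wq, ?_, ?_⟩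
  · rw [NatTrans.epi_iff_epi_app]
    intro W
    rw [AddCommGrpCat.epi_iff_surjective]
    intro x
    obtain ⟨t : W.unop ⟶ Y, ht⟩ := surjective_app_of_epi p W (i.app W x)
    have h0 : f.app W (p.app W t) = 0 := by
      rw [ht]
      exact congr($(NatTrans.congr_app w W) x)
    obtain ⟨s : W.unop ⟶ Z, hs : s ≫ g = t⟩ := exists_of_exact h₁ W t h0
    refine ⟨s, injective_app_of_mono i W ?_⟩
    rw [← ht, ← hs]
    exact hq' W s
  · refine exact_of_pointwise _ _ _ fun W b hb => exists_of_exact h₂ W b ?_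
    have := hq' W b
    rw [hb, map_zero] at this
    exact this.symm

/-- The generators of `N` generate `Q`; the relations are those of `N` together with lifts of the
generators of `M`. -/
lemma isFinPres_cokernel {M N : Cᵒᵖ ⥤ AddCommGrpCat.{v}}
    (hM : isFinPres C M) (hN : isFinPres C N) (f : M ⟶ N) {Q : Cᵒᵖ ⥤ AddCommGrpCat.{v}}
    (q : N ⟶ Q) [Epi q] (w : f ≫ q = 0) (hq : (ShortComplex.mk _ _ w).Exact) : isFinPres C Q := by
  obtain ⟨_, Y, _, p, _, _, _⟩ := (isFinPres_iff M).1 hM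
  obtain ⟨X', Y', f', p', w', _, h'⟩ := (isFinPres_iff N).1 hN
  obtain ⟨h, hh⟩ := exists_yoneda_lift p' (p ≫ f)
  have w₀ : preadditiveYoneda.map (biprod.desc h f') ≫ p' ≫ q = 0 := by
    rw [biprod.desc_eq, Functor.map_add, Functor.map_comp, Functor.map_comp, Preadditive.add_comp,
      Category.assoc, Category.assoc, reassoc_of% w', reassoc_of% hh, w]
    simp
  refine (isFinPres_iff Q).2 ⟨_, Y', biprod.desc h f', p' ≫ q, w₀, inferInstance, ?_⟩
  refine exact_of_pointwise _ _ _ fun W (b : W.unop ⟶ Y') hb => ?_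
  obtain ⟨m, hm⟩ := exists_of_exact hq W (p'.app W b) hb
  obtain ⟨s : W.unop ⟶ Y, rfl⟩ := surjective_app_of_epi p W m
  have e : p'.app W (s ≫ h : W.unop ⟶ Y') = p'.app W b := by
    rw [← hm]
    exact congr($(NatTrans.congr_app hh W) s)
  obtain ⟨r : W.unop ⟶ X', hr : r ≫ f' = b - s ≫ h⟩ :=
    exists_of_exact h' W (b - s ≫ h : W.unop ⟶ Y') (by
      have := map_sub (p'.app W).hom (b : W.unop ⟶ Y') (s ≫ h : W.unop ⟶ Y')
      refine this.trans ?_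
      exact sub_eq_zero.2 e.symm)
  refine ⟨biprod.lift s r, ?_⟩
  change biprod.lift s r ≫ biprod.desc h f' = b
  rw [biprod.lift_desc, hr, add_sub_cancel]

instance [WeakKernels C] : (isFinPres C).IsClosedUnderKernels where
  kernels_le := by
    rintro _ ⟨f, k, hk, hM, hN⟩
    have : Mono k.ι := mono_of_isLimit_fork hk
    exact isFinPres_kernel hM hN f k.ι k.condition
      (ShortComplex.exact_of_f_is_kernel _ (hk.ofIsoLimit (Fork.ext (Iso.refl _))))

instance : (isFinPres C).IsClosedUnderCokernels where
  cokernels_le := by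
    rintro _ ⟨f, k, hk, hM, hN⟩
    have : Epi k.π := epi_of_isColimit_cofork hk
    exact isFinPres_cokernel hM hN f k.π k.condition
      (ShortComplex.exact_of_g_is_cokernel _ (hk.ofIsoColimit (Cofork.ext (Iso.refl _))))

instance : (isFinPres C).ContainsZero where
  exists_zero := ⟨preadditiveYoneda.obj 0,
    (preadditiveYoneda (C := C)).map_isZero (isZero_zero C), isFinPres_yoneda 0⟩

instance : (isFinPres C).IsClosedUnderLimitsOfShape (Discrete WalkingPair) where
  limitsOfShape_le := by
    rintro M ⟨h⟩
    have hX := h.prop_diag_obj ⟨.left⟩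
    have hY := h.prop_diag_obj ⟨.right⟩
    refine (isFinPres C).prop_of_iso ?_ (isFinPres_biprod hX hY)
    exact (BinaryBiproduct.isLimit _ _).conePointUniqueUpToIso
      ((IsLimit.postcomposeHomEquiv (diagramIsoPair h.diag) _).symm h.isLimit)

instance : (isFinPres C).IsClosedUnderFiniteProducts := .mk'

instance [WeakKernels C] : Abelian (FinPres C) := inferInstance

end FinPresAbelian

end PreNAng

namespace PreNAng

/-! ### Representable functors as projective generators -/

section Yon

variable {C : Type u} [Category.{v} C] [Preadditive C] [HasZeroObject C]

instance : (yon (C := C)).Full := inferInstanceAs ((isFinPres C).lift _ _).Full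

instance : (yon (C := C)).Faithful := inferInstanceAs ((isFinPres C).lift _ _).Faithful

instance : (yon (C := C)).Additive where
  map_add := ObjectProperty.hom_ext _ ((preadditiveYoneda (C := C)).map_add)

variable [HasBinaryBiproducts C] [WeakKernels C]

instance : (isFinPres C).ι.PreservesEpimorphisms :=
  (isFinPres C).preservesEpimorphisms_ι_of_isNormalMonoCategory

lemma exists_epi_yon (M : FinPres C) : ∃ (Y : C) (p : yon.obj Y ⟶ M), Epi p := by
  obtain ⟨_, Y, _, p, _, _, _⟩ := (isFinPres_iff M.obj).1 M.property
  refine ⟨Y, ObjectProperty.homMk p, (isFinPres C).ι.epi_of_epi_map ?_⟩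
  assumption

instance projective_yon (X : C) : Projective (yon.obj X) where
  factors {A B} φ p hp := by
    obtain ⟨Y, r, _⟩ := exists_epi_yon A
    have : Epi (r ≫ p).hom := (inferInstance : Epi ((isFinPres C).ι.map (r ≫ p)))
    obtain ⟨h, hh⟩ := @exists_yoneda_lift _ _ _ X Y _ (r ≫ p).hom this φ.hom
    exact ⟨yon.map h ≫ r, ObjectProperty.hom_ext _ (by rw [Category.assoc]; exact hh)⟩

/-- After passing to a representable cover of the test object, a morphism into `C(-, Y)` comes from
`C`, where the weak kernel property lifts it. -/
lemma WeakExact.exact {X Y Z : C} {f : X ⟶ Y} {g : Y ⟶ Z} (h : WeakExact f g) :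
    (ShortComplex.mk (yon.map f) (yon.map g) (h.map_w _)).Exact := by
  rw [ShortComplex.exact_iff_exact_up_to_refinements]
  intro A x hx
  obtain ⟨W, p, _⟩ := exists_epi_yon A
  obtain ⟨t, ht⟩ := yon.map_surjective (p ≫ x)
  obtain ⟨s, hs⟩ := h.exists_lift W t (yon.map_injective (by
    rw [Functor.map_comp, ht, Functor.map_zero, Category.assoc]
    exact (p ≫= hx).trans comp_zero))
  exact ⟨_, p, inferInstance, yon.map s, by
    change p ≫ x = yon.map s ≫ yon.map f
    rw [← Functor.map_comp, hs, ht]⟩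

end Yon

end PreNAng

namespace PreNAng

/-! ### Connecting morphisms in the stable category -/

section Connecting

variable {A : Type u} [Category.{v} A] [Preadditive A] [HasZeroObject A] [HasBinaryBiproducts A]

instance : (toStable A).Additive := CategoryTheory.Quotient.functor_additive _ stableRel_add

lemma toStable_map_eq_iff {X Y : A} {f g : X ⟶ Y} :
    (toStable A).map f = (toStable A).map g ↔ stableRel A f g :=
  CategoryTheory.Quotient.functor_map_eq_iff _ f g

lemma toStable_map_eq_zero {X J Y : A} [Injective J] (a : X ⟶ J) (b : J ⟶ Y) :
    (toStable A).map (a ≫ b) = 0 := by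
  rw [← (toStable A).map_zero, toStable_map_eq_iff]
  exact ⟨J, inferInstance, a, b, sub_zero _⟩

namespace CosyzygyChoice

variable (c : CosyzygyChoice A)

/-- The connecting morphism `B ⟶ Ω⁻¹ K` in the stable category of a short exact sequence
`0 ⟶ K ⟶ J ⟶ B ⟶ 0`. -/
def bd {K J B : A} {i : K ⟶ J} {p : J ⟶ B} (h : IsShortExact i p) :
    (toStable A).obj B ⟶ c.om.obj ((toStable A).obj K) :=
  (toStable A).map (c.connecting h (𝟙 K))

lemma map_om_map_toStable {X Y : A} (f : X ⟶ Y) : c.om.map ((toStable A).map f) =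
    (toStable A).map (c.connecting (c.shortExact X) f) := rfl

/-- An extension of `1_K` followed by an extension of `f` is an extension of `f`, and the stable
class on cokernels does not depend on the extension. -/
lemma map_eq_bd_comp {K J B M : A} {i : K ⟶ J} {p : J ⟶ B} (h : IsShortExact i p)
    (f : K ⟶ M) (g : B ⟶ c.Om M) (e : J ⟶ c.I M) (he : i ≫ e = f ≫ c.ι M)
    (hg : p ≫ g = e ≫ c.π M) :
    (toStable A).map g = c.bd h ≫ c.om.map ((toStable A).map f) := by
  rw [map_om_map_toStable, bd]
  refine Eq.trans ?_ ((toStable A).map_comp _ _)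
  obtain ⟨e₁, h₁, h₂⟩ := c.connecting_spec h (𝟙 K)
  obtain ⟨e₂, h₃, h₄⟩ := c.connecting_spec (c.shortExact K) f
  refine h.lift_unique (c.shortExact M).w (c.injective M) (stableRel_refl f) he hg
    (e' := e₁ ≫ e₂) ?_ ?_
  · rw [reassoc_of% h₁, h₃]
  · rw [reassoc_of% h₂, h₄, Category.assoc]

lemma bd_natural {K J B K' J' B' : A} {i : K ⟶ J} {p : J ⟶ B} (h : IsShortExact i p)
    {i' : K' ⟶ J'} {p' : J' ⟶ B'} (h' : IsShortExact i' p') (a : K ⟶ K') (b : J ⟶ J')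
    (d : B ⟶ B') (hab : i ≫ b = a ≫ i') (hbd : p ≫ d = b ≫ p') :
    c.bd h ≫ c.om.map ((toStable A).map a) = (toStable A).map d ≫ c.bd h' := by
  obtain ⟨e, h₁, h₂⟩ := c.connecting_spec h' (𝟙 K')
  refine Eq.trans ?_ ((toStable A).map_comp _ _)
  refine (c.map_eq_bd_comp h a _ (b ≫ e) ?_ ?_).symm
  · rw [reassoc_of% hab, h₁, Category.id_comp]
  · rw [reassoc_of% hbd, h₂, Category.assoc]

/-- Injectivity of `J` lets `1_K` be extended in both directions between the two sequences; both
composites induce stable identities by uniqueness. -/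
lemma isIso_bd {K J B : A} {i : K ⟶ J} {p : J ⟶ B} (h : IsShortExact i p) (hJ : Injective J) :
    IsIso (c.bd h) := by
  obtain ⟨e, h₁, h₂⟩ := c.connecting_spec h (𝟙 K)
  obtain ⟨g, e', h₁', h₂'⟩ := (c.shortExact K).exists_lift h.w (𝟙 K)
  rw [Category.id_comp] at h₁ h₁'
  refine ⟨(toStable A).map g, ?_, ?_⟩
  · refine ((toStable A).map_comp _ _).symm.trans (Eq.trans ?_ ((toStable A).map_id _))
    refine h.lift_unique h.w hJ (stableRel_refl (𝟙 _)) (e := e ≫ e') (e' := 𝟙 _) ?_ ?_ ?_ ?_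
    · rw [reassoc_of% h₁, h₁', Category.id_comp]
    · rw [reassoc_of% h₂, h₂', Category.assoc]
    · simp
    · simp
  · refine ((toStable A).map_comp _ _).symm.trans (Eq.trans ?_ ((toStable A).map_id _))
    refine (c.shortExact K).lift_unique (c.shortExact K).w (c.injective _)
      (stableRel_refl (𝟙 _)) (e := e' ≫ e) (e' := 𝟙 _) ?_ ?_ ?_ ?_
    · rw [reassoc_of% h₁', h₁, Category.id_comp]
    · rw [reassoc_of% h₂', h₂, Category.assoc]
    · simp
    · exact (Category.comp_id _).trans (Category.id_comp _).symm

/-- This is how `σ` enters the comparison of an `n`-angle with its rotation: `F` of an extension `J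
⟶ I K`, followed by `F (I K) ⟶ I (F K)`, is an extension for the shifted sequence. -/
lemma bd_map (F : A ≌ A) [F.functor.Additive] {K J B : A} {i : K ⟶ J} {p : J ⟶ B}
    (h : IsShortExact i p) :
    c.bd (h.map F) = (stableMap F).map (c.bd h) ≫ (sigma F c).hom.app ((toStable A).obj K) := by
  refine Eq.trans ?_ ((toStable A).map_comp (F.functor.map (c.connecting h (𝟙 K)))
    (sigmaMap F c K))
  obtain ⟨e, h₁, h₂⟩ := c.connecting_spec h (𝟙 K)
  obtain ⟨b, h₃, h₄⟩ : ∃ e, _ ∧ _ ≫ sigmaMap F c K = _ :=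
    c.connecting_spec ((c.shortExact K).map F) (𝟙 (F.functor.obj K))
  refine c.map_connecting_eq (h.map F) (stableRel_refl _) (e := F.functor.map e ≫ b) ?_ ?_
  · rw [← Functor.map_comp_assoc, h₁, Category.id_comp, h₃]
    rfl
  · rw [← Functor.map_comp_assoc, h₂, Functor.map_comp_assoc, h₄, Category.assoc]
    rfl

/-- If the difference on cosyzygies factors through an injective, that object is projective, so the
factorization lifts to `I Y`. Subtracting the lift from the difference of the extensions gives a
morphism `I X ⟶ Y` whose restriction to `X` is `f - g`. -/
lemma om_faithful (hA : ∀ J : A, Injective J → Projective J) : c.om.Faithful where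
  map_injective {X Y} f g hfg := by
    obtain ⟨X⟩ := X
    obtain ⟨Y⟩ := Y
    obtain ⟨f, rfl⟩ := (toStable A).map_surjective f
    obtain ⟨g, rfl⟩ := (toStable A).map_surjective g
    obtain ⟨e, h₁, h₂⟩ := c.connecting_spec (c.shortExact X) f
    obtain ⟨e', h₁', h₂'⟩ := c.connecting_spec (c.shortExact X) g
    obtain ⟨J, hJ, a, b, hab⟩ := toStable_map_eq_iff.1 hfg
    have := hA J hJ
    have := (c.shortExact Y).epi
    have := (c.shortExact Y).mono
    let t := a ≫ Projective.factorThru b (c.π Y)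
    have ht : t ≫ c.π Y = a ≫ b := by simp [t]
    obtain ⟨s, hs⟩ := KernelFork.IsLimit.lift' (c.shortExact Y).isKernel.some
      (e - e' - c.π X ≫ t) (by
        rw [Preadditive.sub_comp, Preadditive.sub_comp, ← h₂, ← h₂', Category.assoc, ht, ← hab,
          Preadditive.comp_sub, sub_self])
    refine toStable_map_eq_iff.2 ⟨_, c.injective X, c.ι X, s, ?_⟩
    change s ≫ c.ι Y = _ at hs
    rw [← cancel_mono (c.ι Y), Category.assoc, hs, Preadditive.sub_comp, Preadditive.comp_sub,
      Preadditive.comp_sub, h₁, h₁', reassoc_of% (c.shortExact X).w, zero_comp, sub_zero]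

end CosyzygyChoice

end Connecting

end PreNAng

namespace PreNAng

/-! ### Weak kernels and cokernels in a category with a pre-`n`-angulation -/

section WeakExact

variable {C : Type u} [Category.{v} C] [Preadditive C]

lemma WeakExact.of_iso {X Y Z X' Y' Z' : C} {f : X ⟶ Y} {g : Y ⟶ Z} (h : WeakExact f g)
    {f' : X' ⟶ Y'} {g' : Y' ⟶ Z'} (a : X ≅ X') (b : Y ≅ Y') (d : Z ≅ Z')
    (hab : f ≫ b.hom = a.hom ≫ f') (hbd : g ≫ d.hom = b.hom ≫ g') : WeakExact f' g' where
  w := by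
    rw [← cancel_epi a.hom, ← reassoc_of% hab, ← hbd, reassoc_of% h.w, zero_comp, comp_zero]
  exists_lift W t ht := by
    obtain ⟨s, hs⟩ := h.exists_lift W (t ≫ b.inv) (by
      rw [← cancel_mono d.hom, Category.assoc, Category.assoc, hbd, b.inv_hom_id_assoc, ht,
        zero_comp])
    refine ⟨s ≫ a.hom, ?_⟩
    rw [Category.assoc, ← hab, reassoc_of% hs, b.inv_hom_id, Category.comp_id]

lemma WeakExact.map {X Y Z : C} {f : X ⟶ Y} {g : Y ⟶ Z} (h : WeakExact f g) (S : C ≌ C)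
    [S.functor.Additive] : WeakExact (S.functor.map f) (S.functor.map g) where
  w := h.map_w _
  exists_lift W t ht := by
    obtain ⟨s, hs⟩ := h.exists_lift _ (S.inverse.map t ≫ S.unitInv.app Y) (by
      apply S.functor.map_injective
      rw [← cancel_epi (S.counitInv.app W), Functor.map_comp, ← Category.assoc, shift_right_inv,
        ht, Functor.map_zero, comp_zero])
    refine ⟨S.counitInv.app W ≫ S.functor.map s, ?_⟩
    rw [Category.assoc, ← Functor.map_comp, hs, shift_right_inv]

lemma WeakExact.of_map {X Y Z : C} {f : X ⟶ Y} {g : Y ⟶ Z} (S : C ≌ C)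
    [S.functor.Additive] (h : WeakExact (S.functor.map f) (S.functor.map g)) :
    WeakExact f g where
  w := S.functor.map_injective (by rw [Functor.map_comp, h.w, Functor.map_zero])
  exists_lift W t ht := by
    obtain ⟨s, hs⟩ := h.exists_lift _ (S.functor.map t) (by
      rw [← Functor.map_comp, ht, Functor.map_zero])
    refine ⟨S.functor.preimage s, S.functor.map_injective ?_⟩
    rw [Functor.map_comp, S.functor.map_preimage, hs]

lemma comp_signIso_hom {n : ℕ} {X Y : C} {f g : X ⟶ Y} (h : f = (-1 : ℤ) ^ n • g) :
    f ≫ (signIso n Y).hom = g := by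
  rw [h]
  change _ ≫ ((-1 : ℤ) ^ n • 𝟙 Y) = g
  rw [Preadditive.comp_zsmul, Category.comp_id, smul_smul, ← mul_pow, neg_mul_neg, one_mul,
    one_pow, one_smul]

end WeakExact

namespace NSeq

variable {C : Type u} [Category.{v} C] {S : C ≌ C} {k : ℕ}

/-- Sequences are built by appending a last object. The objects are recovered only up to the
isomorphisms `e`, `e'`, because `Fin.snoc` at a variable index does not reduce definitionally. -/
lemma exists_of_snoc (A : Fin (k + 2) → C) (m : ∀ i : Fin (k + 1), A i.castSucc ⟶ A i.succ)
    (Z : C) (a : A (Fin.last (k + 1)) ⟶ Z) (b : Z ⟶ S.functor.obj (A 0)) :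
    ∃ (X : NSeq S k) (e : ∀ i : Fin (k + 2), X.obj i.castSucc ≅ A i)
      (e' : X.obj (Fin.last (k + 2)) ≅ Z),
      (∀ i : Fin (k + 1), X.map i.castSucc ≫ (e i.succ).hom = (e i.castSucc).hom ≫ m i) ∧
      X.map (Fin.last (k + 1)) ≫ e'.hom = (e (Fin.last (k + 1))).hom ≫ a ∧
      X.last ≫ S.functor.map (e 0).hom = e'.hom ≫ b := by
  let obj : Fin (k + 3) → C := Fin.snoc (α := fun _ => C) A Z
  let e (i : Fin (k + 2)) : obj i.castSucc ≅ A i := eqToIso (Fin.snoc_castSucc _ _ _)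
  let e' : obj (Fin.last (k + 2)) ≅ Z := eqToIso (Fin.snoc_last _ _)
  let X : NSeq S k :=
    { obj := obj
      map := Fin.lastCases (motive := fun i => obj i.castSucc ⟶ obj i.succ)
        ((e (Fin.last (k + 1))).hom ≫ a ≫ e'.inv)
        (fun i => (e i.castSucc).hom ≫ m i ≫ (e i.succ).inv)
      last := e'.hom ≫ b ≫ S.functor.map (e 0).inv }
  have h₁ (i : Fin (k + 1)) : X.map i.castSucc = (e i.castSucc).hom ≫ m i ≫ (e i.succ).inv :=
    Fin.lastCases_castSucc (motive := fun i => obj i.castSucc ⟶ obj i.succ) i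
  have h₂ : X.map (Fin.last (k + 1)) = (e (Fin.last (k + 1))).hom ≫ a ≫ e'.inv :=
    Fin.lastCases_last (motive := fun i => obj i.castSucc ⟶ obj i.succ)
  refine ⟨X, e, e', fun i => ?_, ?_, ?_⟩
  · rw [h₁, Category.assoc, Category.assoc, Iso.inv_hom_id, Category.comp_id]
  · rw [h₂, Category.assoc, Category.assoc, Iso.inv_hom_id, Category.comp_id]
  · exact (Category.assoc _ _ _).trans (e'.hom ≫= (Category.assoc _ _ _).trans
      ((b ≫= (S.functor.mapIso (e 0)).inv_hom_id).trans (Category.comp_id _)))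

/-- The second morphism `α₂ : X₂ ⟶ X₃`. -/
def second (X : NSeq S k) : X.obj 1 ⟶ X.obj 2 := X.map 1

variable [Preadditive C]

lemma IsLeftRotation.exists_iso {X Y : NSeq S k} (h : X.IsLeftRotation Y) :
    ∃ (a : Y.obj 0 ≅ X.obj 1) (b : Y.obj 1 ≅ X.obj 2)
      (l : Y.obj (Fin.last _) ≅ S.functor.obj (X.obj 0)),
      Y.first ≫ b.hom = a.hom ≫ X.second ∧
      Y.last ≫ S.functor.map a.hom = (-1 : ℤ) ^ (k + 3) • (l.hom ≫ S.functor.map X.first) := by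
  obtain ⟨e, e', h₁, h₂, h₃⟩ := h
  exact ⟨e 0, e 1, e', h₁ 0, h₃⟩

lemma exists_isLeftRotation (X : NSeq S k) : ∃ Y, X.IsLeftRotation Y := by
  obtain ⟨Y, e, e', h⟩ := exists_of_snoc (S := S) (fun i => X.obj i.succ) (fun i => X.map i.succ)
    (S.functor.obj (X.obj 0)) X.last ((-1 : ℤ) ^ (k + 3) • S.functor.map X.first)
  exact ⟨Y, e, e', h.1, h.2.1, h.2.2.trans (Preadditive.comp_zsmul _ _ _)⟩

/-- The right rotation of an `n`-`S`-sequence. -/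
def invRot (Y : NSeq S k) : NSeq S k where
  obj := Fin.cons (α := fun _ => C) (S.inverse.obj (Y.obj (Fin.last _))) fun i => Y.obj i.castSucc
  map := Fin.cases ((-1 : ℤ) ^ (k + 3) • (S.inverse.map Y.last ≫ S.unitInv.app _))
    fun i => Y.map i.castSucc
  last := Y.map (Fin.last _) ≫ S.counitInv.app _

lemma invRot_isLeftRotation [S.functor.Additive] (Y : NSeq S k) :
    (invRot Y).IsLeftRotation Y := by
  refine ⟨fun i => Iso.refl _, (S.counitIso.app (Y.obj (Fin.last _))).symm, fun i => ?_, ?_, ?_⟩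
  · exact (Category.comp_id _).trans (Category.id_comp _).symm
  · exact (Category.id_comp _).symm
  · change Y.last ≫ S.functor.map (𝟙 _) = (-1 : ℤ) ^ (k + 3) • (S.counitInv.app _ ≫
      S.functor.map ((-1 : ℤ) ^ (k + 3) • (S.inverse.map Y.last ≫ S.unitInv.app _)))
    rw [Functor.map_zsmul, Preadditive.comp_zsmul, smul_smul, ← mul_pow, shift_right_inv]
    simp

/-- An `n`-`S`-sequence is exact if each morphism is a weak kernel of the next one. -/
structure IsExact (X : NSeq S k) : Prop where
  mid (i : Fin (k + 1)) : WeakExact (X.map i.castSucc) (X.map i.succ)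
  pre : WeakExact (X.map (Fin.last _)) X.last
  post : WeakExact X.last (S.functor.map X.first)

/-- A sequence `0 ⟶ ⋯ ⟶ 0 ⟶ W ⟶ W ⟶ 0 ⟶ ⋯ ⟶ 0`, with the isomorphism `W ⟶ W` in position `i`. -/
structure IsDisk (T : NSeq S k) (i : Fin (k + 2)) : Prop where
  isIso : IsIso (T.map i)
  isZero (j : Fin (k + 3)) : j ≠ i.castSucc → j ≠ i.succ → IsZero (T.obj j)

end NSeq

namespace IsPreNAngulation

variable {C : Type u} [Category.{v} C] [Preadditive C] [HasZeroObject C] [HasBinaryBiproducts C]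
  {S : C ≌ C} {k : ℕ} {N : Set (NSeq S k)} (hN : IsPreNAngulation S k N)

include hN

lemma exists_rot {X : NSeq S k} (hX : X ∈ N) : ∃ Y ∈ N, X.IsLeftRotation Y := by
  obtain ⟨Y, hY⟩ := X.exists_isLeftRotation
  exact ⟨Y, (hN.rotate X Y hY).1 hX, hY⟩

lemma invRot_mem {X : NSeq S k} (hX : X ∈ N) : X.invRot ∈ N :=
  (hN.rotate _ _ X.invRot_isLeftRotation).2 hX

/-- The morphism of `n`-angles `(1, α₁)` from the trivial one on `X₁` passes through a zero third
object, so the composite vanishes. For the lifting, (F3) applies to the rotations: the pair `(f, 0)`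
from `W ⟶ 0 ⟶ ⋯ ⟶ S W` extends, and its component `S W ⟶ S X₁` is the shift of a lift. -/
lemma weakExact_first {X : NSeq S k} (hX : X ∈ N) : WeakExact X.first X.second where
  w := by
    obtain ⟨φ, h₀, h₁⟩ := hN.extend _ (hN.trivial_mem (X.obj 0)) X hX (𝟙 _) X.first rfl
    have h : (0 : X.obj 0 ⟶ 0) ≫ φ.app 2 = φ.app 1 ≫ X.second := φ.comm 1
    rw [h₁] at h
    exact h.symm.trans zero_comp
  exists_lift W f hf := by
    obtain ⟨Y, hY, hXY⟩ := hN.exists_rot hX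
    obtain ⟨T, hT, hWT⟩ := hN.exists_rot (hN.trivial_mem W)
    obtain ⟨a, b, l, h₁, h₂⟩ := hXY.exists_iso
    obtain ⟨(t : T.obj 0 ≅ W), u, (m : _ ≅ S.functor.obj W), g₁,
      (g₂ : T.last ≫ S.functor.map t.hom = (-1 : ℤ) ^ (k + 3) • (m.hom ≫ S.functor.map (𝟙 W)))⟩ :=
      hWT.exists_iso
    obtain ⟨φ, h, -⟩ := hN.extend T hT Y hY (t.hom ≫ f ≫ a.inv) 0 (by
      rw [comp_zero, ← cancel_mono b.hom, zero_comp, Category.assoc, Category.assoc,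
        Category.assoc, h₁, Iso.inv_hom_id_assoc, hf, comp_zero])
    have h' := φ.comm_last =≫ S.functor.map a.hom
    rw [Category.assoc, Category.assoc, h₂, ← Functor.map_comp, h] at h'
    simp only [Category.assoc, Iso.inv_hom_id, Category.comp_id, Functor.map_comp] at h'
    rw [reassoc_of% g₂, Preadditive.zsmul_comp, Preadditive.comp_zsmul] at h'
    -- Both rotations carry the same sign, so it cancels after one more multiplication.
    replace h' := congr((-1 : ℤ) ^ (k + 3) • $h')
    rw [smul_smul, smul_smul, ← mul_pow, CategoryTheory.Functor.map_id, neg_mul_neg,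
      one_mul, one_pow, one_smul, one_smul, Category.comp_id] at h'
    refine ⟨S.functor.preimage (m.inv ≫ φ.app (Fin.last _) ≫ l.hom), S.functor.map_injective ?_⟩
    rw [Functor.map_comp, Functor.map_preimage, Category.assoc, Category.assoc, ← h',
      Iso.inv_hom_id_assoc]

lemma weakExact_mid {X : NSeq S k} (hX : X ∈ N) (i : Fin (k + 1)) :
    WeakExact (X.map i.castSucc) (X.map i.succ) := by
  induction i using Fin.induction generalizing X with
  | zero => exact hN.weakExact_first hX
  | succ i ih =>
    obtain ⟨Y, hY, e, e', h₁, h₂, h₃⟩ := hN.exists_rot hX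
    exact (ih hY).of_iso (e i.castSucc.castSucc) (e i.castSucc.succ) (e i.succ.succ)
      (h₁ i.castSucc) (h₁ i.succ)

lemma weakExact_pre {X : NSeq S k} (hX : X ∈ N) :
    WeakExact (X.map (Fin.last _)) X.last := by
  obtain ⟨Y, hY, e, e', h₁, h₂, h₃⟩ := hN.exists_rot hX
  exact (hN.weakExact_mid hY (Fin.last _)).of_iso (e (Fin.last k).castSucc) (e (Fin.last k).succ) e'
    (h₁ _) h₂

lemma isExact {X : NSeq S k} (hX : X ∈ N) : X.IsExact where
  mid := hN.weakExact_mid hX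
  pre := hN.weakExact_pre hX
  post := by
    obtain ⟨Y, hY, e, e', h₁, h₂, h₃⟩ := hN.exists_rot hX
    exact (hN.weakExact_pre hY).of_iso (e _) e' (S.functor.mapIso (e 0) ≪≫ signIso (k + 3) _) h₂
      ((Category.assoc _ _ _).symm.trans (comp_signIso_hom h₃))

/-- The trivial `n`-angle is the disk in position `0`, and a right rotation moves a disk one place
further without changing its isomorphism. -/
lemma exists_disk (i : Fin (k + 2)) (W : C) :
    ∃ T ∈ N, T.IsDisk i ∧ Nonempty (T.obj i.castSucc ≅ W) := by
  induction i using Fin.induction with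
  | zero =>
    refine ⟨_, hN.trivial_mem W, ⟨inferInstanceAs (IsIso (𝟙 W)), ?_⟩, ⟨Iso.refl _⟩⟩
    rintro ⟨_ | _ | j, hj⟩ h₀ h₁
    · exact (h₀ rfl).elim
    · exact (h₁ rfl).elim
    · exact isZero_zero C
  | succ i ih =>
    obtain ⟨T, hT, h, ⟨e⟩⟩ := ih
    refine ⟨T.invRot, hN.invRot_mem hT, ⟨h.isIso, ?_⟩, ⟨e⟩⟩
    intro j h₀ h₁
    induction j using Fin.cases with
    | zero =>
      refine S.inverse.map_isZero (h.isZero _ ?_ ?_)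
      · intro H
        have := congr(($H).1)
        simp at this
        omega
      · intro H
        have := congr(($H).1)
        simp at this
        omega
    | succ j =>
      refine h.isZero _ ?_ ?_
      · rintro H
        refine h₀ ?_
        ext
        have := congr(($H).1)
        simp at this ⊢
        omega
      · intro H
        refine h₁ ?_
        ext
        have := congr(($H).1)
        simp at this ⊢
        omega

/-- (F3) with target the disk `0 ⟶ W ⟶ W ⟶ 0 ⟶ ⋯` and the pair `(0, f)`: the third component is the
factorization. -/
lemma exists_desc {X : NSeq S k} (hX : X ∈ N) {W : C} (f : X.obj 1 ⟶ W)
    (hf : X.first ≫ f = 0) : ∃ g, X.second ≫ g = f := by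
  obtain ⟨T, hT, hT', ⟨(e : T.obj 1 ≅ W)⟩⟩ := hN.exists_disk 1 W
  have : IsIso T.second := hT'.isIso
  obtain ⟨φ, -, h⟩ := hN.extend X hX T hT 0 (f ≫ e.inv) (by
    rw [zero_comp, reassoc_of% hf, zero_comp])
  have h' : X.second ≫ φ.app 2 = φ.app 1 ≫ T.second := φ.comm 1
  refine ⟨φ.app 2 ≫ inv T.second ≫ e.hom, ?_⟩
  rw [reassoc_of% h', h]
  simp

lemma exists_weakExact {A B : C} (f : A ⟶ B) : ∃ X ∈ N, ∃ (a : X.obj 0 ≅ A) (b : X.obj 1 ≅ B),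
    X.first ≫ b.hom = a.hom ≫ f := by
  obtain ⟨X, hX, ⟨e⟩⟩ := hN.complete f
  exact ⟨X, hX, Arrow.leftFunc.mapIso e, Arrow.rightFunc.mapIso e, (e.hom.w).symm⟩

end IsPreNAngulation

end PreNAng

namespace PreNAng

/-! ### The category of finitely presented functors is a Frobenius category -/

section ShortExact

variable {A : Type u} [Category.{v} A] [Abelian A]

lemma isShortExact_of_exact {K J B : A} {i : K ⟶ J} {p : J ⟶ B} [Mono i] [Epi p] (w : i ≫ p = 0)
    (h : (ShortComplex.mk i p w).Exact) : IsShortExact i p where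
  w := w
  isKernel := ⟨ShortComplex.Exact.fIsKernel (S := .mk i p w) h⟩
  isCokernel := ⟨ShortComplex.Exact.gIsCokernel (S := .mk i p w) h⟩

lemma isShortExact_cokernel {K J : A} (i : K ⟶ J) [Mono i] : IsShortExact i (cokernel.π i) :=
  isShortExact_of_exact (cokernel.condition i) (ShortComplex.exact_cokernel i)

lemma isShortExact_kernel {J B : A} (p : J ⟶ B) [Epi p] : IsShortExact (kernel.ι p) p :=
  isShortExact_of_exact (kernel.condition p) (ShortComplex.exact_kernel p)

end ShortExact

/-- Every morphism of `C` has a weak kernel, it is a weak kernel, and it is a weak cokernel of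
its weak kernels. -/
class WeaklyFrobenius (C : Type u) [Category.{v} C] [Preadditive C] : Prop extends
    WeakKernels C where
  exists_weakExact' {X Y : C} (f : X ⟶ Y) : ∃ (Z : C) (g : Y ⟶ Z), WeakExact f g
  exists_extension {X Y W : C} (f : X ⟶ Y) (g : X ⟶ W)
    (h : ∀ (V : C) (t : V ⟶ X), t ≫ f = 0 → t ≫ g = 0) : ∃ g', f ≫ g' = g

section Frobenius

variable {C : Type u} [Category.{v} C] [Preadditive C] [HasZeroObject C] [HasBinaryBiproducts C]

/-- Up to isomorphism each morphism is the first one of an `n`-angle and the second one of its right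
rotation. The former gives a weak cokernel of which it is a weak kernel; the latter gives a weak
kernel and, by `exists_desc`, the extensions. -/
lemma IsPreNAngulation.weaklyFrobenius {S : C ≌ C} {k : ℕ} {N : Set (NSeq S k)}
    (hN : IsPreNAngulation S k N) : WeaklyFrobenius C where
  exists_weakExact {Y Z} g := by
    obtain ⟨X, hX, a, b, h⟩ := hN.exists_weakExact g
    exact ⟨_, _, (hN.weakExact_first (hN.invRot_mem hX)).of_iso (Iso.refl _) a b
      (Category.id_comp _).symm h⟩
  exists_weakExact' {Y Z} g := by
    obtain ⟨X, hX, a, b, h⟩ := hN.exists_weakExact g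
    refine ⟨_, b.inv ≫ X.second, (hN.weakExact_first hX).of_iso a b (Iso.refl _) h ?_⟩
    rw [b.hom_inv_id_assoc]
    exact Category.comp_id _
  exists_extension {Y Z W} f g h := by
    obtain ⟨X, hX, a, b, hab⟩ := hN.exists_weakExact f
    obtain ⟨(g' : X.obj 1 ⟶ W), hg'⟩ := hN.exists_desc (hN.invRot_mem hX) (a.hom ≫ g) (by
      refine (Category.assoc _ _ _).symm.trans (h _ _ ?_)
      refine (Category.assoc _ _ _).trans ((_ ≫= hab.symm).trans ?_)
      refine (Category.assoc _ _ _).symm.trans ?_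
      refine ((hN.weakExact_first (hN.invRot_mem hX)).w =≫ b.hom).trans zero_comp)
    refine ⟨b.inv ≫ g', ?_⟩
    rw [← cancel_epi a.hom, ← reassoc_of% hab, b.hom_inv_id_assoc]
    exact hg'

variable [WeaklyFrobenius C]

lemma exists_yon_presentation (M : FinPres C) : ∃ (X Y : C) (f : X ⟶ Y) (p : yon.obj Y ⟶ M)
    (w : yon.map f ≫ p = 0), Epi p ∧ (ShortComplex.mk _ _ w).Exact := by
  obtain ⟨Y, p, _⟩ := exists_epi_yon M
  obtain ⟨X, q, _⟩ := exists_epi_yon (kernel p)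
  obtain ⟨f, hf⟩ := yon.map_surjective (q ≫ kernel.ι p)
  have w : yon.map f ≫ p = 0 := by rw [hf, Category.assoc, kernel.condition, comp_zero]
  refine ⟨X, Y, f, p, w, inferInstance, ?_⟩
  rw [ShortComplex.exact_iff_epi_kernel_lift]
  have : kernel.lift p (yon.map f) w = q := by
    rw [← cancel_mono (kernel.ι p), kernel.lift_ι, hf]
  change Epi (kernel.lift p (yon.map f) w)
  rw [this]
  infer_instance

/-- If `f` presents `M` and is a weak kernel of `g : Y ⟶ Z`, then exactness of the represented
sequence identifies `M` with the image of `C(-, g)`. -/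
lemma exists_mono_yon (M : FinPres C) : ∃ (Z : C) (i : M ⟶ yon.obj Z), Mono i := by
  obtain ⟨X, Y, f, p, w, _, hp⟩ := exists_yon_presentation M
  obtain ⟨Z, g, hg⟩ := WeaklyFrobenius.exists_weakExact' f
  have hi : p ≫ hp.desc (yon.map g) (hg.map_w yon) = yon.map g := hp.g_desc _ _
  refine ⟨Z, hp.desc (yon.map g) (hg.map_w yon), Preadditive.mono_of_cancel_zero _ fun {A} x hx => ?_⟩
  obtain ⟨A', r, _, y, hy⟩ := surjective_up_to_refinements_of_epi p x
  obtain ⟨A'', s, _, z, hz⟩ := hg.exact.exact_up_to_refinements y (by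
    change y ≫ yon.map g = 0
    rw [← hi, ← reassoc_of% hy, hx, comp_zero])
  rw [← cancel_epi r, hy, ← cancel_epi s, ← Category.assoc, hz, Category.assoc]
  change z ≫ yon.map f ≫ p = _
  rw [w]
  simp

/-- Cover `N` by `C(-, B)` and the pullback of the cover to `M` by `C(-, A)`. The morphism `b : A ⟶
W` given by `φ` kills all that `a : A ⟶ B` kills, so it extends to `h : B ⟶ W`, and `h` descends to
`N`. -/
instance injective_yon (W : C) : Injective (yon.obj W) where
  factors {M N} φ i _ := by
    obtain ⟨B, p, _⟩ := exists_epi_yon N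
    obtain ⟨A, q, _⟩ := exists_epi_yon (pullback i p)
    obtain ⟨a, ha⟩ := yon.map_surjective (q ≫ pullback.snd i p)
    obtain ⟨b, hb⟩ := yon.map_surjective (q ≫ pullback.fst i p ≫ φ)
    have hai : yon.map a ≫ p = (q ≫ pullback.fst i p) ≫ i := by
      rw [ha, Category.assoc, Category.assoc, pullback.condition]
    obtain ⟨h, hh⟩ := WeaklyFrobenius.exists_extension a b fun V t ht => yon.map_injective (by
      have : yon.map t ≫ q ≫ pullback.fst i p = 0 := by
        rw [← cancel_mono i, Category.assoc, ← hai, ← Functor.map_comp_assoc, ht]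
        simp
      rw [Functor.map_comp, hb, reassoc_of% this, zero_comp, Functor.map_zero])
    have hp := (isShortExact_kernel p)
    obtain ⟨g, hg⟩ := hp.exists_desc (yon.map h) (by
      -- The kernel of `p` sits in the pullback with zero component in `M`, where `φ` contributes
      -- nothing; hence `h` vanishes on it.
      obtain ⟨r, s, _, y, hy⟩ := surjective_up_to_refinements_of_epi q
        (pullback.lift (f := i) (g := p) 0 (kernel.ι p) (by simp))
      have h₁ := hy =≫ pullback.fst i p
      have h₂ := hy =≫ pullback.snd i p
      rw [Category.assoc, Category.assoc, pullback.lift_fst, comp_zero] at h₁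
      rw [Category.assoc, Category.assoc, pullback.lift_snd, ← ha] at h₂
      rw [← cancel_epi s, reassoc_of% h₂, ← Functor.map_comp, hh, hb, reassoc_of% h₁.symm,
        zero_comp, comp_zero])
    refine ⟨g, ?_⟩
    rw [← cancel_epi (q ≫ pullback.fst i p), ← Category.assoc, ← hai, Category.assoc, hg,
      ← Functor.map_comp, hh, hb, Category.assoc]

/-- An injective is a retract of a representable, and by full faithfulness the corresponding
idempotent lives in `C`, where it splits. -/
lemma exists_iso_yon [IsIdempotentComplete C] (J : FinPres C) [Injective J] :
    ∃ X : C, Nonempty (J ≅ yon.obj X) := by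
  obtain ⟨Z, i, _⟩ := exists_mono_yon J
  have hi : i ≫ Injective.factorThru (𝟙 J) i = 𝟙 J := Injective.comp_factorThru _ _
  obtain ⟨e, he⟩ := yon.map_surjective (Injective.factorThru (𝟙 J) i ≫ i)
  obtain ⟨X, j, r, hj, hr⟩ := IsIdempotentComplete.idempotents_split Z e (yon.map_injective (by
    rw [Functor.map_comp, he, Category.assoc, reassoc_of% hi]))
  refine ⟨X, ⟨⟨i ≫ yon.map r, yon.map j ≫ Injective.factorThru (𝟙 J) i, ?_, ?_⟩⟩⟩
  · rw [Category.assoc, ← Functor.map_comp_assoc, hr, he, Category.assoc, hi, Category.comp_id, hi]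
  · rw [Category.assoc, ← reassoc_of% he, ← Functor.map_comp, ← Functor.map_comp, ← hr,
      Category.assoc, hj, Category.comp_id, hj, CategoryTheory.Functor.map_id]

lemma projective_of_injective [IsIdempotentComplete C] (J : FinPres C) (hJ : Injective J) :
    Projective J := by
  obtain ⟨X, ⟨e⟩⟩ := exists_iso_yon J
  exact Projective.of_iso e.symm inferInstance

lemma nonempty_cosyzygyChoice : Nonempty (CosyzygyChoice (FinPres C)) := by
  choose Z i hi using exists_mono_yon (C := C)
  exact ⟨{
    I M := yon.obj (Z M)
    Om M := cokernel (i M)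
    ι := i
    π M := cokernel.π (i M)
    injective M := inferInstance
    shortExact M := isShortExact_cokernel (i M) }⟩

end Frobenius

end PreNAng

namespace PreNAng

/-! ### The resolution of a kernel which is given by an exact `n`-`S`-sequence -/

section Image

variable {A : Type u} [Category.{v} A] [Abelian A]

lemma isShortExact_of_mono_comp {K J B B' : A} {i : K ⟶ J} {g : J ⟶ B'} [Mono i]
    {w : i ≫ g = 0} (h : (ShortComplex.mk i g w).Exact) (q : J ⟶ B) (m : B ⟶ B') [Epi q] [Mono m]
    (hqm : q ≫ m = g) : IsShortExact i q := by
  have w' : i ≫ q = 0 := by rw [← cancel_mono m, Category.assoc, hqm, w, zero_comp]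
  refine isShortExact_of_exact w' ?_
  refine (ShortComplex.exact_iff_of_epi_of_isIso_of_mono (S₁ := .mk i q w') (S₂ := .mk i g w)
    ⟨𝟙 _, 𝟙 _, m, by simp, by simp [hqm]⟩).2 h

lemma exact_image_ι {X Y Z : A} {f : X ⟶ Y} {g : Y ⟶ Z} {w : f ≫ g = 0}
    (h : (ShortComplex.mk f g w).Exact) :
    ∃ w', (ShortComplex.mk (image.ι f) g w').Exact := by
  have w' : image.ι f ≫ g = 0 := by
    rw [← cancel_epi (factorThruImage f), image.fac_assoc, w, comp_zero]
  refine ⟨w', (ShortComplex.exact_iff_of_epi_of_isIso_of_mono (S₁ := .mk f g w)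
    (S₂ := .mk (image.ι f) g w') ⟨factorThruImage f, 𝟙 _, 𝟙 _, by simp, by simp⟩).1 h⟩

lemma epi_of_exact_of_comp {X Y Z K : A} {f : X ⟶ Y} {g : Y ⟶ Z} {w : f ≫ g = 0}
    (h : (ShortComplex.mk f g w).Exact) (q : X ⟶ K) (i : K ⟶ Y) [Mono i] (hq : q ≫ i = f)
    (hi : i ≫ g = 0) : Epi q := by
  rw [epi_iff_surjective_up_to_refinements]
  intro B y
  obtain ⟨B', r, hr, x, hx⟩ := h.exact_up_to_refinements (y ≫ i) (by simp [hi])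
  refine ⟨B', r, hr, x, ?_⟩
  rw [← cancel_mono i, Category.assoc, hx, Category.assoc, hq]

end Image

variable {C : Type u} [Category.{v} C] [Preadditive C] [HasZeroObject C] [HasBinaryBiproducts C]
  {S : C ≌ C} {k : ℕ}

lemma yonShiftIso_naturality (S : C ≌ C) {X Y : C} (f : X ⟶ Y) :
    (shift S).functor.map (yon.map f) ≫ (yonShiftIso S Y).hom =
      (yonShiftIso S X).hom ≫ yon.map (S.functor.map f) := by
  apply ObjectProperty.hom_ext
  ext W (g : S.inverse.obj W.unop ⟶ X)
  change S.counitInv.app W.unop ≫ S.functor.map (g ≫ f) =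
    (S.counitInv.app W.unop ≫ S.functor.map g) ≫ S.functor.map f
  rw [Functor.map_comp, Category.assoc]

/-- `X` is an exact `n`-`S`-sequence and `j` is a kernel of `C(-, α₁)`. -/
structure IsRes (X : NSeq S k) {M : FinPres C} (j : M ⟶ yon.obj (X.obj 0)) : Prop where
  isExact : X.IsExact
  w : j ≫ yon.map X.first = 0
  isKernel : Nonempty (IsLimit (KernelFork.ofι j w))

lemma IsRes.mono {X : NSeq S k} {M : FinPres C} {j : M ⟶ yon.obj (X.obj 0)} (h : IsRes X j) :
    Mono j :=
  mono_of_isLimit_fork h.isKernel.some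

lemma IsRes.mono_shift {X : NSeq S k} {M : FinPres C} {j : M ⟶ yon.obj (X.obj 0)}
    (h : IsRes X j) : Mono ((shift S).functor.map j) :=
  have := h.mono
  inferInstance

lemma IsRes.exists_lift {X : NSeq S k} {M : FinPres C} {j : M ⟶ yon.obj (X.obj 0)}
    (h : IsRes X j) {Z : FinPres C} (f : Z ⟶ yon.obj (X.obj 0)) (hf : f ≫ yon.map X.first = 0) :
    ∃ g : Z ⟶ M, g ≫ j = f :=
  ⟨_, (KernelFork.IsLimit.lift' h.isKernel.some f hf).2⟩

variable [WeaklyFrobenius C]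

lemma IsRes.exact {X : NSeq S k} {M : FinPres C} {j : M ⟶ yon.obj (X.obj 0)} (h : IsRes X j) :
    (ShortComplex.mk _ _ h.w).Exact :=
  ShortComplex.exact_of_f_is_kernel _ h.isKernel.some

lemma NSeq.IsExact.exists_isRes {X : NSeq S k} (h : X.IsExact) :
    ∃ (M : FinPres C) (j : M ⟶ yon.obj (X.obj 0)), IsRes X j :=
  ⟨_, kernel.ι (yon.map X.first), h, kernel.condition _, ⟨kernelIsKernel _⟩⟩

/-- The kernels in the complex `C(-, X₁) ⟶ ⋯ ⟶ C(-, Xₙ)`. -/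
def resK (X : NSeq S k) (M : FinPres C) : Fin (k + 3) → FinPres C :=
  Fin.cases M fun i => image (yon.map (X.map i))

/-- The inclusions of the kernels. -/
def resι (X : NSeq S k) {M : FinPres C} (j : M ⟶ yon.obj (X.obj 0)) :
    ∀ i, resK X M i ⟶ yon.obj (X.obj i) :=
  Fin.cases j fun i => image.ι (yon.map (X.map i))

/-- The projections onto the kernels. -/
def resπ (X : NSeq S k) (M : FinPres C) (i : Fin (k + 2)) :
    yon.obj (X.obj i.castSucc) ⟶ resK X M i.succ :=
  factorThruImage (yon.map (X.map i))

lemma resπ_resι (X : NSeq S k) {M : FinPres C} (j : M ⟶ yon.obj (X.obj 0)) (i : Fin (k + 2)) :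
    resπ X M i ≫ resι X j i.succ = yon.map (X.map i) :=
  image.fac _

/-- The induction step shared by all comparisons of iterated connecting morphisms: a naturality
square for one connecting morphism is pasted with `T` of the previous square. -/
lemma comp_map_comp_map {D : Type*} [Category* D] {T : D ⥤ D} {B B' K K' Z Z' : D}
    {b : B ⟶ T.obj K} {b' : B' ⟶ T.obj K'} {d : K ⟶ Z} {d' : K' ⟶ Z'} {w : Z ⟶ Z'}
    {κ : K ⟶ K'} {u : B ⟶ B'} (h₁ : b ≫ T.map κ = u ≫ b') (h₂ : d ≫ w = κ ≫ d') :
    (b ≫ T.map d) ≫ T.map w = u ≫ b' ≫ T.map d' := by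
  rw [Category.assoc, ← T.map_comp, h₂, T.map_comp, reassoc_of% h₁]

namespace IsRes

variable {X : NSeq S k} {M : FinPres C} {j : M ⟶ yon.obj (X.obj 0)} (h : IsRes X j)

include h

lemma mono_resι (i : Fin (k + 3)) : Mono (resι X j i) := by
  induction i using Fin.cases with
  | zero => exact h.mono
  | succ i => exact inferInstanceAs (Mono (image.ι _))

lemma ses (i : Fin (k + 2)) : IsShortExact (resι X j i.castSucc) (resπ X M i) := by
  induction i using Fin.cases with
  | zero =>
    have := h.mono
    exact isShortExact_of_mono_comp h.exact (factorThruImage (yon.map X.first))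
      (image.ι (yon.map X.first)) (image.fac _)
  | succ i =>
    obtain ⟨w, hw⟩ := exact_image_ι (h.isExact.mid i).exact
    exact isShortExact_of_mono_comp hw (factorThruImage (yon.map (X.map i.succ))) (image.ι _)
      (image.fac _)

lemma mono_shift_comp : Mono ((shift S).functor.map j ≫ (yonShiftIso S (X.obj 0)).hom) :=
  have := h.mono_shift
  inferInstance

lemma shift_w : ((shift S).functor.map j ≫ (yonShiftIso S (X.obj 0)).hom) ≫
    yon.map (S.functor.map X.first) = 0 := by
  rw [Category.assoc, ← yonShiftIso_naturality, ← Functor.map_comp_assoc, h.w, Functor.map_zero,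
    zero_comp]

lemma exists_shift_lift {Z : FinPres C} (f : Z ⟶ yon.obj (S.functor.obj (X.obj 0)))
    (hf : f ≫ yon.map (S.functor.map X.first) = 0) :
    ∃ q, q ≫ (shift S).functor.map j ≫ (yonShiftIso S (X.obj 0)).hom = f := by
  obtain ⟨q, hq⟩ := KernelFork.IsLimit.lift' (KernelFork.mapIsLimit _ h.isKernel.some
    (shift S).functor) (f ≫ (yonShiftIso S (X.obj 0)).inv) (by
      rw [← cancel_mono (yonShiftIso S _).hom, Category.assoc, Category.assoc,
        yonShiftIso_naturality, Iso.inv_hom_id_assoc, hf, zero_comp])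
  change Z ⟶ (shift S).functor.obj M at q
  change q ≫ (shift S).functor.map j = _ at hq
  exact ⟨q, by rw [reassoc_of% hq, Iso.inv_hom_id, Category.comp_id]⟩

lemma exists_q : ∃ q, q ≫ (shift S).functor.map j ≫ (yonShiftIso S (X.obj 0)).hom =
    yon.map X.last :=
  h.exists_shift_lift _ (h.isExact.post.map_w _)

/-- The morphism `C(-, Xₙ) ⟶ S M` in the factorization of `C(-, αₙ)`. -/
def q : yon.obj (X.obj (Fin.last (k + 2))) ⟶ (shift S).functor.obj M := h.exists_q.choose

lemma q_comp : h.q ≫ (shift S).functor.map j ≫ (yonShiftIso S (X.obj 0)).hom =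
    yon.map X.last := h.exists_q.choose_spec

/-- Exactness at `S X₁` makes the image of `C(-, αₙ)` equal to the kernel of `C(-, S α₁)`, which is
`S M`. -/
lemma epi_q : Epi h.q :=
  have := h.mono_shift_comp
  epi_of_exact_of_comp h.isExact.post.exact h.q _ h.q_comp h.shift_w

lemma ses_last : IsShortExact (resι X j (Fin.last (k + 2))) h.q := by
  obtain ⟨w, hw⟩ := exact_image_ι h.isExact.pre.exact
  have := h.epi_q
  have := h.mono_shift_comp
  exact isShortExact_of_mono_comp hw h.q _ h.q_comp

variable (c : CosyzygyChoice (FinPres C))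

/-- The iterated connecting morphisms in the stable category. -/
def D : ∀ i : Fin (k + 3), (toStable _).obj (resK X M i) ⟶ (c.omPow i).obj ((toStable _).obj M) :=
  Fin.induction (𝟙 _) fun i d => c.bd (h.ses i) ≫ c.om.map d

lemma D_succ (i : Fin (k + 2)) :
    h.D c i.succ = c.bd (h.ses i) ≫ c.om.map (h.D c i.castSucc) := rfl

/-- The morphism `δ_X : S M ⟶ Ω⁻ⁿ M` in the stable category. -/
def δ : (toStable _).obj ((shift S).functor.obj M) ⟶
    (c.omPow (k + 3)).obj ((toStable _).obj M) :=
  c.bd h.ses_last ≫ c.om.map (h.D c (Fin.last (k + 2)))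

/-- All middle terms are representable, hence injective, so each connecting morphism is a stable
isomorphism. -/
lemma isIso_D (i : Fin (k + 3)) : IsIso (h.D c i) := by
  induction i using Fin.induction with
  | zero => exact inferInstanceAs (IsIso (𝟙 _))
  | succ i ih =>
    have := c.isIso_bd (h.ses i) inferInstance
    exact inferInstanceAs (IsIso (c.bd (h.ses i) ≫ c.om.map (h.D c i.castSucc)))

lemma isIso_δ : IsIso (h.δ c) := by
  have := c.isIso_bd h.ses_last inferInstance
  have := h.isIso_D c (Fin.last (k + 2))
  exact inferInstanceAs (IsIso (c.bd h.ses_last ≫ c.om.map (h.D c (Fin.last (k + 2)))))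

omit h in
lemma exists_map {Y : NSeq S k} {M' : FinPres C} {j' : M' ⟶ yon.obj (Y.obj 0)} (h : IsRes X j)
    (h' : IsRes Y j') (f : ∀ i, X.obj i ⟶ Y.obj i)
    (hf : ∀ i : Fin (k + 2), X.map i ≫ f i.succ = f i.castSucc ≫ Y.map i)
    (g : M ⟶ M') (hg : g ≫ j' = j ≫ yon.map (f 0)) (i : Fin (k + 3)) :
    ∃ κ : resK X M i ⟶ resK Y M' i, κ ≫ resι Y j' i = resι X j i ≫ yon.map (f i) ∧
      h.D c i ≫ (c.omPow i).map ((toStable _).map g) = (toStable _).map κ ≫ h'.D c i := by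
  induction i using Fin.induction with
  | zero => exact ⟨g, hg, (Category.id_comp _).trans (Category.comp_id _).symm⟩
  | succ i ih =>
    obtain ⟨κ, h₁, h₂⟩ := ih
    obtain ⟨κ', h₃⟩ := (h.ses i).exists_desc (yon.map (f i.castSucc) ≫ resπ Y M' i) (by
      rw [← reassoc_of% h₁, (h'.ses i).w, comp_zero])
    refine ⟨κ', ?_, ?_⟩
    · have := (h.ses i).epi
      rw [← cancel_epi (resπ X M i), reassoc_of% h₃, resπ_resι, ← Category.assoc, resπ_resι,
        ← Functor.map_comp, ← Functor.map_comp, hf]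
    · exact comp_map_comp_map
        (c.bd_natural (h.ses i) (h'.ses i) κ (yon.map (f i.castSucc)) κ' h₁.symm h₃) h₂

/-- The square with the last morphisms is not assumed to commute, so the morphism `u` induced on `S
M` may differ from `S g`. This freedom is used both to correct the last component in (F3) and to
twist `δ`. -/
lemma δ_natural {Y : NSeq S k} {M' : FinPres C} {j' : M' ⟶ yon.obj (Y.obj 0)}
    (h' : IsRes Y j') (f : ∀ i, X.obj i ⟶ Y.obj i)
    (hf : ∀ i : Fin (k + 2), X.map i ≫ f i.succ = f i.castSucc ≫ Y.map i)
    (g : M ⟶ M') (hg : g ≫ j' = j ≫ yon.map (f 0))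
    (u : (shift S).functor.obj M ⟶ (shift S).functor.obj M')
    (hu : h.q ≫ u = yon.map (f (Fin.last (k + 2))) ≫ h'.q) :
    h.δ c ≫ (c.omPow (k + 3)).map ((toStable _).map g) = (toStable _).map u ≫ h'.δ c := by
  obtain ⟨κ, h₁, h₂⟩ := exists_map c h h' f hf g hg (Fin.last (k + 2))
  exact comp_map_comp_map (c.bd_natural h.ses_last h'.ses_last κ _ u h₁.symm hu) h₂

/-- Compatibility with `αₙ` forces the morphism induced on `S M` to be `S g`, since `S M' ⟶ S Y₁` is
a monomorphism. -/
lemma δ_natural_hom {Y : NSeq S k} {M' : FinPres C} {j' : M' ⟶ yon.obj (Y.obj 0)}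
    (h' : IsRes Y j') (f : NSeq.Hom X Y) (g : M ⟶ M') (hg : g ≫ j' = j ≫ yon.map (f.app 0)) :
    h.δ c ≫ (c.omPow (k + 3)).map ((toStable _).map g) =
      (toStable _).map ((shift S).functor.map g) ≫ h'.δ c := by
  refine h.δ_natural c h' f.app f.comm g hg _ ?_
  have := h'.mono_shift_comp
  rw [← cancel_mono ((shift S).functor.map j' ≫ (yonShiftIso S (Y.obj 0)).hom), Category.assoc,
    Category.assoc, h'.q_comp, ← Functor.map_comp_assoc, hg, Functor.map_comp_assoc,
    yonShiftIso_naturality, ← Functor.map_comp, ← f.comm_last, Functor.map_comp, ← h.q_comp]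
  simp only [Category.assoc]

/-- The morphisms from the kernels in an exact sequence to the cosyzygies. -/
def Ψ : ∀ i : Fin (k + 3), resK X M i ⟶ c.omObj i M :=
  Fin.induction (𝟙 M) fun i ψ =>
    have := h.mono_resι i.castSucc
    have := c.injective (c.omObj i M)
    ((h.ses i).exists_desc
      (Injective.factorThru (ψ ≫ c.ι (c.omObj i M)) (resι X j i.castSucc) ≫ c.π (c.omObj i M)) (by
        rw [Injective.comp_factorThru_assoc]
        exact (Category.assoc _ _ _).trans ((ψ ≫= (c.shortExact _).w).trans comp_zero))).choose

lemma exists_isDelta : ∃ d, IsDelta c X j d := by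
  have := h.mono_resι
  have := fun i : Fin (k + 3) => c.injective (c.omObj i M)
  let φ (i : Fin (k + 3)) : yon.obj (X.obj i) ⟶ c.I (c.omObj i M) :=
    Injective.factorThru (h.Ψ c i ≫ c.ι (c.omObj i M)) (resι X j i)
  have hφ (i) : resι X j i ≫ φ i = h.Ψ c i ≫ c.ι (c.omObj i M) := Injective.comp_factorThru _ _
  have hΨ (i : Fin (k + 2)) : resπ X M i ≫ h.Ψ c i.succ = φ i.castSucc ≫ c.π (c.omObj i M) :=
    Exists.choose_spec (p := fun g => resπ X M i ≫ g = φ i.castSucc ≫ c.π (c.omObj i M)) _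
  obtain ⟨ψ, hψ⟩ := h.ses_last.exists_desc (φ (Fin.last (k + 2)) ≫ c.π _) (by
    rw [reassoc_of% hφ, (c.shortExact _).w, comp_zero])
  refine ⟨_, φ, h.q, ψ, ?_, fun i => ?_, h.q_comp, hψ, rfl⟩
  · exact (hφ 0).trans (Category.id_comp _)
  · have := hΨ i =≫ c.ι _
    rw [← resπ_resι X j, Category.assoc, hφ]
    exact (Category.assoc _ _ _).symm.trans (this.trans (Category.assoc _ _ _))

/-- Any lift `φ` induces morphisms from the kernels of the complex to the cosyzygies, and
`map_eq_bd_comp` identifies their stable classes inductively with the `D i`; no choice in `φ`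
survives. -/
lemma eq_δ_of_isDelta {d} (hd : IsDelta c X j d) : d = h.δ c := by
  obtain ⟨φ, q, ψ, h₀, h₁, h₂, h₃, rfl⟩ := hd
  have hq : q = h.q := by
    have := h.mono_shift_comp
    rw [← cancel_mono ((shift S).functor.map j ≫ (yonShiftIso S (X.obj 0)).hom), h₂, h.q_comp]
  subst hq
  have key (i : Fin (k + 3)) : ∃ ψ : resK X M i ⟶ c.omObj i M,
      resι X j i ≫ φ i = ψ ≫ c.ι (c.omObj i M) ∧ (toStable _).map ψ = h.D c i := by
    induction i using Fin.induction with
    | zero => exact ⟨𝟙 M, h₀.trans (Category.id_comp _).symm, (toStable _).map_id _⟩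
    | succ i ih =>
      obtain ⟨ψ, h₅, h₆⟩ := ih
      obtain ⟨ψ', h₇⟩ := (h.ses i).exists_desc (φ i.castSucc ≫ c.π (c.omObj i M)) (by
        rw [reassoc_of% h₅]
        exact (ψ ≫= (c.shortExact _).w).trans comp_zero)
      refine ⟨ψ', ?_, ?_⟩
      · have := (h.ses i).epi
        rw [← cancel_epi (resπ X M i), ← Category.assoc, resπ_resι, h₁]
        exact (Category.assoc _ _ _).symm.trans ((h₇.symm =≫ _).trans (Category.assoc _ _ _))
      · rw [D_succ, ← h₆]
        exact c.map_eq_bd_comp (h.ses i) ψ ψ' (φ i.castSucc) h₅ h₇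
  obtain ⟨ψ', h₅, h₆⟩ := key (Fin.last (k + 2))
  rw [δ, ← h₆]
  exact c.map_eq_bd_comp h.ses_last ψ' ψ _ h₅ h₃

lemma isDelta_iff {d} : IsDelta c X j d ↔ d = h.δ c := by
  refine ⟨h.eq_δ_of_isDelta c, ?_⟩
  rintro rfl
  obtain ⟨d, hd⟩ := h.exists_isDelta c
  rwa [← h.eq_δ_of_isDelta c hd]

end IsRes

end PreNAng

namespace PreNAng

/-! ### The effect of a rotation on `δ` -/

lemma CosyzygyChoice.omPowComm_succ_app {A : Type u} [Category.{v} A] [Preadditive A]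
    [HasZeroObject A] [HasBinaryBiproducts A] (c : CosyzygyChoice A) (i : ℕ) (M : Stable A) :
    (c.omPowComm (i + 1)).hom.app M = c.om.map ((c.omPowComm i).hom.app M) :=
  Category.id_comp _

lemma IsShortExact.exists_lift_kernel {A : Type u} [Category.{v} A] [Preadditive A]
    {K J B Z : A} {i : K ⟶ J} {p : J ⟶ B} (h : IsShortExact i p) (f : Z ⟶ J) (hf : f ≫ p = 0) :
    ∃ g, g ≫ i = f :=
  ⟨_, (KernelFork.IsLimit.lift' h.isKernel.some f hf).2⟩

/-- The projection of `C(-, X₁)` onto the image of `C(-, α₁)`. -/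
def resπ₀ {C : Type u} [Category.{v} C] [Preadditive C] [HasZeroObject C]
    [HasBinaryBiproducts C] {S : C ≌ C} {k : ℕ} [WeaklyFrobenius C] (X : NSeq S k)
    (M : FinPres C) : yon.obj (X.obj 0) ⟶ resK X M 1 :=
  resπ X M 0

namespace IsRes

variable {C : Type u} [Category.{v} C] [Preadditive C] [HasZeroObject C] [HasBinaryBiproducts C]
  {S : C ≌ C} {k : ℕ} [WeaklyFrobenius C]
  {X : NSeq S k} {M : FinPres C} {j : M ⟶ yon.obj (X.obj 0)} (h : IsRes X j)
  {Y : NSeq S k} {M' : FinPres C} {j' : M' ⟶ yon.obj (Y.obj 0)} (h' : IsRes Y j')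
  (c : CosyzygyChoice (FinPres C))

include h h'

omit h' in
lemma ses_zero : IsShortExact j (resπ₀ X M) := h.ses 0

omit h' in
lemma resι_one_w : resι X j 1 ≫ yon.map X.second = 0 := by
  have h₁ : resπ X M 1 ≫ resι X j 2 = yon.map X.second := resπ_resι X j 1
  rw [← h₁]
  exact (Category.assoc _ _ _).symm.trans (((h.ses 1).w =≫ resι X j 2).trans zero_comp)

omit h' in
lemma exists_lift_one {Z : FinPres C} (f : Z ⟶ yon.obj (X.obj 1)) (hf : f ≫ yon.map X.second = 0) :
    ∃ g, g ≫ resι X j 1 = f := by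
  have : Mono (resι X j 2) := h.mono_resι 2
  have h₁ : resπ X M 1 ≫ resι X j 2 = yon.map X.second := resπ_resι X j 1
  refine (h.ses 1).exists_lift_kernel f ?_
  refine (cancel_mono (resι X j 2)).1 ?_
  exact (Category.assoc _ _ _).trans ((f ≫= h₁).trans (hf.trans zero_comp.symm))

/-- By exactness the image of `C(-, α₁)` is the kernel of `C(-, α₂)`, and `α₂` is the first morphism
of the rotation. -/
lemma exists_iso_resK (a : Y.obj 0 ≅ X.obj 1) (b : Y.obj 1 ≅ X.obj 2)
    (hab : Y.first ≫ b.hom = a.hom ≫ X.second) :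
    ∃ κ : M' ≅ resK X M 1, κ.hom ≫ resι X j 1 = j' ≫ yon.map a.hom := by
  have : Mono (resι X j 1) := h.mono_resι 1
  have := h'.mono
  obtain ⟨κ, hκ⟩ := h.exists_lift_one (j' ≫ yon.map a.hom) (by
    rw [Category.assoc, ← Functor.map_comp, ← hab, Functor.map_comp, reassoc_of% h'.w, zero_comp])
  obtain ⟨l, hl⟩ := h'.exists_lift (resι X j 1 ≫ yon.map a.inv) (by
    have : a.inv ≫ Y.first = X.second ≫ b.inv := by
      rw [Iso.inv_comp_eq, ← reassoc_of% hab, Iso.hom_inv_id, Category.comp_id]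
    rw [Category.assoc, ← Functor.map_comp, this, Functor.map_comp, reassoc_of% h.resι_one_w,
      zero_comp])
  refine ⟨⟨κ, l, ?_, ?_⟩, hκ⟩
  · rw [← cancel_mono j', Category.assoc, hl, reassoc_of% hκ, ← Functor.map_comp]
    simp
  · rw [← cancel_mono (resι X j 1), Category.assoc, hκ, reassoc_of% hl, ← Functor.map_comp]
    simp

/-- The kernels for `Y` are those for `X` moved by one place. Thus the iterated connecting morphisms
of `X` are those of `Y` with one more, `M' ≅ resK X M 1 ⟶ Ω⁻¹ M`, applied at the innermost place. -/
lemma exists_map_rotation (e : ∀ i : Fin (k + 2), Y.obj i.castSucc ≅ X.obj i.succ)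
    (he : ∀ i : Fin (k + 1), Y.map i.castSucc ≫ (e i.succ).hom = (e i.castSucc).hom ≫ X.map i.succ)
    (κ₀ : M' ⟶ resK X M 1) (hκ₀ : κ₀ ≫ resι X j 1 = j' ≫ yon.map (e 0).hom) (i : Fin (k + 2)) :
    ∃ κ : resK Y M' i.castSucc ⟶ resK X M i.succ,
      κ ≫ resι X j i.succ = resι Y j' i.castSucc ≫ yon.map (e i).hom ∧
      h'.D c i.castSucc ≫ (c.omPow i).map ((toStable _).map κ₀ ≫ c.bd h.ses_zero) ≫
        (c.omPowComm i).hom.app ((toStable _).obj M) = (toStable _).map κ ≫ h.D c i.succ := by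
  induction i using Fin.induction with
  | zero =>
    refine ⟨κ₀, hκ₀, ?_⟩
    refine (Category.id_comp _).trans ?_
    refine (_ ≫= Category.id_comp _).trans ?_
    refine (Category.comp_id _).trans ?_
    refine _ ≫= ?_
    refine (Category.comp_id _).symm.trans ?_
    exact _ ≫= (c.om.map_id _).symm
  | succ i ih =>
    obtain ⟨κ, h₁, h₂⟩ := ih
    obtain ⟨κ', h₃⟩ := (h'.ses i.castSucc).exists_desc
      (yon.map (e i.castSucc).hom ≫ resπ X M i.succ) (by
        refine (Category.assoc _ _ _).symm.trans ((h₁.symm =≫ _).trans ?_)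
        exact (Category.assoc _ _ _).trans ((κ ≫= (h.ses i.succ).w).trans comp_zero))
    refine ⟨κ', ?_, ?_⟩
    · have := (h'.ses i.castSucc).epi
      rw [← cancel_epi (resπ Y M' i.castSucc), reassoc_of% h₃, resπ_resι]
      refine (Functor.map_comp _ _ _).symm.trans ((congr(yon.map $(he i)).symm).trans ?_)
      rw [Functor.map_comp, ← resπ_resι Y j' i.castSucc, Category.assoc]
      rfl
    · have h₄ := comp_map_comp_map
        (c.bd_natural (h'.ses i.castSucc) (h.ses i.succ) κ (yon.map (e i.castSucc).hom) κ'
          h₁.symm h₃) h₂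
      refine Eq.trans ?_ h₄
      refine _ ≫= ?_
      refine (_ ≫= c.omPowComm_succ_app _ _).trans ?_
      exact (c.om.map_comp _ _).symm

/-- `δ_X` and `δ_Y` share all connecting morphisms but one. `δ_X` starts from that of `0 ⟶ M ⟶ X₁ ⟶
K ⟶ 0`, while `δ_Y` ends with that of the shifted sequence; the two differ by `σ`, and the sign
comes from the last morphism `(-1)ⁿ S α₁` of the rotation. -/
lemma δ_rotation (hXY : X.IsLeftRotation Y) :
    ∃ w : (toStable _).obj M' ⟶ c.om.obj ((toStable _).obj M), IsIso w ∧
      h'.δ c ≫ (c.omPow (k + 3)).map w ≫ (c.omPowComm (k + 3)).hom.app ((toStable _).obj M) =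
        (-1 : ℤ) ^ (k + 3) • ((stableMap (shift S)).map w ≫
          (sigma (shift S) c).hom.app ((toStable _).obj M) ≫ c.om.map (h.δ c)) := by
  obtain ⟨e, e', he₁, he₂, he₃⟩ := hXY
  obtain ⟨e₀, he₀⟩ : ∃ e₀ : Y.obj 0 ≅ X.obj 1, e₀ = e 0 := ⟨_, rfl⟩
  obtain ⟨κ₀, hκ₀'⟩ := exists_iso_resK h h' (e 0) (e 1) (he₁ 0)
  have hκ₀ : κ₀.hom ≫ resι X j 1 = j' ≫ yon.map e₀.hom := by rw [he₀]; exact hκ₀'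
  have he₃' : Y.last ≫ S.functor.map e₀.hom =
      (-1 : ℤ) ^ (k + 3) • (e'.hom ≫ S.functor.map X.first) := by rw [he₀]; exact he₃
  obtain ⟨κ, h₁, h₂⟩ := exists_map_rotation h h' c e he₁ κ₀.hom hκ₀' (Fin.last _)
  have := c.isIso_bd h.ses_zero inferInstance
  refine ⟨(toStable _).map κ₀.hom ≫ c.bd h.ses_zero, inferInstance, ?_⟩
  -- The kernel in the last place of `Y` maps to `S M`; after this identification its iterated
  -- connecting morphism is `δ_X`.
  obtain ⟨κ', h₃⟩ := (h'.ses (Fin.last _)).exists_desc (yon.map (e (Fin.last _)).hom ≫ h.q) (by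
    refine (Category.assoc _ _ _).symm.trans ((h₁.symm =≫ _).trans ?_)
    exact (Category.assoc _ _ _).trans ((κ ≫= h.ses_last.w).trans comp_zero))
  have h₄ : h'.D c (Fin.last _) ≫ (c.omPow (k + 2)).map ((toStable _).map κ₀.hom ≫
      c.bd h.ses_zero) ≫ (c.omPowComm (k + 2)).hom.app ((toStable _).obj M) =
        (toStable _).map κ' ≫ h.δ c := by
    have h₄ := comp_map_comp_map (c.bd_natural (h'.ses (Fin.last _)) h.ses_last κ
      (yon.map (e (Fin.last _)).hom) κ' h₁.symm h₃) h₂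
    refine Eq.trans ?_ h₄
    refine _ ≫= ?_
    refine (_ ≫= c.omPowComm_succ_app _ _).trans ?_
    exact (c.om.map_comp _ _).symm
  have h₅ : κ' ≫ (shift S).functor.map j ≫ (yonShiftIso S (X.obj 0)).hom =
      resι Y j' (Fin.last _) ≫ yon.map e'.hom := by
    have := (h'.ses (Fin.last _)).epi
    rw [← cancel_epi (resπ Y M' (Fin.last _)), reassoc_of% h₃, h.q_comp, ← Functor.map_comp, ← he₂,
      Functor.map_comp, ← resπ_resι Y j', Category.assoc]
    rfl
  -- The last short exact sequence of `Y` maps to the shift of `0 ⟶ M ⟶ X₁ ⟶ K ⟶ 0`; on the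
  -- quotients this map is `(-1)ⁿ S κ₀`, the only place where the sign arises.
  have h₆ : h'.q ≫ ((-1 : ℤ) ^ (k + 3) • (shift S).functor.map κ₀.hom) =
      (yon.map e'.hom ≫ (yonShiftIso S (X.obj 0)).inv) ≫ (shift S).functor.map (resπ₀ X M) := by
    have : Mono (resι X j 1) := h.mono_resι 1
    have h₇ : h'.q ≫ (shift S).functor.map j' ≫
        (shift S).functor.map (yon.map e₀.hom) ≫ (yonShiftIso S (X.obj 1)).hom =
          (-1 : ℤ) ^ (k + 3) • yon.map (e'.hom ≫ S.functor.map X.first) := by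
      refine (_ ≫= _ ≫= yonShiftIso_naturality S e₀.hom).trans ?_
      refine Eq.trans ?_ ((congr(yon.map $he₃')).trans (yon.map_zsmul ..))
      rw [Functor.map_comp, ← h'.q_comp]
      simp only [Category.assoc]
    have h₈ : resπ₀ X M ≫ resι X j 1 = yon.map X.first := resπ_resι X j 0
    rw [← cancel_mono ((shift S).functor.map (resι X j 1) ≫ (yonShiftIso S (X.obj 1)).hom)]
    simp only [Category.assoc, Preadditive.comp_zsmul, Preadditive.zsmul_comp]
    rw [← Functor.map_comp_assoc, ← Functor.map_comp_assoc, h₈, hκ₀, yonShiftIso_naturality,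
      Iso.inv_hom_id_assoc, Functor.map_comp_assoc, h₇, smul_smul, ← mul_pow, Functor.map_comp]
    simp
  have h₇ := comp_map_comp_map (c.bd_natural h'.ses_last (h.ses_zero.map (shift S)) κ'
    (yon.map e'.hom ≫ (yonShiftIso S (X.obj 0)).inv) _ (by
      rw [← reassoc_of% h₅, Iso.hom_inv_id, Category.comp_id]) h₆) h₄
  rw [c.bd_map (shift S) h.ses_zero, Functor.map_zsmul] at h₇
  refine Eq.trans ?_ (h₇.trans ?_)
  · refine _ ≫= ?_
    refine (_ ≫= c.omPowComm_succ_app _ _).trans ?_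
    exact (c.om.map_comp _ _).symm
  · rw [Functor.map_comp, Preadditive.zsmul_comp]
    refine congrArg (fun t => (-1 : ℤ) ^ (k + 3) • t) ?_
    refine Eq.trans (_ ≫= Category.assoc _ _ _) ?_
    exact (Category.assoc _ _ _).symm

end IsRes

end PreNAng

namespace PreNAng

/-! ### The isomorphism of triangle functors associated with a pre-`n`-angulation -/

lemma comp_signIso_hom_eq {D : Type*} [Category* D] [Preadditive D] {n : ℕ} {X Y : D}
    (f : X ⟶ Y) : f ≫ (signIso n Y).hom = (-1 : ℤ) ^ n • f := by
  change f ≫ ((-1 : ℤ) ^ n • 𝟙 Y) = _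
  rw [Preadditive.comp_zsmul, Category.comp_id]

lemma sign_smul_sign_smul {G : Type*} [AddCommGroup G] (n : ℕ) (g : G) :
    (-1 : ℤ) ^ n • (-1 : ℤ) ^ n • g = g := by
  rw [smul_smul, ← mul_pow, neg_mul_neg, one_mul, one_pow, one_smul]

/-- An isomorphism of triangle functors which is given by a natural isomorphism. -/
def SuspFunctor.isoOfNatIso {D : Type u} [Category.{v} D] {T : D ⥤ D} {F G : SuspFunctor T}
    (θ : F.functor ≅ G.functor)
    (h : ∀ X, F.comm.hom.app X ≫ T.map (θ.hom.app X) = θ.hom.app (T.obj X) ≫ G.comm.hom.app X) :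
    F ≅ G where
  hom := ⟨θ.hom, h⟩
  inv := ⟨θ.inv, fun X => by
    rw [← cancel_epi (θ.hom.app (T.obj X)), ← reassoc_of% (h X), ← Functor.map_comp,
      Iso.hom_inv_id_app, CategoryTheory.Functor.map_id, Category.comp_id, Iso.hom_inv_id_app_assoc]⟩
  hom_inv_id := Hom.ext θ.hom_inv_id
  inv_hom_id := Hom.ext θ.inv_hom_id

section

variable {C : Type u} [Category.{v} C] [Preadditive C] [HasZeroObject C] [HasBinaryBiproducts C]
  {S : C ≌ C} {k : ℕ}

lemma IsRes.of_mono {X : NSeq S k} (hX : X.IsExact) {M : FinPres C} (j : M ⟶ yon.obj (X.obj 0))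
    [Mono j] (w : j ≫ yon.map X.first = 0)
    (h : ∀ {Z : FinPres C} (f : Z ⟶ yon.obj (X.obj 0)), f ≫ yon.map X.first = 0 →
      ∃ g : Z ⟶ M, g ≫ j = f) : IsRes X j where
  isExact := hX
  w := w
  isKernel := ⟨KernelFork.IsLimit.ofι' _ _ fun f hf => ⟨_, (h f hf).choose_spec⟩⟩

/-- The compatibility of a morphism of triangle functors with the suspension, evaluated at an
object. -/
lemma comm_app (c : CosyzygyChoice (FinPres C))
    (Θ : shiftTriangleFunctor (shift S) c ⟶ omTriangleFunctor c (k + 3)) (M : Stable (FinPres C)) :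
    (sigma (shift S) c).hom.app M ≫ c.om.map (Θ.nat.app M) =
      (-1 : ℤ) ^ (k + 3) • (Θ.nat.app (c.om.obj M) ≫ (c.omPowComm (k + 3)).hom.app M) := by
  refine (Θ.comm M).trans ?_
  refine (Category.assoc _ _ _).symm.trans ?_
  exact comp_signIso_hom_eq _

variable [WeaklyFrobenius C]

/-- `h` determines `d'` from `T d` through isomorphisms, and by `hΘ` the same formula determines
`Θ_{M'}` from `T Θ_M`. -/
lemma rotation_aux {D : Type*} [Category* D] [Preadditive D] {T F G : D ⥤ D} {M M' : D}
    (w : M' ⟶ T.obj M) [IsIso w] (σ : F.obj (T.obj M) ⟶ T.obj (F.obj M)) [IsIso σ]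
    (γ : G.obj (T.obj M) ⟶ T.obj (G.obj M)) [IsIso γ] (Θ : F ⟶ G) (n : ℕ)
    (hΘ : σ ≫ T.map (Θ.app M) = (-1 : ℤ) ^ n • (Θ.app (T.obj M) ≫ γ))
    (d : F.obj M ⟶ G.obj M) (d' : F.obj M' ⟶ G.obj M')
    (h : d' ≫ G.map w ≫ γ = (-1 : ℤ) ^ n • (F.map w ≫ σ ≫ T.map d)) :
    T.map d = T.map (Θ.app M) ↔ d' = Θ.app M' := by
  have h' : Θ.app M' ≫ G.map w ≫ γ = (-1 : ℤ) ^ n • (F.map w ≫ σ ≫ T.map (Θ.app M)) := by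
    rw [hΘ, Preadditive.comp_zsmul, sign_smul_sign_smul, Θ.naturality_assoc]
  rw [← cancel_mono (G.map w ≫ γ), h, h', ← cancel_epi σ, ← cancel_epi (F.map w)]
  refine ⟨fun H => congrArg _ H, fun H => ?_⟩
  have := congrArg (fun t => (-1 : ℤ) ^ n • t) H
  simpa only [sign_smul_sign_smul] using this

lemma comm_of_rotation {D : Type*} [Category* D] [Preadditive D] {T F G : D ⥤ D} {M M' : D}
    (w : M' ⟶ T.obj M) [IsIso w] (σ : F.obj (T.obj M) ⟶ T.obj (F.obj M))
    (γ : G.obj (T.obj M) ⟶ T.obj (G.obj M)) (Θ : F ⟶ G) (n : ℕ)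
    (h : Θ.app M' ≫ G.map w ≫ γ = (-1 : ℤ) ^ n • (F.map w ≫ σ ≫ T.map (Θ.app M))) :
    σ ≫ T.map (Θ.app M) = (-1 : ℤ) ^ n • (Θ.app (T.obj M) ≫ γ) := by
  rw [← cancel_epi (F.map w), Preadditive.comp_zsmul, Θ.naturality_assoc, h, sign_smul_sign_smul]

/-- The rotation formula involves only `Ω⁻¹ δ_X`; faithfulness of `Ω⁻¹` recovers `δ_X` itself. -/
lemma IsRes.δ_eq_iff_of_isLeftRotation [IsIdempotentComplete C] {X : NSeq S k} {M : FinPres C}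
    {j : M ⟶ yon.obj (X.obj 0)} (h : IsRes X j) {Y : NSeq S k} {M' : FinPres C}
    {j' : M' ⟶ yon.obj (Y.obj 0)} (h' : IsRes Y j') (c : CosyzygyChoice (FinPres C))
    (Θ : shiftTriangleFunctor (shift S) c ⟶ omTriangleFunctor c (k + 3))
    (hXY : X.IsLeftRotation Y) :
    h.δ c = Θ.nat.app ((toStable _).obj M) ↔ h'.δ c = Θ.nat.app ((toStable _).obj M') := by
  obtain ⟨w, _, hw⟩ := h.δ_rotation h' c hXY
  have := c.om_faithful projective_of_injective
  refine c.om.map_injective.eq_iff.symm.trans ?_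
  exact rotation_aux (F := stableMap (shift S)) (G := c.omPow (k + 3)) w
    ((sigma (shift S) c).hom.app ((toStable _).obj M))
    ((c.omPowComm (k + 3)).hom.app ((toStable _).obj M)) Θ.nat (k + 3) (comm_app c Θ _) (h.δ c)
    (h'.δ c) hw

namespace IsPreNAngulation

variable {N : Set (NSeq S k)} (hN : IsPreNAngulation S k N)

include hN

/-- Embed `M` in a representable and the cokernel in another one; the composite comes from a
morphism of `C` with kernel `M`, which is then completed. -/
lemma exists_isRes (M : FinPres C) :
    ∃ X ∈ N, ∃ j : M ⟶ yon.obj (X.obj 0), IsRes X j := by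
  obtain ⟨A, i, _⟩ := exists_mono_yon M
  obtain ⟨B, p, _⟩ := exists_mono_yon (cokernel i)
  obtain ⟨f, hf⟩ := yon.map_surjective (cokernel.π i ≫ p)
  obtain ⟨X, hX, a, b, hab⟩ := hN.exists_weakExact f
  have hX' : yon.map X.first = yon.map a.hom ≫ cokernel.π i ≫ p ≫ yon.map b.inv := by
    rw [← reassoc_of% hf, ← Functor.map_comp, ← Functor.map_comp, ← reassoc_of% hab,
      Iso.hom_inv_id, Category.comp_id]
  refine ⟨X, hX, i ≫ yon.map a.inv, .of_mono (hN.isExact hX) _ ?_ fun {Z} f hf => ?_⟩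
  · rw [hX', Category.assoc, ← Functor.map_comp_assoc]
    simp
  · obtain ⟨g, hg⟩ := (isShortExact_cokernel i).exists_lift_kernel (f ≫ yon.map a.hom) (by
      rw [← cancel_mono (p ≫ yon.map b.inv), zero_comp]
      simpa [hX'] using hf)
    refine ⟨g, ?_⟩
    rw [reassoc_of% hg, ← Functor.map_comp]
    simp

/-- Injectivity of representables extends `g` to the first objects, the weak cokernel property of
`X.first` extends it to the second ones, and (F3) does the rest. -/
lemma exists_hom {X : NSeq S k} {M : FinPres C} {j : M ⟶ yon.obj (X.obj 0)} (hX : X ∈ N)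
    (h : IsRes X j) {Y : NSeq S k} {M' : FinPres C} {j' : M' ⟶ yon.obj (Y.obj 0)} (hY : Y ∈ N)
    (h' : IsRes Y j') (g : M ⟶ M') :
    ∃ f : NSeq.Hom X Y, g ≫ j' = j ≫ yon.map (f.app 0) := by
  have := h.mono
  obtain ⟨f₀, h₀⟩ := yon.map_surjective (Injective.factorThru (g ≫ j') j)
  have h₀' : j ≫ yon.map f₀ = g ≫ j' := by rw [h₀, Injective.comp_factorThru]
  obtain ⟨f₁, h₁⟩ := WeaklyFrobenius.exists_extension X.first (f₀ ≫ Y.first) fun V t ht => by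
    obtain ⟨s, hs⟩ := h.exists_lift (yon.map t) (by rw [← Functor.map_comp, ht, Functor.map_zero])
    apply yon.map_injective
    rw [Functor.map_comp, Functor.map_comp, ← hs, Category.assoc, reassoc_of% h₀', h'.w,
      comp_zero, comp_zero, Functor.map_zero]
  obtain ⟨f, h₂, -⟩ := hN.extend X hX Y hY f₀ f₁ h₁
  exact ⟨f, by rw [h₂, h₀']⟩

lemma δ_comp_map (c : CosyzygyChoice (FinPres C)) {X : NSeq S k} {M : FinPres C}
    {j : M ⟶ yon.obj (X.obj 0)} (hX : X ∈ N) (h : IsRes X j) {Y : NSeq S k} {M' : FinPres C}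
    {j' : M' ⟶ yon.obj (Y.obj 0)} (hY : Y ∈ N) (h' : IsRes Y j') (g : M ⟶ M') :
    h.δ c ≫ (c.omPow (k + 3)).map ((toStable _).map g) =
      (toStable _).map ((shift S).functor.map g) ≫ h'.δ c := by
  obtain ⟨f, hf⟩ := hN.exists_hom hX h hY h' g
  exact h.δ_natural_hom c h' f g hf

lemma exists_natIso (c : CosyzygyChoice (FinPres C)) :
    ∃ θ : stableMap (shift S) ≅ c.omPow (k + 3), ∀ X ∈ N, ∀ (M : FinPres C)
      (j : M ⟶ yon.obj (X.obj 0)) (h : IsRes X j), θ.hom.app ((toStable _).obj M) = h.δ c := by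
  choose X hX j h using hN.exists_isRes
  refine ⟨CategoryTheory.Quotient.natIsoLift _ (NatIso.ofComponents
    (fun M => @asIso _ _ _ _ ((h M).δ c) ((h M).isIso_δ c))
    (fun {M M'} g => (hN.δ_comp_map c (hX M) (h M) (hX M') (h M') g).symm)), fun Y hY M i hi => ?_⟩
  -- Naturality at `1_M` compares the chosen `n`-angle with an arbitrary one that has the same
  -- kernel.
  have := hN.δ_comp_map c (hX M) (h M) hY hi (𝟙 M)
  refine (Category.comp_id _).symm.trans (Eq.trans ?_ (Category.id_comp _))
  refine Eq.trans (_ ≫= ?_) (this.trans (?_ =≫ _))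
  · exact (((c.omPow (k + 3)).congr_map ((toStable _).map_id _)).trans
      ((c.omPow (k + 3)).map_id _)).symm
  · exact ((toStable _).congr_map ((shift S).functor.map_id _)).trans ((toStable _).map_id _)

/-- The compatibility with `Ω⁻¹` at `M` is `δ_rotation` for an `n`-angle and its rotation, both of
which lie in `N` and so compute `θ`. -/
lemma exists_iso [IsIdempotentComplete C] (c : CosyzygyChoice (FinPres C)) :
    ∃ Θ : shiftTriangleFunctor (shift S) c ≅ omTriangleFunctor c (k + 3), ∀ X ∈ N,
      ∀ (M : FinPres C) (j : M ⟶ yon.obj (X.obj 0)) (h : IsRes X j),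
        h.δ c = Θ.hom.nat.app ((toStable _).obj M) := by
  obtain ⟨θ, hθ⟩ := hN.exists_natIso c
  have key (M : Stable (FinPres C)) : (shiftTriangleFunctor (shift S) c).comm.hom.app M ≫
      c.om.map (θ.hom.app M) = θ.hom.app (c.om.obj M) ≫
        (omTriangleFunctor c (k + 3)).comm.hom.app M := by
    obtain ⟨M⟩ := M
    obtain ⟨X, hX, j, h⟩ := hN.exists_isRes M
    obtain ⟨Y, hY, hXY⟩ := hN.exists_rot hX
    obtain ⟨M', j', h'⟩ := (hN.isExact hY).exists_isRes
    obtain ⟨w, _, hw⟩ := h.δ_rotation h' c hXY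
    rw [← hθ X hX M j h, ← hθ Y hY M' j' h'] at hw
    have hw' := comm_of_rotation (F := stableMap (shift S)) (G := c.omPow (k + 3)) w
      ((sigma (shift S) c).hom.app ((toStable _).obj M))
      ((c.omPowComm (k + 3)).hom.app ((toStable _).obj M)) θ.hom (k + 3) hw
    refine hw'.trans ?_
    refine (comp_signIso_hom_eq _).symm.trans ?_
    exact Category.assoc _ _ _
  exact ⟨SuspFunctor.isoOfNatIso θ key, fun X hX M j h => (hθ X hX M j h).symm⟩

end IsPreNAngulation

end

end PreNAng

namespace PreNAng

/-! ### The pre-`n`-angulation associated with an isomorphism of triangle functors -/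

/-! ### Exactness of sequences under summands, sums and rotations -/

section Exactness

variable {C : Type u} [Category.{v} C] [Preadditive C]

lemma WeakExact.of_retract {X Y Z X' Y' Z' : C} {f : X ⟶ Y} {g : Y ⟶ Z} (h : WeakExact f g)
    {f' : X' ⟶ Y'} {g' : Y' ⟶ Z'} {iX : X' ⟶ X} {pX : X ⟶ X'} {iY : Y' ⟶ Y} {pY : Y ⟶ Y'}
    {iZ : Z' ⟶ Z} {pZ : Z ⟶ Z'} (hY : iY ≫ pY = 𝟙 _) (hZ : iZ ≫ pZ = 𝟙 _)
    (hf : f' ≫ iY = iX ≫ f) (hf' : f ≫ pY = pX ≫ f') (hg : g' ≫ iZ = iY ≫ g) :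
    WeakExact f' g' where
  w := by
    rw [← Category.comp_id g', ← hZ, reassoc_of% hg, reassoc_of% hf, reassoc_of% h.w, zero_comp,
      comp_zero]
  exists_lift W t ht := by
    obtain ⟨s, hs⟩ := h.exists_lift W (t ≫ iY) (by
      rw [Category.assoc, ← hg, reassoc_of% ht, zero_comp])
    exact ⟨s ≫ pX, by rw [Category.assoc, ← hf', reassoc_of% hs, hY, Category.comp_id]⟩

lemma WeakExact.of_sum {X₁ Y₁ Z₁ X₂ Y₂ Z₂ X Y Z : C} {f₁ : X₁ ⟶ Y₁} {g₁ : Y₁ ⟶ Z₁}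
    (h₁ : WeakExact f₁ g₁) {f₂ : X₂ ⟶ Y₂} {g₂ : Y₂ ⟶ Z₂} (h₂ : WeakExact f₂ g₂)
    {f : X ⟶ Y} {g : Y ⟶ Z} {iX₁ : X₁ ⟶ X} {pX₁ : X ⟶ X₁} {iX₂ : X₂ ⟶ X} {pX₂ : X ⟶ X₂}
    {iY₁ : Y₁ ⟶ Y} {pY₁ : Y ⟶ Y₁} {iY₂ : Y₂ ⟶ Y} {pY₂ : Y ⟶ Y₂}
    {iZ₁ : Z₁ ⟶ Z} {pZ₁ : Z ⟶ Z₁} {iZ₂ : Z₂ ⟶ Z} {pZ₂ : Z ⟶ Z₂}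
    (hX : pX₁ ≫ iX₁ + pX₂ ≫ iX₂ = 𝟙 X) (hY : pY₁ ≫ iY₁ + pY₂ ≫ iY₂ = 𝟙 Y)
    (hf₁ : f₁ ≫ iY₁ = iX₁ ≫ f) (hf₂ : f₂ ≫ iY₂ = iX₂ ≫ f)
    (hg₁ : g₁ ≫ iZ₁ = iY₁ ≫ g) (hg₂ : g₂ ≫ iZ₂ = iY₂ ≫ g)
    (hg₁' : g ≫ pZ₁ = pY₁ ≫ g₁) (hg₂' : g ≫ pZ₂ = pY₂ ≫ g₂) : WeakExact f g where
  w := by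
    rw [← Category.id_comp f, ← hX]
    simp only [Preadditive.add_comp, Category.assoc]
    rw [← reassoc_of% hf₁, ← reassoc_of% hf₂, ← hg₁, ← hg₂, reassoc_of% h₁.w, reassoc_of% h₂.w]
    simp
  exists_lift W t ht := by
    obtain ⟨s₁, hs₁⟩ := h₁.exists_lift W (t ≫ pY₁) (by
      rw [Category.assoc, ← hg₁', reassoc_of% ht, zero_comp])
    obtain ⟨s₂, hs₂⟩ := h₂.exists_lift W (t ≫ pY₂) (by
      rw [Category.assoc, ← hg₂', reassoc_of% ht, zero_comp])
    refine ⟨s₁ ≫ iX₁ + s₂ ≫ iX₂, ?_⟩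
    rw [Preadditive.add_comp, Category.assoc, Category.assoc, ← hf₁, ← hf₂, reassoc_of% hs₁,
      reassoc_of% hs₂, ← Preadditive.comp_add, hY, Category.comp_id]

lemma WeakExact.iff_of_iso {X Y Z X' Y' Z' : C} {f : X ⟶ Y} {g : Y ⟶ Z} {f' : X' ⟶ Y'}
    {g' : Y' ⟶ Z'} (a : X ≅ X') (b : Y ≅ Y') (d : Z ≅ Z')
    (hab : f ≫ b.hom = a.hom ≫ f') (hbd : g ≫ d.hom = b.hom ≫ g') :
    WeakExact f g ↔ WeakExact f' g' :=
  ⟨fun h => h.of_iso a b d hab hbd, fun h => h.of_iso a.symm b.symm d.symm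
    (by simp [Iso.comp_inv_eq, hab]) (by simp [Iso.comp_inv_eq, hbd])⟩

lemma WeakExact.iff_map {X Y Z : C} {f : X ⟶ Y} {g : Y ⟶ Z} (S : C ≌ C) [S.functor.Additive] :
    WeakExact f g ↔ WeakExact (S.functor.map f) (S.functor.map g) :=
  ⟨fun h => h.map S, .of_map S⟩

lemma WeakExact.iff_zsmul {X Y Z : C} {f : X ⟶ Y} {g : Y ⟶ Z} (n : ℕ) :
    WeakExact f g ↔ WeakExact ((-1 : ℤ) ^ n • f) g :=
  WeakExact.iff_of_iso (signIso n X) (.refl _) (.refl _)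
    (by
      change f ≫ 𝟙 Y = ((-1 : ℤ) ^ n • 𝟙 X) ≫ ((-1 : ℤ) ^ n • f)
      rw [Preadditive.zsmul_comp, Category.comp_id, Category.id_comp, sign_smul_sign_smul])
    (by simp)

namespace NSeq

variable {S : C ≌ C} {k : ℕ}

lemma Hom.comm_first {X Y : NSeq S k} (f : Hom X Y) : X.first ≫ f.app 1 = f.app 0 ≫ Y.first :=
  f.comm 0

variable [HasZeroObject C] [HasBinaryBiproducts C]

lemma IsExact.of_retract {X Z : NSeq S k} (hZ : Z.IsExact) (i : Hom X Z) (p : Hom Z X)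
    (h : ∀ l, i.app l ≫ p.app l = 𝟙 _) : X.IsExact where
  mid l := (hZ.mid l).of_retract (h _) (h _) (i.comm l.castSucc) (p.comm l.castSucc) (i.comm l.succ)
  pre := hZ.pre.of_retract (h _) (by rw [← S.functor.map_comp, h 0, S.functor.map_id])
    (i.comm _) (p.comm _) i.comm_last
  post := hZ.post.of_retract (iY := S.functor.map (i.app 0)) (pY := S.functor.map (p.app 0))
    (iZ := S.functor.map (i.app 1)) (pZ := S.functor.map (p.app 1))
    (by rw [← S.functor.map_comp, h 0, S.functor.map_id])
    (by rw [← S.functor.map_comp, h 1, S.functor.map_id])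
    i.comm_last p.comm_last
    (by rw [← S.functor.map_comp, ← S.functor.map_comp, i.comm_first])

lemma IsDirectSum.isExact {X Y Z : NSeq S k} (h : IsDirectSum X Y Z) (hX : X.IsExact)
    (hY : Y.IsExact) : Z.IsExact := by
  obtain ⟨i₁, p₁, i₂, p₂, h⟩ := h
  have hs (l) : S.functor.map (p₁.app l) ≫ S.functor.map (i₁.app l) +
      S.functor.map (p₂.app l) ≫ S.functor.map (i₂.app l) = 𝟙 _ := by
    rw [← S.functor.map_comp, ← S.functor.map_comp, ← Functor.map_add, (h l).2.2.2.2,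
      CategoryTheory.Functor.map_id]
  refine ⟨fun l => (hX.mid l).of_sum (hY.mid l) (h _).2.2.2.2 (h _).2.2.2.2 (i₁.comm l.castSucc)
    (i₂.comm l.castSucc) (i₁.comm l.succ) (i₂.comm l.succ) (p₁.comm l.succ) (p₂.comm l.succ),
    hX.pre.of_sum hY.pre (h _).2.2.2.2 (h _).2.2.2.2 (i₁.comm _) (i₂.comm _) i₁.comm_last
      i₂.comm_last p₁.comm_last p₂.comm_last,
    hX.post.of_sum hY.post (h _).2.2.2.2 (hs 0) i₁.comm_last i₂.comm_last
      (iZ₁ := S.functor.map (i₁.app 1)) (iZ₂ := S.functor.map (i₂.app 1))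
      (pZ₁ := S.functor.map (p₁.app 1)) (pZ₂ := S.functor.map (p₂.app 1)) ?_ ?_ ?_ ?_⟩
  all_goals rw [← S.functor.map_comp, ← S.functor.map_comp, Hom.comm_first]

/-- Rotation permutes the exactness conditions cyclically; the one that wraps around is shifted by
`S` and changed by a sign, which does not affect weak exactness. -/
lemma IsLeftRotation.isExact_iff {X Y : NSeq S k} (h : X.IsLeftRotation Y) :
    X.IsExact ↔ Y.IsExact := by
  obtain ⟨a, b, l, h₁, h₂⟩ := h.exists_iso
  obtain ⟨e, e', he₁, he₂, he₃⟩ := h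
  have ht (i : Fin k) : WeakExact (Y.map i.castSucc.castSucc) (Y.map i.castSucc.succ) ↔
      WeakExact (X.map i.succ.castSucc) (X.map i.succ.succ) :=
    WeakExact.iff_of_iso (e i.castSucc.castSucc) (e i.castSucc.succ) (e i.succ.succ)
      (he₁ i.castSucc) (he₁ i.succ)
  have hl : WeakExact (Y.map (Fin.last k).castSucc) (Y.map (Fin.last k).succ) ↔
      WeakExact (X.map (Fin.last (k + 1))) X.last :=
    WeakExact.iff_of_iso (e (Fin.last k).castSucc) (e (Fin.last k).succ) e' (he₁ (Fin.last k)) he₂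
  have hp : WeakExact (Y.map (Fin.last (k + 1))) Y.last ↔
      WeakExact X.last (S.functor.map X.first) :=
    WeakExact.iff_of_iso (e (Fin.last (k + 1))) e' (S.functor.mapIso (e 0) ≪≫ signIso (k + 3) _) he₂
      ((Category.assoc _ _ _).symm.trans (comp_signIso_hom he₃))
  have hq : WeakExact Y.last (S.functor.map Y.first) ↔ WeakExact X.first X.second := by
    rw [WeakExact.iff_map (f := X.first) S, WeakExact.iff_zsmul (f := Y.last) (k + 3)]
    exact WeakExact.iff_of_iso l (S.functor.mapIso a) (S.functor.mapIso b)
      ((Preadditive.zsmul_comp _ _ _).trans ((congrArg (fun t => (-1 : ℤ) ^ (k + 3) • t) h₂).trans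
        (sign_smul_sign_smul _ _)))
      ((S.functor.map_comp _ _).symm.trans ((S.functor.congr_map h₁).trans
        (S.functor.map_comp _ _)))
  constructor
  · refine fun hX => ⟨fun i => ?_, hp.2 hX.post, hq.2 (hX.mid 0)⟩
    induction i using Fin.lastCases with
    | last => exact hl.2 hX.pre
    | cast i => exact (ht i).2 (hX.mid i.succ)
  · refine fun hY => ⟨fun i => ?_, hl.1 (hY.mid (Fin.last k)), hp.1 hY.pre⟩
    induction i using Fin.cases with
    | zero => exact hq.1 hY.post
    | succ i => exact (ht i).1 (hY.mid i.castSucc)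

end NSeq

end Exactness

/-! ### Closure properties of the class defined by a morphism of triangle functors -/

section Angles

variable {C : Type u} [Category.{v} C] [Preadditive C] [HasZeroObject C] [HasBinaryBiproducts C]
  {S : C ≌ C} {k : ℕ} [WeaklyFrobenius C] {c : CosyzygyChoice (FinPres C)}
  (Θ : shiftTriangleFunctor (shift S) c ⟶ omTriangleFunctor c (k + 3))

/-- The value of `Θ` at a finitely presented functor. -/
def compAt (M : FinPres C) : (toStable _).obj ((shift S).functor.obj M) ⟶
    (c.omPow (k + 3)).obj ((toStable _).obj M) :=
  Θ.nat.app ((toStable _).obj M)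

variable {Θ} in
lemma compAt_natural {M M' : FinPres C} (g : M ⟶ M') :
    compAt Θ M ≫ (c.omPow (k + 3)).map ((toStable _).map g) =
      (toStable _).map ((shift S).functor.map g) ≫ compAt Θ M' :=
  (Θ.nat.naturality ((toStable _).map g)).symm

/-- The exact sequences `X` such that `Θ_M = δ_X` for the kernels `M` of `C(-, α₁)`. -/
def angles : Set (NSeq S k) :=
  {X | X.IsExact ∧ ∀ (M : FinPres C) (j : M ⟶ yon.obj (X.obj 0)) (h : IsRes X j),
    h.δ c = compAt Θ M}

variable {Θ}

/-- The difference of `δ_X` and `Θ_M`. -/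
def IsRes.defect {X : NSeq S k} {M : FinPres C} {j : M ⟶ yon.obj (X.obj 0)} (h : IsRes X j)
    (Θ : shiftTriangleFunctor (shift S) c ⟶ omTriangleFunctor c (k + 3)) :
    (toStable _).obj ((shift S).functor.obj M) ⟶ (c.omPow (k + 3)).obj ((toStable _).obj M) :=
  h.δ c - compAt Θ M

namespace IsRes

variable {X : NSeq S k} {M : FinPres C} {j : M ⟶ yon.obj (X.obj 0)} (h : IsRes X j)

lemma defect_eq_zero_iff : h.defect Θ = 0 ↔ h.δ c = compAt Θ M :=
  sub_eq_zero

lemma defect_natural {Y : NSeq S k} {M' : FinPres C} {j' : M' ⟶ yon.obj (Y.obj 0)}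
    (h' : IsRes Y j') (f : NSeq.Hom X Y) (g : M ⟶ M') (hg : g ≫ j' = j ≫ yon.map (f.app 0)) :
    h.defect Θ ≫ (c.omPow (k + 3)).map ((toStable _).map g) =
      (toStable _).map ((shift S).functor.map g) ≫ h'.defect Θ := by
  rw [defect, defect, Preadditive.sub_comp, Preadditive.comp_sub, h.δ_natural_hom c h' f g hg,
    compAt_natural]

include h in
lemma exists_map_kernel {Y : NSeq S k} {M' : FinPres C} {j' : M' ⟶ yon.obj (Y.obj 0)}
    (h' : IsRes Y j') (a : X.obj 0 ⟶ Y.obj 0) (b : X.obj 1 ⟶ Y.obj 1)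
    (w : X.first ≫ b = a ≫ Y.first) : ∃ g : M ⟶ M', g ≫ j' = j ≫ yon.map a :=
  h'.exists_lift _ (by
    rw [Category.assoc, ← Functor.map_comp, ← w, Functor.map_comp, reassoc_of% h.w, zero_comp])

/-- Two kernels of the same morphism are isomorphic and the defect is natural, so one kernel
suffices. The closure properties thereby reduce to the vanishing of a natural additive quantity. -/
lemma mem_angles_iff : X ∈ angles Θ ↔ h.defect Θ = 0 := by
  refine ⟨fun hX => h.defect_eq_zero_iff.2 (hX.2 _ _ h), fun h₀ => ⟨h.isExact, fun M' j' h' => ?_⟩⟩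
  rw [← defect_eq_zero_iff]
  let f : NSeq.Hom X X := ⟨fun _ => 𝟙 _, fun i => by simp, by simp⟩
  obtain ⟨g, hg⟩ := h.exists_map_kernel h' _ _ f.comm_first
  obtain ⟨g', hg'⟩ := h'.exists_map_kernel h _ _ f.comm_first
  have hgg : g' ≫ g = 𝟙 M' := by
    have := h'.mono
    rw [← cancel_mono j', Category.assoc, hg, reassoc_of% hg']
    simp [f]
  have h₁ := h.defect_natural (Θ := Θ) h' f g hg
  rw [h₀, zero_comp] at h₁
  have h₂ := (toStable _).map ((shift S).functor.map g') ≫= h₁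
  rw [comp_zero, ← Functor.map_comp_assoc, ← Functor.map_comp, hgg] at h₂
  simpa using h₂.symm

end IsRes

lemma retract_mem_angles {X Z : NSeq S k} (hZ : Z ∈ angles Θ) (i : NSeq.Hom X Z)
    (p : NSeq.Hom Z X) (hip : ∀ l, i.app l ≫ p.app l = 𝟙 _) : X ∈ angles Θ := by
  obtain ⟨M, j, h⟩ := (hZ.1.of_retract i p hip).exists_isRes
  obtain ⟨M', j', h'⟩ := hZ.1.exists_isRes
  rw [h.mem_angles_iff]
  rw [h'.mem_angles_iff] at hZ
  obtain ⟨g, hg⟩ := h.exists_map_kernel h' _ _ i.comm_first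
  obtain ⟨g', hg'⟩ := h'.exists_map_kernel h _ _ p.comm_first
  have hgg : g ≫ g' = 𝟙 M := by
    have := h.mono
    rw [← cancel_mono j, Category.assoc, hg', reassoc_of% hg, ← Functor.map_comp, hip]
    simp
  have h₁ := h.defect_natural (Θ := Θ) h' i g hg
  rw [hZ, comp_zero] at h₁
  have h₂ := h₁ =≫ (c.omPow (k + 3)).map ((toStable _).map g')
  rw [zero_comp, Category.assoc, ← Functor.map_comp, ← Functor.map_comp, hgg] at h₂
  simpa using h₂

lemma directSum_mem_angles {X Y Z : NSeq S k} (hXYZ : NSeq.IsDirectSum X Y Z)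
    (hX : X ∈ angles Θ) (hY : Y ∈ angles Θ) : Z ∈ angles Θ := by
  obtain ⟨M, j, h⟩ := (hXYZ.isExact hX.1 hY.1).exists_isRes
  obtain ⟨M₁, j₁, h₁⟩ := hX.1.exists_isRes
  obtain ⟨M₂, j₂, h₂⟩ := hY.1.exists_isRes
  rw [h.mem_angles_iff]
  rw [h₁.mem_angles_iff] at hX
  rw [h₂.mem_angles_iff] at hY
  obtain ⟨i₁, p₁, i₂, p₂, hip⟩ := hXYZ
  obtain ⟨a₁, ha₁⟩ := h₁.exists_map_kernel h _ _ i₁.comm_first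
  obtain ⟨b₁, hb₁⟩ := h.exists_map_kernel h₁ _ _ p₁.comm_first
  obtain ⟨a₂, ha₂⟩ := h₂.exists_map_kernel h _ _ i₂.comm_first
  obtain ⟨b₂, hb₂⟩ := h.exists_map_kernel h₂ _ _ p₂.comm_first
  have hM : b₁ ≫ a₁ + b₂ ≫ a₂ = 𝟙 M := by
    have := h.mono
    rw [← cancel_mono j, Preadditive.add_comp, Category.assoc, Category.assoc, ha₁, ha₂,
      reassoc_of% hb₁, reassoc_of% hb₂, ← Functor.map_comp, ← Functor.map_comp,
      ← Preadditive.comp_add, ← Functor.map_add, (hip 0).2.2.2.2]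
    simp
  have e₁ := h₁.defect_natural (Θ := Θ) h i₁ a₁ ha₁
  have e₂ := h₂.defect_natural (Θ := Θ) h i₂ a₂ ha₂
  rw [hX, zero_comp] at e₁
  rw [hY, zero_comp] at e₂
  have : (toStable _).map ((shift S).functor.map (b₁ ≫ a₁ + b₂ ≫ a₂)) ≫ h.defect Θ = 0 := by
    rw [Functor.map_add, Functor.map_add, Preadditive.add_comp, Functor.map_comp,
      Functor.map_comp, Functor.map_comp, Functor.map_comp, Category.assoc, Category.assoc,
      ← e₁, ← e₂, comp_zero, comp_zero, add_zero]
  rw [hM] at this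
  simpa using this

lemma trivial_mem_angles {N : Set (NSeq S k)} (hN : IsPreNAngulation S k N) (X : C) :
    NSeq.trivial S k X ∈ angles Θ := by
  obtain ⟨M, j, h⟩ := (hN.isExact (hN.trivial_mem X)).exists_isRes
  rw [h.mem_angles_iff]
  have hM : 𝟙 M = 0 := by
    have := h.mono
    have hj : j = 0 := (Category.comp_id _).symm.trans ((j ≫= (yon.map_id X).symm).trans h.w)
    rw [← cancel_mono j, hj, comp_zero, comp_zero]
  have : 𝟙 ((toStable _).obj ((shift S).functor.obj M)) = 0 := by
    rw [← CategoryTheory.Functor.map_id, ← CategoryTheory.Functor.map_id, hM, Functor.map_zero,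
      Functor.map_zero]
  rw [← Category.id_comp (h.defect Θ), this, zero_comp]

lemma rotate_mem_angles_iff [IsIdempotentComplete C] {X Y : NSeq S k} (hXY : X.IsLeftRotation Y) :
    X ∈ angles Θ ↔ Y ∈ angles Θ := by
  have key (hX : X.IsExact) (hY : Y.IsExact) : X ∈ angles Θ ↔ Y ∈ angles Θ := by
    obtain ⟨M, j, h⟩ := hX.exists_isRes
    obtain ⟨M', j', h'⟩ := hY.exists_isRes
    rw [h.mem_angles_iff, h'.mem_angles_iff, h.defect_eq_zero_iff, h'.defect_eq_zero_iff]
    exact h.δ_eq_iff_of_isLeftRotation h' c Θ hXY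
  exact ⟨fun h => (key h.1 (hXY.isExact_iff.1 h.1)).1 h,
    fun h => (key (hXY.isExact_iff.2 h.1) h.1).2 h⟩

end Angles

end PreNAng

namespace PreNAng

/-! ### The completion of morphisms and of commutative squares -/

section Extend

variable {C : Type u} [Category.{v} C] [Preadditive C] [HasZeroObject C] [HasBinaryBiproducts C]
  {S : C ≌ C} {k : ℕ} [WeaklyFrobenius C]

lemma WeakExact.exists_desc {X Y Z W : C} {f : X ⟶ Y} {g : Y ⟶ Z} (h : WeakExact f g)
    (t : Y ⟶ W) (ht : f ≫ t = 0) : ∃ s, g ≫ s = t :=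
  WeaklyFrobenius.exists_extension g t fun V s hs => by
    obtain ⟨r, rfl⟩ := h.exists_lift V s hs
    rw [Category.assoc, ht, comp_zero]

/-- Each morphism is a weak cokernel of the preceding one, so components can be added one by one.
Nothing is claimed about the square that ends in `S Y₁`. -/
lemma NSeq.IsExact.exists_extension {X Y : NSeq S k} (hX : X.IsExact) (hY : Y.IsExact)
    (φ₁ : X.obj 0 ⟶ Y.obj 0) (φ₂ : X.obj 1 ⟶ Y.obj 1) (hφ : X.first ≫ φ₂ = φ₁ ≫ Y.first) :
    ∃ f : ∀ i, X.obj i ⟶ Y.obj i, f 0 = φ₁ ∧ f 1 = φ₂ ∧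
      ∀ i : Fin (k + 2), X.map i ≫ f i.succ = f i.castSucc ≫ Y.map i := by
  have step (i : Fin (k + 1)) (a : X.obj i.castSucc.castSucc ⟶ Y.obj i.castSucc.castSucc)
      (b : X.obj i.castSucc.succ ⟶ Y.obj i.castSucc.succ)
      (hab : X.map i.castSucc ≫ b = a ≫ Y.map i.castSucc) :
      ∃ d : X.obj i.succ.succ ⟶ Y.obj i.succ.succ, X.map i.succ ≫ d = b ≫ Y.map i.succ :=
    (hX.mid i).exists_desc (b ≫ Y.map i.succ)
      ((Category.assoc _ _ _).symm.trans ((hab =≫ _).trans ((Category.assoc _ _ _).trans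
        ((a ≫= (hY.mid i).w).trans comp_zero))))
  choose d hd using step
  -- The recursion carries two consecutive components with their commuting square, since the next
  -- component is obtained from that square.
  let P : ∀ i : Fin (k + 2), {p : (X.obj i.castSucc ⟶ Y.obj i.castSucc) ×
      (X.obj i.succ ⟶ Y.obj i.succ) // X.map i ≫ p.2 = p.1 ≫ Y.map i} :=
    Fin.induction ⟨(φ₁, φ₂), hφ⟩ fun i p =>
      ⟨(p.1.2, d i p.1.1 p.1.2 p.2), hd i p.1.1 p.1.2 p.2⟩
  refine ⟨Fin.cases φ₁ fun i => (P i).1.2, rfl, rfl, fun i => ?_⟩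
  induction i using Fin.cases with
  | zero => exact hφ
  | succ i => exact (P i.succ).2

lemma IsRes.exists_desc_shift {X : NSeq S k} {M : FinPres C} {j : M ⟶ yon.obj (X.obj 0)}
    (h : IsRes X j) {Y : NSeq S k} {M' : FinPres C} {j' : M' ⟶ yon.obj (Y.obj 0)} (h' : IsRes Y j')
    (c : CosyzygyChoice (FinPres C)) (f : ∀ i, X.obj i ⟶ Y.obj i)
    (hf : ∀ i : Fin (k + 2), X.map i ≫ f i.succ = f i.castSucc ≫ Y.map i)
    (g : M ⟶ M') (hg : g ≫ j' = j ≫ yon.map (f 0)) :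
    ∃ u, h.q ≫ u = yon.map (f (Fin.last (k + 2))) ≫ h'.q := by
  obtain ⟨κ, h₁, -⟩ := exists_map c h h' f hf g hg (Fin.last (k + 2))
  exact h.ses_last.exists_desc _ (by rw [← reassoc_of% h₁, h'.ses_last.w, comp_zero])

variable [IsIdempotentComplete C] {c : CosyzygyChoice (FinPres C)}
  (Θ : shiftTriangleFunctor (shift S) c ⟶ omTriangleFunctor c (k + 3))

/-- The weak cokernel property gives all components, with every square but the last commuting. The
failure of the last one is the difference of `S g` and the induced `u : S M ⟶ S M'`. Since `δ = Θ`
on both sequences and `Θ` is natural and invertible, this difference is stably zero; it then factors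
through a projective and can be absorbed in the last component. -/
lemma exists_hom_of_mem_angles [∀ M, IsIso (compAt Θ M)] {X Y : NSeq S k} (hX : X ∈ angles Θ)
    (hY : Y ∈ angles Θ) (φ₁ : X.obj 0 ⟶ Y.obj 0) (φ₂ : X.obj 1 ⟶ Y.obj 1)
    (hφ : X.first ≫ φ₂ = φ₁ ≫ Y.first) :
    ∃ φ : NSeq.Hom X Y, φ.app 0 = φ₁ ∧ φ.app 1 = φ₂ := by
  obtain ⟨M, j, h⟩ := hX.1.exists_isRes
  obtain ⟨M', j', h'⟩ := hY.1.exists_isRes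
  obtain ⟨f, hf₀, hf₁, hf⟩ := hX.1.exists_extension hY.1 φ₁ φ₂ hφ
  obtain ⟨g, hg⟩ := h.exists_map_kernel h' φ₁ φ₂ hφ
  have hg' : g ≫ j' = j ≫ yon.map (f 0) := by rw [hf₀, hg]
  obtain ⟨u, hu⟩ := h.exists_desc_shift h' c f hf g hg'
  have hn := h.δ_natural c h' f hf g hg' u hu
  rw [hX.2 M j h, hY.2 M' j' h', compAt_natural, cancel_mono, toStable_map_eq_iff] at hn
  obtain ⟨J, hJ, a, b, hab⟩ := hn
  have := projective_of_injective J hJ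
  have := h'.epi_q
  -- `t` lifts the error `h.q ≫ (S g - u)` along `h'.q`. It begins with `h.q`, which kills the image
  -- of `αₙ₋₁`, so adding `t` keeps the preceding square commutative.
  obtain ⟨t, ht⟩ := yon.map_surjective (h.q ≫ a ≫ Projective.factorThru b h'.q)
  have ht' : h.q ≫ (shift S).functor.map g = (yon.map (f (Fin.last (k + 2)) + t)) ≫ h'.q := by
    rw [Functor.map_add, Preadditive.add_comp, ← hu, ht, Category.assoc, Category.assoc,
      Projective.factorThru_comp, ← hab, ← Preadditive.comp_add]
    simp
  have ht₀ : X.map (Fin.last (k + 1)) ≫ t = 0 := by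
    apply yon.map_injective
    rw [Functor.map_comp, ht, Functor.map_zero, ← resπ_resι X j]
    refine (Category.assoc _ _ _).trans ((_ ≫= ?_).trans comp_zero)
    exact (Category.assoc _ _ _).symm.trans ((h.ses_last.w =≫ _).trans zero_comp)
  obtain ⟨f', hl, hc⟩ : ∃ f' : ∀ i, X.obj i ⟶ Y.obj i,
      f' (Fin.last (k + 2)) = f (Fin.last (k + 2)) + t ∧
        ∀ i : Fin (k + 2), f' i.castSucc = f i.castSucc :=
    ⟨Fin.lastCases (f (Fin.last (k + 2)) + t) fun i => f i.castSucc, Fin.lastCases_last,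
      fun i => Fin.lastCases_castSucc i⟩
  have hc₀ : f' 0 = f 0 := hc 0
  refine ⟨⟨f', fun i => ?_, ?_⟩, hc₀.trans hf₀, (hc 1).trans hf₁⟩
  · rw [hc]
    induction i using Fin.lastCases with
    | last =>
      refine (_ ≫= hl).trans ?_
      refine (Preadditive.comp_add _ _ _ _ _ _).trans ?_
      rw [ht₀, add_zero]
      exact hf _
    | cast i => exact (_ ≫= hc i.succ).trans (hf _)
  · rw [hl, hc₀]
    apply yon.map_injective
    rw [Functor.map_comp, Functor.map_comp, ← h'.q_comp, ← reassoc_of% ht', ← h.q_comp,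
      ← Functor.map_comp_assoc, hg', Functor.map_comp_assoc]
    simp only [Category.assoc]
    rw [yonShiftIso_naturality]

end Extend

/-! ### Replacing the last term of an exact sequence -/

section Complete

variable {C : Type u} [Category.{v} C] [Preadditive C] [HasZeroObject C] [HasBinaryBiproducts C]
  {S : C ≌ C} {k : ℕ} [WeaklyFrobenius C]

/-- Only `Xₙ` changes, to the middle term of another extension of `S M` by the same kernel. The map
of extensions over `u` and the identity of `M` fit into `δ_natural`, which accounts for the factor
`u`. -/
lemma IsRes.exists_replace_last {X : NSeq S k} {M : FinPres C} {j : M ⟶ yon.obj (X.obj 0)}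
    (h : IsRes X j) (c : CosyzygyChoice (FinPres C)) {E : C}
    {ι : resK X M (Fin.last (k + 2)) ⟶ yon.obj E} {q : yon.obj E ⟶ (shift S).functor.obj M}
    (hE : IsShortExact ι q) (p : E ⟶ X.obj (Fin.last (k + 2)))
    (u : (shift S).functor.obj M ⟶ (shift S).functor.obj M)
    (hp : ι ≫ yon.map p = resι X j (Fin.last (k + 2))) (hu : q ≫ u = yon.map p ≫ h.q) :
    ∃ (Y : NSeq S k) (a : Y.obj 0 ≅ X.obj 0) (b : Y.obj 1 ≅ X.obj 1)
      (h' : IsRes Y (j ≫ yon.map a.inv)), Y.first ≫ b.hom = a.hom ≫ X.first ∧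
        h'.δ c = (toStable _).map u ≫ h.δ c := by
  have := hE.mono
  have := hE.epi
  obtain ⟨α, hα⟩ := yon.map_surjective (resπ X M (Fin.last (k + 1)) ≫ ι)
  obtain ⟨β, hβ⟩ := yon.map_surjective
    (q ≫ (shift S).functor.map j ≫ (yonShiftIso S (X.obj 0)).hom)
  obtain ⟨Y, e, e', h₁, h₂, h₃⟩ := NSeq.exists_of_snoc (S := S) (fun i => X.obj i.castSucc)
    (fun i => X.map i.castSucc) E α β
  have := h.mono_shift_comp
  have hαp : α ≫ p = X.map (Fin.last (k + 1)) := by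
    apply yon.map_injective
    rw [Functor.map_comp, hα, Category.assoc, hp]
    exact resπ_resι X j _
  -- `α` and `αₙ₋₁` are the same projection followed by two monomorphisms, so they kill the same
  -- morphisms.
  have hα₀ {W : C} (x : W ⟶ X.obj (Fin.last (k + 1)).castSucc) :
      x ≫ α = 0 ↔ x ≫ X.map (Fin.last (k + 1)) = 0 := by
    refine ⟨fun hx => by rw [← hαp, reassoc_of% hx, zero_comp], fun hx => ?_⟩
    have := h.mono_resι (Fin.last (k + 2))
    have hx' : yon.map x ≫ resπ X M (Fin.last (k + 1)) = 0 := by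
      refine (cancel_mono (resι X j (Fin.last (k + 2)))).1 ?_
      refine (Category.assoc _ _ _).trans ((_ ≫= resπ_resι X j _).trans ?_)
      exact (yon.map_comp _ _).symm.trans ((congrArg yon.map hx).trans
        ((yon.map_zero _ _).trans zero_comp.symm))
    apply yon.map_injective
    rw [Functor.map_comp, hα, Functor.map_zero]
    exact (Category.assoc _ _ _).symm.trans ((hx' =≫ _).trans zero_comp)
  have hY₁ : WeakExact (X.map (Fin.last k).castSucc) α :=
    ⟨(hα₀ _).2 (h.isExact.mid (Fin.last k)).w,
      fun W t ht => (h.isExact.mid (Fin.last k)).exists_lift W t ((hα₀ _).1 ht)⟩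
  have hY₂ : WeakExact α β := by
    refine ⟨yon.map_injective ?_, fun W t ht => ?_⟩
    · rw [Functor.map_comp, hα, hβ, Functor.map_zero, Category.assoc, reassoc_of% hE.w, zero_comp,
        comp_zero]
    · obtain ⟨g, hg⟩ := hE.exists_lift_kernel (yon.map t) (by
        rw [← cancel_mono ((shift S).functor.map j ≫ (yonShiftIso S (X.obj 0)).hom), zero_comp,
          Category.assoc, ← hβ, ← Functor.map_comp, ht, Functor.map_zero])
      have : Epi (resπ X M (Fin.last (k + 1))) := (h.ses (Fin.last (k + 1))).epi
      obtain ⟨s, hs⟩ := yon.map_surjective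
        (Projective.factorThru g (resπ X M (Fin.last (k + 1))))
      refine ⟨s, yon.map_injective ?_⟩
      rw [Functor.map_comp, hα, hs, ← hg]
      exact (Category.assoc _ _ _).symm.trans (Projective.factorThru_comp g _ =≫ ι)
  have hY₃ : WeakExact β (S.functor.map X.first) := by
    refine ⟨yon.map_injective ?_, fun W t ht => ?_⟩
    · rw [Functor.map_comp, hβ, Functor.map_zero, Category.assoc, h.shift_w, comp_zero]
    · obtain ⟨r, hr⟩ := h.exists_shift_lift (yon.map t) (by
        rw [← Functor.map_comp, ht, Functor.map_zero])
      obtain ⟨s, hs⟩ := yon.map_surjective (Projective.factorThru r q)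
      refine ⟨s, yon.map_injective ?_⟩
      rw [Functor.map_comp, hβ, hs, Projective.factorThru_comp_assoc, hr]
  have hY : Y.IsExact := by
    refine ⟨fun i => ?_, ?_, ?_⟩
    · induction i using Fin.lastCases with
      | last =>
        exact (WeakExact.iff_of_iso (e (Fin.last k).castSucc) (e (Fin.last k).succ) e'
          (h₁ (Fin.last k)) h₂).2 hY₁
      | cast i =>
        exact (WeakExact.iff_of_iso (e i.castSucc.castSucc) (e i.castSucc.succ) (e i.succ.succ)
          (h₁ i.castSucc) (h₁ i.succ)).2 (h.isExact.mid i.castSucc)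
    · exact (WeakExact.iff_of_iso (e (Fin.last (k + 1))) e' (S.functor.mapIso (e 0)) h₂ h₃).2 hY₂
    · exact (WeakExact.iff_of_iso e' (S.functor.mapIso (e 0)) (S.functor.mapIso (e 1)) h₃
        ((S.functor.map_comp _ _).symm.trans ((S.functor.congr_map (h₁ 0)).trans
          (S.functor.map_comp _ _)))).2 hY₃
  obtain ⟨(a : Y.obj 0 ≅ X.obj 0), ha⟩ : ∃ a, a = e 0 := ⟨_, rfl⟩
  obtain ⟨(b : Y.obj 1 ≅ X.obj 1), hb⟩ : ∃ b, b = e 1 := ⟨_, rfl⟩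
  have hab : Y.first ≫ b.hom = a.hom ≫ X.first := by
    rw [ha, hb]
    exact h₁ 0
  have hYX : yon.map Y.first = yon.map a.hom ≫ yon.map X.first ≫ yon.map b.inv := by
    rw [← Functor.map_comp, ← Functor.map_comp, ← reassoc_of% hab, Iso.hom_inv_id,
      Category.comp_id]
  have := h.mono
  have h' : IsRes Y (j ≫ yon.map a.inv) := by
    refine .of_mono hY _ ?_ fun {Z} f hf => ?_
    · rw [hYX, Category.assoc, ← Functor.map_comp_assoc, Iso.inv_hom_id,
        CategoryTheory.Functor.map_id, Category.id_comp, reassoc_of% h.w, zero_comp]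
    · obtain ⟨g, hg⟩ := h.exists_lift (f ≫ yon.map a.hom) (by
        rw [← cancel_mono (yon.map b.inv), zero_comp]
        simpa [hYX] using hf)
      refine ⟨g, ?_⟩
      rw [reassoc_of% hg, ← Functor.map_comp, Iso.hom_inv_id, CategoryTheory.Functor.map_id,
        Category.comp_id]
  refine ⟨Y, a, b, h', hab, ?_⟩
  have h₃' : Y.last ≫ S.functor.map a.hom = e'.hom ≫ β := by
    rw [ha]
    exact h₃
  have hq : h'.q = yon.map e'.hom ≫ q := by
    have := h'.mono_shift_comp
    rw [← cancel_mono ((shift S).functor.map (j ≫ yon.map a.inv) ≫ (yonShiftIso S (Y.obj 0)).hom),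
      h'.q_comp, Functor.map_comp, Category.assoc, Category.assoc,
      yonShiftIso_naturality, ← reassoc_of% hβ, ← Functor.map_comp, ← Functor.map_comp,
      ← reassoc_of% h₃', ← S.functor.map_comp, Iso.hom_inv_id, CategoryTheory.Functor.map_id,
      Category.comp_id]
  obtain ⟨f, hl, hc⟩ : ∃ f : ∀ i, Y.obj i ⟶ X.obj i,
      f (Fin.last (k + 2)) = e'.hom ≫ p ∧ ∀ i : Fin (k + 2), f i.castSucc = (e i).hom :=
    ⟨Fin.lastCases (e'.hom ≫ p) fun i => (e i).hom, Fin.lastCases_last,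
      fun i => Fin.lastCases_castSucc i⟩
  have hc₀ : f 0 = a.hom := (hc 0).trans (by rw [ha])
  have hf (i : Fin (k + 2)) : Y.map i ≫ f i.succ = f i.castSucc ≫ X.map i := by
    rw [hc]
    induction i using Fin.lastCases with
    | last =>
      refine (_ ≫= hl).trans ?_
      refine (Category.assoc _ _ _).symm.trans ((h₂ =≫ p).trans ?_)
      exact (Category.assoc _ _ _).trans (_ ≫= hαp)
    | cast i => exact (_ ≫= hc i.succ).trans (h₁ i)
  have hn := h'.δ_natural c h f hf (𝟙 M) (by
    rw [hc₀, Category.id_comp, Category.assoc, ← Functor.map_comp, Iso.inv_hom_id,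
      CategoryTheory.Functor.map_id, Category.comp_id]) u (by
    rw [hq, hl, Category.assoc, hu, Functor.map_comp, Category.assoc])
  rwa [CategoryTheory.Functor.map_id, CategoryTheory.Functor.map_id, Category.comp_id] at hn

end Complete

end PreNAng

namespace PreNAng

/-! ### Twisting `δ` by a stable isomorphism -/

section

variable {A : Type u} [Category.{v} A] [Abelian A]

/-- An object whose identity factors through an injective is a retract of it. -/
lemma injective_of_toStable_map_id_eq_zero {P : A} (h : (toStable A).map (𝟙 P) = 0) :
    Injective P := by
  rw [← (toStable A).map_zero, toStable_map_eq_iff] at h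
  obtain ⟨J, hJ, a, b, hab⟩ := h
  rw [sub_zero] at hab
  exact ⟨fun g f _ => ⟨Injective.factorThru (g ≫ a) f ≫ b, by
    rw [Injective.comp_factorThru_assoc, Category.assoc, ← hab, Category.comp_id]⟩⟩

/-- The pullback of an extension `0 ⟶ K ⟶ J ⟶ B ⟶ 0` with `J` injective along a stable
isomorphism `B' ⟶ B` has an injective middle term. -/
lemma IsShortExact.exists_pullback (hA : ∀ J : A, Injective J → Projective J) {K J B B' : A}
    {ι : K ⟶ J} {q : J ⟶ B} (h : IsShortExact ι q) [Injective J] (u : B' ⟶ B)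
    [IsIso ((toStable A).map u)] :
    ∃ (P : A) (_ : Injective P) (κ : K ⟶ P) (q' : P ⟶ B') (p : P ⟶ J),
      IsShortExact κ q' ∧ κ ≫ p = ι ∧ q' ≫ u = p ≫ q := by
  have := h.mono
  have := h.epi
  let κ : K ⟶ pullback u q := pullback.lift 0 ι (by rw [zero_comp, h.w])
  have hκ : κ ≫ pullback.snd u q = ι := pullback.lift_snd _ _ _
  have hκ' : κ ≫ pullback.fst u q = 0 := pullback.lift_fst _ _ _
  have : Mono κ := by
    have : Mono (κ ≫ pullback.snd u q) := by rw [hκ]; infer_instance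
    exact mono_of_mono κ (pullback.snd u q)
  have hlift {Z : A} (x : Z ⟶ pullback u q) (hx : x ≫ pullback.fst u q = 0) :
      ∃ r, r ≫ κ = x := by
    obtain ⟨r, hr⟩ := h.exists_lift_kernel (x ≫ pullback.snd u q) (by
      rw [Category.assoc, ← pullback.condition, reassoc_of% hx, zero_comp])
    refine ⟨r, pullback.hom_ext ?_ ?_⟩
    · rw [Category.assoc, hκ', hx, comp_zero]
    · rw [Category.assoc, hκ, hr]
  have hs : IsShortExact κ (pullback.fst u q) := by
    refine isShortExact_of_exact hκ' ?_
    rw [ShortComplex.exact_iff_exact_up_to_refinements]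
    intro Z x hx
    obtain ⟨r, hr⟩ := hlift x hx
    exact ⟨Z, 𝟙 _, inferInstance, r, by rw [Category.id_comp]; exact hr.symm⟩
  refine ⟨pullback u q, injective_of_toStable_map_id_eq_zero ?_, κ, pullback.fst u q,
    pullback.snd u q, hs, hκ, pullback.condition⟩
  -- Followed by the stable isomorphism `u`, the projection passes through the injective `J`.
  have hq : (toStable A).map (pullback.fst u q) = 0 := by
    rw [← cancel_mono ((toStable A).map u), ← Functor.map_comp, pullback.condition, zero_comp]
    exact toStable_map_eq_zero _ _
  obtain ⟨v, hv⟩ := (toStable A).map_surjective (inv ((toStable A).map u))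
  -- `κ` extends along `ι` to `J`: if `v` is a stable inverse of `u`, then `1 - v ≫ u` factors
  -- through a projective and lifts along `q`. Correcting `1_J` by this lift gives a morphism over
  -- `q ≫ v`, hence one from `J` to the pullback.
  have hκ₀ : (toStable A).map κ = 0 := by
    have hvu : (toStable A).map (𝟙 B) = (toStable A).map (v ≫ u) := by
      rw [Functor.map_comp, hv, IsIso.inv_hom_id, CategoryTheory.Functor.map_id]
    obtain ⟨I, hI, a, b, hab⟩ := toStable_map_eq_iff.1 hvu
    have := hA I hI
    have ht : (q ≫ v) ≫ u = (𝟙 J - q ≫ a ≫ Projective.factorThru b q) ≫ q := by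
      rw [Preadditive.sub_comp, Category.assoc, Category.assoc, Category.assoc,
        Projective.factorThru_comp, ← hab, Preadditive.comp_sub]
      simp
    have : κ = ι ≫ pullback.lift (q ≫ v) _ ht := by
      apply pullback.hom_ext
      · rw [hκ', Category.assoc, pullback.lift_fst, reassoc_of% h.w, zero_comp]
      · rw [hκ, Category.assoc, pullback.lift_snd, Preadditive.comp_sub, reassoc_of% h.w]
        simp
    rw [this]
    exact toStable_map_eq_zero _ _
  rw [← (toStable A).map_zero, toStable_map_eq_iff] at hq
  obtain ⟨I, hI, a, b, hab⟩ := hq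
  have := hA I hI
  have : Epi (pullback.fst u q) := hs.epi
  -- A factorization of the projection through a projective lifts along the projection itself, so
  -- the identity of the pullback is a morphism through `κ` plus one through an injective, both
  -- stably zero.
  obtain ⟨r, hr⟩ := hlift (𝟙 _ - a ≫ Projective.factorThru b (pullback.fst u q)) (by
    rw [Preadditive.sub_comp, Category.assoc, Projective.factorThru_comp, ← hab]
    simp)
  have : 𝟙 (pullback u q) = r ≫ κ + a ≫ Projective.factorThru b (pullback.fst u q) := by
    rw [hr, sub_add_cancel]
  rw [this, Functor.map_add, Functor.map_comp, hκ₀, comp_zero, zero_add]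
  exact toStable_map_eq_zero _ _

end

section

variable {C : Type u} [Category.{v} C] [Preadditive C] [HasZeroObject C] [HasBinaryBiproducts C]
  {S : C ≌ C} {k : ℕ} [WeaklyFrobenius C] [IsIdempotentComplete C]

lemma IsShortExact.of_iso_middle {A : Type u} [Category.{v} A] [Preadditive A] {K J J' B : A}
    {i : K ⟶ J} {p : J ⟶ B} (h : IsShortExact i p) (e : J ≅ J') :
    IsShortExact (i ≫ e.hom) (e.inv ≫ p) where
  w := by rw [Category.assoc, e.hom_inv_id_assoc, h.w]
  isKernel := by
    have := h.mono
    have hl {Z : A} (f : Z ⟶ J') (hf : f ≫ e.inv ≫ p = 0) : ∃ g, g ≫ i ≫ e.hom = f := by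
      obtain ⟨g, hg⟩ := h.exists_lift_kernel (f ≫ e.inv) (by simpa using hf)
      exact ⟨g, by rw [reassoc_of% hg, e.inv_hom_id, Category.comp_id]⟩
    exact ⟨KernelFork.IsLimit.ofι' _ _ fun f hf => ⟨_, (hl f hf).choose_spec⟩⟩
  isCokernel := by
    have := h.epi
    have hd {Z : A} (f : J' ⟶ Z) (hf : (i ≫ e.hom) ≫ f = 0) : ∃ g, (e.inv ≫ p) ≫ g = f := by
      obtain ⟨g, hg⟩ := h.exists_desc (e.hom ≫ f) (by simpa using hf)
      exact ⟨g, by rw [Category.assoc, hg, e.inv_hom_id_assoc]⟩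
    exact ⟨CokernelCofork.IsColimit.ofπ' _ _ fun f hf => ⟨_, (hd f hf).choose_spec⟩⟩

/-- Represent `d ≫ (δ_X)⁻¹` by an endomorphism `u` of `S M` and pull the last extension back along
it. The new middle term is injective, hence representable, and `δ` becomes `u ≫ δ_X = d`. -/
lemma IsRes.exists_twist {X : NSeq S k} {M : FinPres C} {j : M ⟶ yon.obj (X.obj 0)}
    (h : IsRes X j) (c : CosyzygyChoice (FinPres C))
    (d : (toStable _).obj ((shift S).functor.obj M) ⟶ (c.omPow (k + 3)).obj ((toStable _).obj M))
    [IsIso d] :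
    ∃ (Y : NSeq S k) (a : Y.obj 0 ≅ X.obj 0) (b : Y.obj 1 ≅ X.obj 1)
      (h' : IsRes Y (j ≫ yon.map a.inv)), Y.first ≫ b.hom = a.hom ≫ X.first ∧ h'.δ c = d := by
  have := h.isIso_δ c
  obtain ⟨u, hu⟩ := (toStable _).map_surjective (d ≫ inv (h.δ c))
  have : IsIso ((toStable _).map u) := by rw [hu]; infer_instance
  obtain ⟨P, _, κ, q, p, hP, hκ, hq⟩ := h.ses_last.exists_pullback projective_of_injective u
  obtain ⟨E, ⟨e⟩⟩ := exists_iso_yon P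
  obtain ⟨p', hp'⟩ := yon.map_surjective (e.inv ≫ p)
  obtain ⟨Y, a, b, h', h₁, h₂⟩ := h.exists_replace_last c (hP.of_iso_middle e) p' u
    (by rw [hp', Category.assoc, e.hom_inv_id_assoc, hκ])
    (by rw [hp', Category.assoc, Category.assoc, hq])
  exact ⟨Y, a, b, h', h₁, by rw [h₂, hu, Category.assoc, IsIso.inv_hom_id, Category.comp_id]⟩

lemma isPreNAngulation_angles {N : Set (NSeq S k)} (hN : IsPreNAngulation S k N)
    {c : CosyzygyChoice (FinPres C)}
    (Θ : shiftTriangleFunctor (shift S) c ⟶ omTriangleFunctor c (k + 3))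
    [∀ M, IsIso (compAt Θ M)] : IsPreNAngulation S k (angles Θ) where
  directSum _ _ _ h hX hY := directSum_mem_angles h hX hY
  summand X Y Z h hZ := by
    obtain ⟨i₁, p₁, i₂, p₂, h⟩ := h
    exact retract_mem_angles hZ i₁ p₁ fun l => (h l).1
  trivial_mem X := trivial_mem_angles hN X
  complete f := by
    obtain ⟨X, hX, a, b, hab⟩ := hN.exists_weakExact f
    obtain ⟨M, j, h⟩ := (hN.isExact hX).exists_isRes
    obtain ⟨Y, a', b', h', hab', hY⟩ := h.exists_twist c (compAt Θ M)
    refine ⟨Y, h'.mem_angles_iff.2 (h'.defect_eq_zero_iff.2 hY), ⟨Arrow.isoMk (a' ≪≫ a) (b' ≪≫ b) ?_⟩⟩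
    simp [hab, reassoc_of% hab']
  rotate X Y h := rotate_mem_angles_iff h
  extend X hX Y hY φ₁ φ₂ h := exists_hom_of_mem_angles Θ hX hY φ₁ φ₂ h

end

end PreNAng

namespace PreNAng

/-! ### Inclusions between pre-`n`-angulations are equalities -/

namespace NSeq

section Sum

variable {C : Type u} [Category.{v} C] [Preadditive C] {S : C ≌ C} {k : ℕ}

/-- The composition of morphisms of `n`-`S`-sequences. -/
def Hom.comp {X Y Z : NSeq S k} (f : Hom X Y) (g : Hom Y Z) : Hom X Z where
  app i := f.app i ≫ g.app i
  comm i := by rw [← Category.assoc, f.comm, Category.assoc, g.comm, Category.assoc]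
  comm_last := by
    rw [Functor.map_comp, ← Category.assoc, f.comm_last, Category.assoc, g.comm_last,
      Category.assoc]

variable [S.functor.Additive]

/-- The difference of the identity and an endomorphism. -/
def Hom.idSub {X : NSeq S k} (f : Hom X X) : Hom X X where
  app i := 𝟙 _ - f.app i
  comm i := by simp [Preadditive.comp_sub, Preadditive.sub_comp, f.comm]
  comm_last := by simp [Preadditive.comp_sub, Preadditive.sub_comp, f.comm_last]

/-- The sum of two morphisms of `n`-`S`-sequences. -/
def Hom.add {X Y : NSeq S k} (f g : Hom X Y) : Hom X Y where
  app i := f.app i + g.app i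
  comm i := by rw [Preadditive.comp_add, Preadditive.add_comp, f.comm, g.comm]
  comm_last := by
    rw [Functor.map_add, Preadditive.comp_add, Preadditive.add_comp, f.comm_last, g.comm_last]

variable [HasBinaryBiproducts C]

lemma exists_isDirectSum (X Y : NSeq S k) : ∃ Z, IsDirectSum X Y Z := by
  let Z : NSeq S k :=
    { obj := fun i => X.obj i ⊞ Y.obj i
      map := fun i => biprod.map (X.map i) (Y.map i)
      last := biprod.desc (X.last ≫ S.functor.map biprod.inl) (Y.last ≫ S.functor.map biprod.inr) }
  refine ⟨Z, ⟨fun i => biprod.inl, fun i => ?_, ?_⟩, ⟨fun i => biprod.fst, fun i => ?_, ?_⟩,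
    ⟨fun i => biprod.inr, fun i => ?_, ?_⟩, ⟨fun i => biprod.snd, fun i => ?_, ?_⟩, fun i => ?_⟩
  · simp [Z]
  · simp [Z]
  · simp [Z]
  · ext <;> simp [Z, ← Functor.map_comp]
  · simp [Z]
  · simp [Z]
  · simp [Z]
  · ext <;> simp [Z, ← Functor.map_comp]
  · simp [Z, biprod.total]

/-- The complement is obtained by splitting the idempotent endomorphism `1 - g ≫ f` of `Z` in each
position. -/
lemma exists_isDirectSum_of_retract [IsIdempotentComplete C] {X Z : NSeq S k} (f : Hom X Z)
    (g : Hom Z X) (h : ∀ i, f.app i ≫ g.app i = 𝟙 _) : ∃ Y, IsDirectSum X Y Z := by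
  obtain ⟨ε, hε⟩ : ∃ ε : Hom Z Z, ε = (g.comp f).idSub := ⟨_, rfl⟩
  have hε' (i) : ε.app i = 𝟙 _ - g.app i ≫ f.app i := by rw [hε]; rfl
  choose Y t r htr hrt using fun i => IsIdempotentComplete.idempotents_split (Z.obj i) (ε.app i)
    (by simp [hε', Preadditive.comp_sub, Preadditive.sub_comp, reassoc_of% h])
  have htε (i) : t i ≫ ε.app i = t i := by
    rw [← hrt, ← Category.assoc, htr, Category.id_comp]
  have hεr (i) : ε.app i ≫ r i = r i := by
    rw [← hrt, Category.assoc, htr, Category.comp_id]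
  refine ⟨⟨Y, fun i => t _ ≫ Z.map i ≫ r _, t _ ≫ Z.last ≫ S.functor.map (r 0)⟩, f, g,
    ⟨t, fun i => ?_, ?_⟩, ⟨r, fun i => ?_, ?_⟩, fun i => ⟨h i, htr i, ?_, ?_, ?_⟩⟩
  · simp only [Category.assoc]
    rw [hrt, ε.comm, ← Category.assoc, htε]
  · simp only [Category.assoc]
    rw [← Functor.map_comp, hrt, ε.comm_last, ← Category.assoc, htε]
  · have : r i.castSucc ≫ t i.castSucc ≫ Z.map i ≫ r i.succ = Z.map i ≫ r i.succ := by
      rw [← Category.assoc, hrt, ← Category.assoc, ← ε.comm, Category.assoc, hεr]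
    exact this.symm
  · have : r (Fin.last _) ≫ t (Fin.last _) ≫ Z.last ≫ S.functor.map (r 0) =
        Z.last ≫ S.functor.map (r 0) := by
      rw [← Category.assoc, hrt, ← Category.assoc, ← ε.comm_last, Category.assoc,
        ← Functor.map_comp, hεr]
    exact this.symm
  · change f.app i ≫ r i = 0
    rw [← hεr, hε', ← Category.assoc, Preadditive.comp_sub, ← Category.assoc, h]
    simp
  · change t i ≫ g.app i = 0
    rw [← htε, hε', Category.assoc, Preadditive.sub_comp, Category.assoc, h]
    simp
  · change _ + r i ≫ t i = _
    rw [hrt, hε']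
    simp

end Sum

/-! ### Endomorphisms that factor through a disk -/

section Disk

variable {C : Type u} [Category.{v} C] [Preadditive C] {S : C ≌ C} {k : ℕ}
  [S.functor.Additive]

/-- Only the middle square and its neighbours need checking. The condition `i ≠ 0` makes the
component at `0` vanish, so the closing square reduces to `h₃`. -/
lemma exists_hom_of_pair {X Y : NSeq S k} (i : Fin (k + 2)) (hi : i ≠ 0)
    (f : ∀ l, X.obj l ⟶ Y.obj l) (h : X.map i ≫ f i.succ = f i.castSucc ≫ Y.map i)
    (h₁ : ∀ l : Fin (k + 2), l.succ = i.castSucc → X.map l ≫ f l.succ = 0)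
    (h₂ : ∀ l : Fin (k + 2), l.castSucc = i.succ → f l.castSucc ≫ Y.map l = 0)
    (h₃ : i = Fin.last _ → f (Fin.last _) ≫ Y.last = 0) :
    ∃ φ : Hom X Y, φ.app i.castSucc = f i.castSucc ∧ φ.app i.succ = f i.succ ∧
      ∀ l, l < i.castSucc → φ.app l = 0 := by
  let φ (l : Fin (k + 3)) : X.obj l ⟶ Y.obj l := if l = i.castSucc ∨ l = i.succ then f l else 0
  have hφ (l : Fin (k + 3)) (hl : l = i.castSucc ∨ l = i.succ) : φ l = f l := if_pos hl
  have hφ' (l : Fin (k + 3)) (hl : l ≠ i.castSucc) (hl' : l ≠ i.succ) : φ l = 0 :=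
    if_neg (by simp [hl, hl'])
  have hφ₀ : φ 0 = 0 := hφ' 0 (fun H => hi (Fin.ext (by simpa using congr(($H).1).symm)))
    (Fin.succ_ne_zero i).symm
  refine ⟨⟨φ, fun l => ?_, ?_⟩, hφ _ (.inl rfl), hφ _ (.inr rfl), fun l hl => ?_⟩
  · by_cases hl : l = i
    · subst hl
      rw [hφ _ (.inl rfl), hφ _ (.inr rfl), h]
    · have hl₁ : l.succ ≠ i.succ := fun H => hl (Fin.succ_injective _ H)
      have hl₂ : l.castSucc ≠ i.castSucc := fun H => hl (Fin.castSucc_injective _ H)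
      trans 0
      · by_cases hl₃ : l.succ = i.castSucc
        · rw [hφ _ (.inl hl₃), h₁ l hl₃]
        · rw [hφ' _ hl₃ hl₁, comp_zero]
      · by_cases hl₃ : l.castSucc = i.succ
        · rw [hφ _ (.inr hl₃), h₂ l hl₃]
        · rw [hφ' _ hl₂ hl₃, zero_comp]
  · rw [hφ₀, Functor.map_zero, comp_zero]
    by_cases hl : i = Fin.last _
    · subst hl
      have : φ (Fin.last _) = f (Fin.last _) := hφ _ (.inr rfl)
      rw [this, h₃ rfl]
    · rw [hφ' _ (Fin.castSucc_ne_last _).symm (fun H => hl (Fin.succ_injective _ H.symm)), zero_comp]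
  · exact hφ' _ hl.ne (hl.trans i.castSucc_lt_succ).ne

lemma exists_family {X Y : NSeq S k} (i : Fin (k + 2))
    (x : X.obj i.castSucc ⟶ Y.obj i.castSucc) (y : X.obj i.succ ⟶ Y.obj i.succ) :
    ∃ f : ∀ l, X.obj l ⟶ Y.obj l, f i.castSucc = x ∧ f i.succ = y :=
  ⟨Function.update (Function.update (fun _ => 0) i.castSucc x) i.succ y, by
    rw [Function.update_of_ne i.castSucc_lt_succ.ne, Function.update_self],
    Function.update_self ..⟩

variable [HasZeroObject C] [HasBinaryBiproducts C]

/-- Up to the identification `e`, the pair is `(α ≫ s, s)` into the disk and `(1, α)` out of it,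
with `α = X.map i.succ`; the neighbouring squares hold because consecutive morphisms of `X` compose
to zero. -/
lemma IsDisk.exists_factor {X T : NSeq S k} (hX : X.IsExact) {i : Fin (k + 1)}
    (hT : T.IsDisk i.succ) (e : T.obj i.succ.castSucc ≅ X.obj i.succ.castSucc)
    (s : X.obj i.succ.succ ⟶ X.obj i.succ.castSucc) :
    ∃ (φ : Hom X T) (ψ : Hom T X),
      φ.app i.succ.castSucc ≫ ψ.app i.succ.castSucc = X.map i.succ ≫ s ∧
      ∀ l, l < i.succ.castSucc → φ.app l ≫ ψ.app l = 0 := by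
  have := hT.isIso
  obtain ⟨f, hf₀, hf₁⟩ := exists_family (X := X) (Y := T) i.succ (X.map i.succ ≫ s ≫ e.inv)
    (s ≫ e.inv ≫ T.map i.succ)
  obtain ⟨g, hg₀, hg₁⟩ := exists_family (X := T) (Y := X) i.succ e.hom
    (inv (T.map i.succ) ≫ e.hom ≫ X.map i.succ)
  obtain ⟨φ, h₁, h₂, h₃⟩ := exists_hom_of_pair (X := X) (Y := T) i.succ (Fin.succ_ne_zero i) f
    (by rw [hf₀, hf₁]; simp)
    (fun l hl => by
      obtain rfl : l = i.castSucc := Fin.ext (by simpa using congr(($hl).1))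
      refine (_ ≫= hf₀).trans ((Category.assoc _ _ _).symm.trans ?_)
      exact ((hX.mid i).w =≫ _).trans zero_comp)
    (fun l hl => (hT.isZero l.succ
      (fun H => by have := congr(($H).1); have := congr(($hl).1); simp at *; omega)
      (fun H => by have := congr(($H).1); have := congr(($hl).1); simp at *; omega)).eq_of_tgt _ _)
    (fun _ => (S.functor.map_isZero (hT.isZero 0
      (fun H => by have := congr(($H).1); simp at this)
      (fun H => by have := congr(($H).1); simp at this))).eq_of_tgt _ _)
  obtain ⟨ψ, h₁', h₂', h₃'⟩ := exists_hom_of_pair (X := T) (Y := X) i.succ (Fin.succ_ne_zero i) g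
    (by rw [hg₀, hg₁]; simp)
    (fun l hl => (hT.isZero l.castSucc
      (fun H => by have := congr(($H).1); have := congr(($hl).1); simp at *; omega)
      (fun H => by have := congr(($H).1); have := congr(($hl).1); simp at *; omega)).eq_of_src _ _)
    (fun l hl => by
      obtain ⟨l, rfl⟩ := Fin.exists_succ_eq.2 (show l ≠ 0 by
        rintro rfl
        exact Fin.succ_ne_zero _ hl.symm)
      obtain ⟨i, rfl⟩ := Fin.exists_castSucc_eq.2 (show i ≠ Fin.last _ by
        rintro rfl
        have := congr(($hl).1)
        simp at this
        omega)
      obtain rfl : l = i.succ := Fin.ext (by simpa using congr(($hl).1))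
      refine (hg₁ =≫ _).trans ?_
      simp only [Category.assoc]
      refine (_ ≫= _ ≫= (hX.mid i.succ).w).trans ?_
      simp)
    (fun hl => by
      obtain rfl : i = Fin.last _ := Fin.succ_injective _ hl
      refine (hg₁ =≫ _).trans ?_
      simp only [Category.assoc]
      refine (_ ≫= _ ≫= hX.pre.w).trans ?_
      simp)
  refine ⟨φ, ψ, ?_, fun l hl => by rw [h₃ l hl, zero_comp]⟩
  rw [h₁, h₁', hf₀, hg₀]
  simp

end Disk

end NSeq

end PreNAng

namespace PreNAng

/-! ### Improving a retraction position by position -/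

namespace IsPreNAngulation

variable {C : Type u} [Category.{v} C] [Preadditive C] [HasZeroObject C] [HasBinaryBiproducts C]
  {S : C ≌ C} {k : ℕ} {N : Set (NSeq S k)} (hN : IsPreNAngulation S k N)

include hN

lemma exists_factor_first {N' : Set (NSeq S k)} (hN' : IsPreNAngulation S k N') (h : N ⊆ N')
    {X : NSeq S k} (hX : X ∈ N') :
    ∃ Z ∈ N, ∃ (f : NSeq.Hom X Z) (g : NSeq.Hom Z X), f.app 0 ≫ g.app 0 = 𝟙 _ ∧
      f.app 1 ≫ g.app 1 = 𝟙 _ := by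
  obtain ⟨Z, hZ, a, b, hab⟩ := hN.exists_weakExact X.first
  obtain ⟨f, hf₀, hf₁⟩ := hN'.extend X hX Z (h hZ) a.inv b.inv
    (by rw [Iso.eq_inv_comp, ← reassoc_of% hab, Iso.hom_inv_id, Category.comp_id])
  obtain ⟨g, hg₀, hg₁⟩ := hN'.extend Z (h hZ) X hX a.hom b.hom hab
  exact ⟨Z, hZ, f, g, by rw [hf₀, hg₀, Iso.inv_hom_id], by rw [hf₁, hg₁, Iso.inv_hom_id]⟩

variable [WeaklyFrobenius C]

/-- The error `1 - f ≫ g` vanishes just before the new position, so there it factors as `X.map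
i.succ ≫ s`. Adding a disk of `N` to `Z` supplies exactly this endomorphism and changes nothing
earlier. -/
lemma exists_factor_step {X : NSeq S k} (hX : X.IsExact) (i : Fin (k + 1))
    (H : ∃ Z ∈ N, ∃ (f : NSeq.Hom X Z) (g : NSeq.Hom Z X),
      ∀ l, l ≤ i.castSucc.castSucc → f.app l ≫ g.app l = 𝟙 _) :
    ∃ Z ∈ N, ∃ (f : NSeq.Hom X Z) (g : NSeq.Hom Z X),
      ∀ l, l ≤ i.succ.castSucc → f.app l ≫ g.app l = 𝟙 _ := by
  obtain ⟨Z, hZ, f, g, hfg⟩ := H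
  let h := (f.comp g).idSub
  have h₀ (l) : h.app l = 𝟙 _ - f.app l ≫ g.app l := rfl
  obtain ⟨s, hs⟩ := (hX.mid i).exists_desc (h.app i.succ.castSucc) (by
    refine (h.comm i.castSucc).trans ?_
    rw [h₀, hfg _ le_rfl, sub_self, zero_comp])
  obtain ⟨T, hT, hTi, ⟨e⟩⟩ := hN.exists_disk i.succ (X.obj i.succ.castSucc)
  obtain ⟨f', g', h₁, h₂⟩ := hTi.exists_factor hX e s
  obtain ⟨Y, hY⟩ := NSeq.exists_isDirectSum Z T
  have hY' := hN.directSum _ _ _ hY hZ hT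
  obtain ⟨i₁, p₁, i₂, p₂, hip⟩ := hY
  refine ⟨Y, hY', (f.comp i₁).add (f'.comp i₂), (p₁.comp g).add (p₂.comp g'), fun l hl => ?_⟩
  have key : (f.app l ≫ i₁.app l + f'.app l ≫ i₂.app l) ≫ (p₁.app l ≫ g.app l + p₂.app l ≫ g'.app l) =
      f.app l ≫ g.app l + f'.app l ≫ g'.app l := by
    obtain ⟨e₁, e₂, e₃, e₄, -⟩ := hip l
    simp only [Preadditive.comp_add, Preadditive.add_comp, Category.assoc]
    simp [reassoc_of% e₁, reassoc_of% e₂, reassoc_of% e₃, reassoc_of% e₄]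
  refine key.trans ?_
  obtain rfl | hl := hl.eq_or_lt
  · rw [h₁]
    have : X.map i.succ ≫ s = 𝟙 _ - f.app i.succ.castSucc ≫ g.app i.succ.castSucc := hs
    rw [this, add_sub_cancel]
  · rw [h₂ l hl, add_zero, hfg l (Fin.le_def.2 ?_)]
    have := Fin.lt_def.1 hl
    simp at this ⊢
    omega

/-- The error `h = 1 - f ≫ g` now lives in the last position only. There it factors through `αₙ` and
is killed by `αₙ`, so `h ≫ h = 0`, and `f ≫ g ≫ (1 + h) = (1 - h) ≫ (1 + h) = 1` exhibits `X` as a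
summand of `Z`. -/
lemma mem_of_factor [IsIdempotentComplete C] {X : NSeq S k} (hX : X.IsExact)
    (H : ∃ Z ∈ N, ∃ (f : NSeq.Hom X Z) (g : NSeq.Hom Z X),
      ∀ l, l ≤ (Fin.last (k + 1)).castSucc → f.app l ≫ g.app l = 𝟙 _) : X ∈ N := by
  obtain ⟨Z, hZ, f, g, hfg⟩ := H
  let h := (f.comp g).idSub
  have h₀ (l) : h.app l = 𝟙 _ - f.app l ≫ g.app l := rfl
  have h₁ (l) : (f.app l ≫ (g.app l + g.app l ≫ h.app l)) = 𝟙 _ - h.app l ≫ h.app l := by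
    rw [h₀]
    simp only [Preadditive.comp_add, Preadditive.comp_sub, Preadditive.sub_comp, Category.comp_id,
      Category.id_comp, Category.assoc]
    abel
  have hc (i : Fin (k + 2)) : h.app i.castSucc = 0 := by
    rw [h₀, hfg _ (Fin.castSucc_le_castSucc_iff.2 (Fin.le_last i)), sub_self]
  have h₂ (l) : h.app l ≫ h.app l = 0 := by
    induction l using Fin.lastCases with
    | last =>
      obtain ⟨s, hs⟩ := hX.pre.exists_desc (h.app (Fin.last _)) (by
        refine (h.comm (Fin.last _)).trans ?_
        rw [hc, zero_comp])
      have : h.app (Fin.last _) ≫ X.last = 0 := by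
        have hz : h.app 0 = 0 := hc 0
        rw [← h.comm_last, hz, Functor.map_zero, comp_zero]
      rw [← zero_comp (f := s), ← this, Category.assoc, hs]
    | cast l => rw [hc, zero_comp]
  obtain ⟨Y, hY⟩ := NSeq.exists_isDirectSum_of_retract f (g.add (g.comp h)) (fun l =>
    (h₁ l).trans (by rw [h₂, sub_zero]))
  exact hN.summand _ _ _ hY hZ

/-- An `n`-angle of `N'` is compared with one of `N` that has the same first morphism. (F3) in `N'`
gives a retraction in the first two positions, disks of `N` improve it up to the last but one, and
nilpotence of the remaining error completes it. -/
lemma eq_of_subset [IsIdempotentComplete C] {N' : Set (NSeq S k)}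
    (hN' : IsPreNAngulation S k N') (h : N ⊆ N') : N = N' := by
  refine h.antisymm fun X hX => ?_
  have hX' := hN'.isExact hX
  have key (i : Fin (k + 1)) : ∃ Z ∈ N, ∃ (f : NSeq.Hom X Z) (g : NSeq.Hom Z X),
      ∀ l, l ≤ i.succ.castSucc → f.app l ≫ g.app l = 𝟙 _ := by
    induction i using Fin.induction with
    | zero =>
      obtain ⟨Z, hZ, f, g, h₀, h₁⟩ := hN.exists_factor_first hN' h hX
      refine ⟨Z, hZ, f, g, fun l hl => ?_⟩
      obtain rfl | hl := hl.eq_or_lt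
      · exact h₁
      · obtain rfl : l = 0 := Fin.ext (by simpa using Fin.lt_def.1 hl)
        exact h₀
    | succ i ih => exact hN.exists_factor_step hX' i.succ ih
  exact hN.mem_of_factor hX' (key (Fin.last k))

end IsPreNAngulation

end PreNAng

namespace PreNAng

/-! ### The classification -/

section Classification

variable {C : Type u} [Category.{v} C] [Preadditive C] [HasZeroObject C] [HasBinaryBiproducts C]
  {S : C ≌ C} {k : ℕ} [WeaklyFrobenius C] {c : CosyzygyChoice (FinPres C)}

lemma isDeltaOf_iff {N : PreNAngulation S k}
    {Θ : shiftTriangleFunctor (shift S) c ≅ omTriangleFunctor c (k + 3)} :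
    IsDeltaOf c N Θ ↔ N.1 ⊆ angles Θ.hom := by
  refine ⟨fun h X hX => ⟨N.2.isExact hX, fun M j hj => ?_⟩, fun h X hX M j w hj => ?_⟩
  · exact ((hj.isDelta_iff c).1 (h X hX M j hj.w hj.isKernel)).symm
  · have hM : IsRes X j := ⟨N.2.isExact hX, w, hj⟩
    exact (hM.isDelta_iff c).2 ((h hX).2 M j hM).symm

instance (Θ : shiftTriangleFunctor (shift S) c ≅ omTriangleFunctor c (k + 3)) (M : FinPres C) :
    IsIso (compAt Θ.hom M) :=
  ⟨Θ.inv.nat.app ((toStable _).obj M),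
    congr(($(congrArg SuspFunctor.Hom.nat Θ.hom_inv_id)).app ((toStable _).obj M)),
    congr(($(congrArg SuspFunctor.Hom.nat Θ.inv_hom_id)).app ((toStable _).obj M))⟩

/-- Every `M` is the kernel attached to some `n`-angle of `N`, so all components are prescribed. -/
lemma eq_of_isDeltaOf {N : PreNAngulation S k}
    {Θ Θ' : shiftTriangleFunctor (shift S) c ≅ omTriangleFunctor c (k + 3)}
    (h : IsDeltaOf c N Θ) (h' : IsDeltaOf c N Θ') : Θ = Θ' := by
  rw [isDeltaOf_iff] at h h'
  refine Iso.ext (SuspFunctor.Hom.ext (NatTrans.ext (funext fun M => ?_)))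
  obtain ⟨M⟩ := M
  obtain ⟨X, hX, j, hj⟩ := N.2.exists_isRes M
  exact ((h hX).2 M j hj).symm.trans ((h' hX).2 M j hj)

variable [IsIdempotentComplete C]

lemma exists_isDeltaOf (N : PreNAngulation S k) (c : CosyzygyChoice (FinPres C)) :
    ∃ Θ, IsDeltaOf c N Θ := by
  obtain ⟨Θ, hΘ⟩ := N.2.exists_iso c
  exact ⟨Θ, isDeltaOf_iff.2 fun X hX => ⟨N.2.isExact hX, fun M j h => hΘ X hX M j h⟩⟩

lemma eq_angles_of_isDeltaOf {N : PreNAngulation S k}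
    {Θ : shiftTriangleFunctor (shift S) c ≅ omTriangleFunctor c (k + 3)}
    (h : IsDeltaOf c N Θ) : N.1 = angles Θ.hom :=
  N.2.eq_of_subset (isPreNAngulation_angles N.2 Θ.hom) (isDeltaOf_iff.1 h)

end Classification

/-- The action by composition on a type which is in bijection with the isomorphisms to `G`. -/
abbrev autMulAction {D : Type*} [Category* D] {F G : D} {P : Type*} (e : P ≃ (F ≅ G)) :
    MulAction (Aut G) P where
  smul g p := e.symm (e p ≪≫ g)
  one_smul p := by
    change e.symm (e p ≪≫ Iso.refl G) = p
    rw [Iso.trans_refl, e.symm_apply_apply]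
  mul_smul g h p := by
    -- In `Aut G` the product `g * h` is `h` followed by `g`, so composition after `e p` is a left
    -- action.
    change e.symm (e p ≪≫ h ≪≫ g) = e.symm (e (e.symm (e p ≪≫ h)) ≪≫ g)
    rw [e.apply_symm_apply]
    exact congrArg e.symm (Iso.trans_assoc (e p) h g).symm

end PreNAng

theorem mainTheorem2 {C : Type u} [Category.{v} C] [Preadditive C] [HasZeroObject C]
    [HasBinaryBiproducts C] [IsIdempotentComplete C] (S : C ≌ C) (k : ℕ)
    (hN : Nonempty (PreNAng.PreNAngulation S k)) :
    Nonempty (PreNAng.CosyzygyChoice (PreNAng.FinPres C)) ∧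
    ∀ c : PreNAng.CosyzygyChoice (PreNAng.FinPres C),
      ∃ δ : PreNAng.PreNAngulation S k →
          (PreNAng.shiftTriangleFunctor (PreNAng.shift S) c ≅
            PreNAng.omTriangleFunctor c (k + 3)),
        (∀ N Θ, PreNAng.IsDeltaOf c N Θ ↔ Θ = δ N) ∧
        Function.Bijective δ ∧
        ∃ _ : MulAction (Aut (PreNAng.omTriangleFunctor c (k + 3)))
            (PreNAng.PreNAngulation S k),
          (∀ (g : Aut (PreNAng.omTriangleFunctor c (k + 3))) (N : PreNAng.PreNAngulation S k),
            δ (g • N) = δ N ≪≫ g) ∧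
          ∀ N N' : PreNAng.PreNAngulation S k,
            ∃! g : Aut (PreNAng.omTriangleFunctor c (k + 3)), g • N = N' := by
  obtain ⟨N₀⟩ := hN
  have := N₀.2.weaklyFrobenius
  refine ⟨PreNAng.nonempty_cosyzygyChoice, fun c => ?_⟩
  choose δ hδ using fun N : PreNAng.PreNAngulation S k => PreNAng.exists_isDeltaOf N c
  have hδ' (N Θ) : PreNAng.IsDeltaOf c N Θ ↔ Θ = δ N :=
    ⟨fun h => PreNAng.eq_of_isDeltaOf h (hδ N), fun h => h ▸ hδ N⟩
  have hb : Function.Bijective δ := by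
    refine ⟨fun N N' h => Subtype.ext ?_, fun Θ => ?_⟩
    · rw [PreNAng.eq_angles_of_isDeltaOf (hδ N), PreNAng.eq_angles_of_isDeltaOf (hδ N'), h]
    -- The given `N₀` serves as the source of exact sequences that are twisted into those with `δ_X
    -- = Θ_M`.
    · let N : PreNAng.PreNAngulation S k :=
        ⟨PreNAng.angles Θ.hom, PreNAng.isPreNAngulation_angles N₀.2 Θ.hom⟩
      exact ⟨N, ((hδ' N Θ).1 (PreNAng.isDeltaOf_iff.2 subset_rfl)).symm⟩
  let e := Equiv.ofBijective δ hb
  refine ⟨δ, hδ', hb, PreNAng.autMulAction e, fun g N => e.apply_symm_apply _, fun N N' => ?_⟩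
  refine ⟨(δ N).symm ≪≫ δ N', ?_, fun g hg => ?_⟩
  · change e.symm (δ N ≪≫ (δ N).symm ≪≫ δ N') = N'
    rw [Iso.self_symm_id_assoc]
    exact e.symm_apply_apply N'
  · have : δ N' = δ N ≪≫ g := (congrArg δ hg).symm.trans (e.apply_symm_apply _)
    rw [this]
    exact (Iso.symm_self_id_assoc (δ N) g).symm
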